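/- Let $R\in\mathbb{C}[x,y]$ be a nonzero polynomial and let $A=\mathbb{C}[x,y]/(R)$. Write $x_1=x$, $x_2=y$, and let $\partial_iR\in A$ denote the class of $\partial R/\partial x_i$. Let $C^n$ be the space of $\mathbb{C}$-multilinear maps $A^n\to A$, with the Hochschild differential $$(\delta C)(a_1,\dots,a_{n+1})=a_1C(a_2,\dots,a_{n+1})+\sum_{i=1}^{n}(-1)^iC(a_1,\dots,a_ia_{i+1},\dots,a_{n+1})+(-1)^{n+1}C(a_1,\dots,a_n)a_{n+1},$$ and let $H^n$ be its $n$-th cohomology. For each $k$ let $H^{n,k}$ be the Barr–Gerstenhaber–Schack (Hodge) component of $H^n$, that is, the degree-$n$ cohomology of the subcomplex $C^{\bullet,k}$ with $C^{n,k}=\{C\circ e_n(k): C\in C^n\}$. Here the idempotents $e_n(k)\in\mathbb{C}[S_n]$ are given by $$\sum_k t^k e_n(k)=\frac1{n!}\sum_{\sigma\in S_n}(t-d_\sigma)(t-d_\sigma+1)\cdots(t-d_\sigma+n-1)\,\mathrm{sgn}(\sigma)\,\sigma ,$$ where $d_\sigma$ is the number of $i$ with $\sigma(i)>\sigma(i+1)$,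 and $\sigma$ acts on $A^{\otimes n}$ by $\sigma(a_1\otimes\cdots\otimes a_n)=a_{\sigma^{-1}(1)}\otimes\cdots\otimes a_{\sigma^{-1}(n)}$. Let $DR=(\partial_1R,\partial_2R)\subset A$ be the gradient ideal, and let $A_+\subset A$ be the image of the polynomials without constant term. Let $V_R$ be the space of vector fields $v=v_1\partial_1+v_2\partial_2$ with $v_i\in A$ that annihilate $R$, i.e. $v_1\partial_1R+v_2\partial_2R=0$ in $A$. Let $dR^*=\partial_2R\,\partial_1-\partial_1R\,\partial_2\in V_R$. Then, as complex vector spaces, $$H^1\cong V_R,$$ and for every $k>0$ $$H^{2k,k}\cong A/DR,\qquad H^{2k,k+1}\cong\{a\in A_+ : a\,\partial_1R=a\,\partial_2R=0\},\qquad H^{2k+1,k+1}\cong V_R/(A\cdot dR^*).$$ All other components in positive degree vanish: $H^{n,j}=0$ whenever $n>0$ and $2j\notin\{n,n+1,n+2\}$. -/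

import Mathlib

open scoped BigOperators

noncomputable section

/-- The quotient space `Z / (Z ∩ B)` of two subspaces of a vector space; it is `Z / B` when
`B ⊆ Z`. -/
abbrev Subquotient {V : Type*} [AddCommGroup V] [Module ℂ V] (Z B : Submodule ℂ V) : Type _ :=
  Z ⧸ B.submoduleOf Z

/-! ## The Hochschild complex of a commutative algebra and its Hodge decomposition -/

namespace Hochschild

variable (A : Type*) [CommRing A] [Algebra ℂ A]

/-- Hochschild `n`-cochains of `A` with values in `A`: multilinear maps `A × ⋯ × A → A`,
that is, linear maps `A^{⊗ n} → A`. -/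
abbrev Cochain (n : ℕ) : Type _ := MultilinearMap ℂ (fun _ : Fin n => A) A

variable {A}

/-- Changing one entry of a tuple changes exactly one entry of the contracted tuple
`(a₀, …, aⱼaⱼ₊₁, …, aₙ)`, and does so linearly. -/
theorem contractNth_update {n : ℕ} (j : Fin n) (a : Fin (n + 1) → A) (m : Fin (n + 1)) :
    ∃ (m' : Fin n) (l : A →ₗ[ℂ] A), ∀ x : A,
      Fin.contractNth j.castSucc (· * ·) (Function.update a m x) =
        Function.update (Fin.contractNth j.castSucc (· * ·) a) m' (l x) := by
  rcases lt_trichotomy (m : ℕ) (j : ℕ) with h | h | h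
  · refine ⟨⟨m, by omega⟩, LinearMap.id, fun x => ?_⟩
    funext i
    simp only [Fin.contractNth, Function.update_apply, Fin.ext_iff, Fin.val_castSucc,
      Fin.val_succ, LinearMap.id_apply]
    split_ifs <;> first | rfl | omega
  · refine ⟨j, LinearMap.mulRight ℂ (a j.succ), fun x => ?_⟩
    funext i
    simp only [Fin.contractNth, Function.update_apply, Fin.ext_iff, Fin.val_castSucc,
      Fin.val_succ, LinearMap.mulRight_apply]
    split_ifs with h1 h2 h3 <;> first | rfl | omega | skip
    all_goals
      have : i = j := by ext; omega
      rw [this]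
  · by_cases h' : (m : ℕ) = j + 1
    · refine ⟨j, LinearMap.mulLeft ℂ (a j.castSucc), fun x => ?_⟩
      funext i
      simp only [Fin.contractNth, Function.update_apply, Fin.ext_iff, Fin.val_castSucc,
        Fin.val_succ, LinearMap.mulLeft_apply]
      split_ifs with h1 h2 h3 <;> first | rfl | omega | skip
      all_goals
        have : i = j := by ext; omega
        rw [this]
    · refine ⟨⟨m - 1, by omega⟩, LinearMap.id, fun x => ?_⟩
      funext i
      simp only [Fin.contractNth, Function.update_apply, Fin.ext_iff, Fin.val_castSucc,
        Fin.val_succ, LinearMap.id_apply]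
      split_ifs <;> first | rfl | omega

/-- The cochain `(a₀, …, aₙ) ↦ C(a₀, …, aⱼaⱼ₊₁, …, aₙ)`. -/
def face {n : ℕ} (j : Fin n) (C : Cochain A n) : Cochain A (n + 1) where
  toFun a := C (Fin.contractNth j.castSucc (· * ·) a)
  map_update_add' a m x y := by
    rename_i inst
    obtain rfl : inst = instDecidableEqFin (n + 1) := Subsingleton.elim _ _
    obtain ⟨m', l, h⟩ := contractNth_update j a m
    simp only [h, map_add, MultilinearMap.map_update_add]
  map_update_smul' a m c x := by
    rename_i inst
    obtain rfl : inst = instDecidableEqFin (n + 1) := Subsingleton.elim _ _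
    obtain ⟨m', l, h⟩ := contractNth_update j a m
    simp only [h, map_smul, MultilinearMap.map_update_smul]

/-- The cochain `(a₀, …, aₙ) ↦ a₀ C(a₁, …, aₙ)`. -/
def firstFace {n : ℕ} (C : Cochain A n) : Cochain A (n + 1) :=
  LinearMap.uncurryLeft (M := fun _ : Fin (n + 1) => A)
    { toFun := fun a => a • C
      map_add' := fun a b => add_smul a b C
      map_smul' := fun c a => MultilinearMap.ext fun v => smul_assoc c a (C v) }

/-- The cochain `(a₀, …, aₙ) ↦ C(a₀, …, aₙ₋₁) aₙ`. -/
def lastFace {n : ℕ} (C : Cochain A n) : Cochain A (n + 1) :=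
  MultilinearMap.uncurryRight ((LinearMap.mul ℂ A).compMultilinearMap C)

variable (A)

/-- The Hochschild coboundary
`(δC)(a₀, …, aₙ) = a₀ C(a₁, …, aₙ) + ∑ⱼ (-1)^(j+1) C(a₀, …, aⱼaⱼ₊₁, …, aₙ)
  + (-1)^(n+1) C(a₀, …, aₙ₋₁) aₙ`. -/
def coboundary (n : ℕ) : Cochain A n →ₗ[ℂ] Cochain A (n + 1) where
  toFun C := firstFace C + ∑ j : Fin n, (-1 : ℂ) ^ ((j : ℕ) + 1) • face j C
    + (-1 : ℂ) ^ (n + 1) • lastFace C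
  map_add' C D := by
    ext a
    simp only [firstFace, lastFace, face, _root_.add_apply, _root_.sum_apply,
      _root_.smul_apply, LinearMap.uncurryLeft_apply, MultilinearMap.uncurryRight_apply,
      LinearMap.coe_mk, AddHom.coe_mk, MultilinearMap.coe_mk,
      LinearMap.compMultilinearMap_apply, LinearMap.mul_apply', smul_add, add_mul,
      Finset.sum_add_distrib]
    abel
  map_smul' c C := by
    ext a
    simp only [firstFace, lastFace, face, _root_.add_apply, _root_.sum_apply,
      _root_.smul_apply, LinearMap.uncurryLeft_apply, MultilinearMap.uncurryRight_apply,
      LinearMap.coe_mk, AddHom.coe_mk, MultilinearMap.coe_mk,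
      LinearMap.compMultilinearMap_apply, LinearMap.mul_apply', smul_add, smul_mul_assoc,
      Finset.smul_sum, RingHom.id_apply, smul_comm _ c]

theorem coboundary_apply (n : ℕ) (C : Cochain A n) (a : Fin (n + 1) → A) :
    coboundary A n C a = a 0 * C (Fin.tail a)
      + ∑ j : Fin n, (-1 : ℂ) ^ ((j : ℕ) + 1) • C (Fin.contractNth j.castSucc (· * ·) a)
      + (-1 : ℂ) ^ (n + 1) • (C (Fin.init a) * a (Fin.last n)) := by
  simp only [coboundary, LinearMap.coe_mk, AddHom.coe_mk, firstFace, lastFace, face,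
    _root_.add_apply, _root_.sum_apply,
    _root_.smul_apply, LinearMap.uncurryLeft_apply, MultilinearMap.uncurryRight_apply,
    LinearMap.coe_mk, AddHom.coe_mk, MultilinearMap.coe_mk,
    LinearMap.compMultilinearMap_apply, LinearMap.mul_apply', smul_eq_mul]

/-- Hochschild `n`-cocycles. -/
def cocycles (n : ℕ) : Submodule ℂ (Cochain A n) :=
  LinearMap.ker (coboundary A n)

/-- Hochschild `n`-coboundaries. -/
def coboundaries : (n : ℕ) → Submodule ℂ (Cochain A n)
  | 0 => ⊥
  | n + 1 => LinearMap.range (coboundary A n)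

/-- The Hochschild cohomology `Hochⁿ(A, A)`. -/
abbrev Cohomology (n : ℕ) : Type _ :=
  Subquotient (cocycles A n) (coboundaries A n)

end Hochschild

namespace Hochschild

/-- The number of descents of a permutation: the `i` with `σ(i) > σ(i+1)`. -/
def descents {n : ℕ} (σ : Equiv.Perm (Fin n)) : ℕ :=
  Nat.card {i : Fin n // ∃ h : (i : ℕ) + 1 < n, σ ⟨(i : ℕ) + 1, h⟩ < σ i}

/-- The coefficient at `σ` of the Barr–Gerstenhaber–Schack idempotent `eₙ(k) ∈ ℂ[Sₙ]`, given by
Garsia's generating function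
`∑ₖ xᵏ eₙ(k) = (1/n!) ∑_σ (x - d_σ)(x - d_σ + 1)⋯(x - d_σ + n - 1) sgn(σ) σ`. -/
def idempotentCoeff (n k : ℕ) (σ : Equiv.Perm (Fin n)) : ℂ :=
  ((n.factorial : ℂ)⁻¹ * ((Equiv.Perm.sign σ : ℤ) : ℂ)) *
    (∏ i ∈ Finset.range n,
      (Polynomial.X - Polynomial.C (descents σ : ℂ) + Polynomial.C (i : ℂ))).coeff k

variable (A : Type*) [CommRing A] [Algebra ℂ A]

/-- The action `C ↦ C ∘ eₙ(k)` on cochains, where `σ` acts on chains by moving the factor in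
position `i` to position `σ(i)`: `σ(a₁ ⊗ ⋯ ⊗ aₙ) = a_{σ⁻¹(1)} ⊗ ⋯ ⊗ a_{σ⁻¹(n)}`. -/
def hodgeProjector (n k : ℕ) : Cochain A n →ₗ[ℂ] Cochain A n :=
  ∑ σ : Equiv.Perm (Fin n), idempotentCoeff n k σ •
    (MultilinearMap.domDomCongrLinearEquiv ℂ ℂ A A σ⁻¹).toLinearMap

theorem hodgeProjector_apply (n k : ℕ) (C : Cochain A n) (a : Fin n → A) :
    hodgeProjector A n k C a =
      ∑ σ : Equiv.Perm (Fin n), idempotentCoeff n k σ • C (fun i => a (σ⁻¹ i)) := by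
  simp [hodgeProjector]

/-- The component `C^{n,k}` of the Hochschild cochains: the image of `eₙ(k)`. -/
def hodgeCochains (n k : ℕ) : Submodule ℂ (Cochain A n) :=
  LinearMap.range (hodgeProjector A n k)

/-- The cocycles in `C^{n,k}`. -/
def hodgeCocycles (n k : ℕ) : Submodule ℂ (Cochain A n) :=
  cocycles A n ⊓ hodgeCochains A n k

/-- The coboundaries of the complex `C^{•,k}` in degree `n`: the image of `C^{n-1,k}`. -/
def hodgeCoboundaries : (n k : ℕ) → Submodule ℂ (Cochain A n)
  | 0, _ => ⊥
  | n + 1, k => (hodgeCochains A n k).map (coboundary A n)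

/-- The Barr–Gerstenhaber–Schack (Hodge) component `H^{n,k}` of `Hochⁿ(A, A)`: the `n`-th
cohomology of the direct summand `C^{•,k}` of the Hochschild complex. -/
abbrev HodgeCohomology (n k : ℕ) : Type _ :=
  Subquotient (hodgeCocycles A n k) (hodgeCoboundaries A n k)

end Hochschild

/-! ## Plane curves -/

namespace PlaneCurve

open MvPolynomial

/-- The coordinate algebra `A = ℂ[x, y]/(R)`. -/
abbrev CoordRing (R : MvPolynomial (Fin 2) ℂ) : Type :=
  MvPolynomial (Fin 2) ℂ ⧸ Ideal.span {R}

variable (R : MvPolynomial (Fin 2) ℂ)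

/-- The class in `A` of the partial derivative `∂ᵢR`. -/
def partialR (i : Fin 2) : CoordRing R :=
  Ideal.Quotient.mk (Ideal.span {R}) (pderiv i R)

/-- The gradient ideal `DR` of `A`, generated by the partial derivatives of `R`. -/
def gradientIdeal : Ideal (CoordRing R) :=
  Ideal.span (Set.range (partialR R))

/-- The part `A₊` of positive degree: the image in `A` of the polynomials without
constant term. -/
def positivePart : Ideal (CoordRing R) :=
  (RingHom.ker (constantCoeff (R := ℂ) (σ := Fin 2))).map (Ideal.Quotient.mk (Ideal.span {R}))

/-- The space `{a ∈ A₊ : a ∂₁R = a ∂₂R = 0}`. -/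
def gradientAnnihilator : Submodule ℂ (CoordRing R) where
  carrier := {a | a ∈ positivePart R ∧ ∀ i, a * partialR R i = 0}
  add_mem' := fun {a b} ha hb =>
    ⟨Ideal.add_mem _ ha.1 hb.1, fun i => by rw [add_mul, ha.2 i, hb.2 i, add_zero]⟩
  zero_mem' := ⟨Ideal.zero_mem _, fun i => zero_mul _⟩
  smul_mem' := fun c a ha =>
    ⟨Submodule.smul_of_tower_mem _ c ha.1,
      fun i => by rw [smul_mul_assoc, ha.2 i, smul_zero]⟩

/-- Vector fields on the plane with values in `A`: derivations `v₁∂₁ + v₂∂₂` from `ℂ[x, y]`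
to `A`. -/
abbrev VectorField : Type :=
  Derivation ℂ (MvPolynomial (Fin 2) ℂ) (CoordRing R)

/-- The space `V_R` of the vector fields with values in `A` that annihilate `R`. -/
def tangentFields : Submodule ℂ (VectorField R) where
  carrier := {v | v R = 0}
  add_mem' := fun {v w} hv hw => by
    simp only [Set.mem_ofPred_eq] at hv hw ⊢
    rw [Derivation.add_apply, hv, hw, add_zero]
  zero_mem' := rfl
  smul_mem' := fun a v hv => by
    simp only [Set.mem_ofPred_eq] at hv ⊢
    rw [Derivation.smul_apply, hv, smul_zero]

/-- The vector field `dR* = ∂₂R ∂₁ - ∂₁R ∂₂`. -/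
def dualGradient : VectorField R :=
  mkDerivation ℂ ![partialR R 1, -partialR R 0]

/-- The space `A·dR*` of the `A`-multiples of `dR*`. -/
def dualGradientMultiples : Submodule ℂ (VectorField R) :=
  (Submodule.span (CoordRing R) {dualGradient R}).restrictScalars ℂ

/-- The value of `dR*` on a polynomial `f` is `∂₂R ∂₁f - ∂₁R ∂₂f`. -/
theorem dualGradient_apply (f : MvPolynomial (Fin 2) ℂ) :
    dualGradient R f =
      partialR R 1 * Ideal.Quotient.mk (Ideal.span {R}) (pderiv 0 f) -
        partialR R 0 * Ideal.Quotient.mk (Ideal.span {R}) (pderiv 1 f) := by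
  have key : dualGradient R =
      partialR R 1 • (Algebra.linearMap (MvPolynomial (Fin 2) ℂ) (CoordRing R)).compDer
          (pderiv (R := ℂ) (0 : Fin 2)) -
        partialR R 0 • (Algebra.linearMap (MvPolynomial (Fin 2) ℂ) (CoordRing R)).compDer
          (pderiv (R := ℂ) (1 : Fin 2)) := by
    refine MvPolynomial.derivation_ext fun i => ?_
    fin_cases i <;> simp [dualGradient, pderiv_X]
  rw [key]
  rfl

/-- The multiples of `dR*` annihilate `R`. -/
theorem dualGradientMultiples_le : dualGradientMultiples R ≤ tangentFields R := by
  intro v hv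
  obtain ⟨a, rfl⟩ := Submodule.mem_span_singleton.1 hv
  change (a • dualGradient R) R = 0
  rw [Derivation.smul_apply, dualGradient_apply]
  simp only [partialR]
  rw [mul_comm, sub_self, smul_zero]

end PlaneCurve

end

/-!
Writing `R ⊗ 1 - 1 ⊗ R = t (x ⊗ 1 - 1 ⊗ x) + u (y ⊗ 1 - 1 ⊗ y)` in `ℂ[x, y] ⊗ ℂ[x, y]` and
symmetrizing `t` and `u` under the exchange of the factors gives a matrix factorization of zero
over `A ⊗ A`, and with it a resolution of `A` by bimodules that is two-periodic from degree one on.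
The unsymmetrized relation presents the class of `R` by a two-chain `ω` of the bar resolution;
contracting Hochschild cochains with `x`, `y` and the divided powers of `ω` compares the Hochschild
complex with the complex of pairs that the resolution computes. On the diagonal the differences act
by zero and `t`, `u` restrict to the partial derivatives of `R`, so the cohomology of the small
complex is read off directly.

The Hodge components are the eigenspaces of the second Adams operation, with eigenvalues `2 ^ k`.
Contraction with `x`, with `y`, and with the symmetrized `ω` each lowers the weight by one, so
the entries of a pair of degree `2 m + 1` have weight `m + 1` and those of a pair of degree `2 m`
have weights `m` and `m + 1`.
-/

noncomputable section

/-! ### Cochains on words -/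

namespace WordCochain

section Shuffle

variable {A M S : Type*} [CommRing S] [AddCommGroup M] [Module S M]

variable (M S) in
/-- The cochain `w ↦ F (a w)`. Cochains of all degrees with values in `M` are encoded as functions
on the words in `A`. -/
def slice (a : A) : (List A → M) →ₗ[S] (List A → M) :=
  LinearMap.funLeft S M (List.cons a)

@[simp] theorem slice_apply (a : A) (F : List A → M) (t : List A) :
    slice M S a F t = F (a :: t) := rfl

theorem slice_eq (a : A) (F : List A → M) : slice M S a F = fun t => F (a :: t) := rfl

variable (M S) in
/-- The sign operator `F ↦ (-1)ⁿ F` on cochains of degree `n`. -/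
def degreeSign : (List A → M) →ₗ[S] (List A → M) :=
  LinearMap.pi fun t => (-1 : S) ^ t.length • LinearMap.proj t

@[simp] theorem degreeSign_apply (F : List A → M) (t : List A) :
    degreeSign M S F t = (-1 : S) ^ t.length • F t := rfl

theorem slice_degreeSign (a : A) (F : List A → M) :
    slice M S a (degreeSign M S F) = -degreeSign M S (slice M S a F) := by
  funext t
  simp [pow_succ]

variable (M S) in
/-- The value of a cochain on the signed shuffle product of two words. -/
def shuffle : List A → List A → ((List A → M) →ₗ[S] M)
  | [], v => LinearMap.proj v
  | a :: u, [] => LinearMap.proj (a :: u)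
  | a :: u, b :: v => shuffle u (b :: v) ∘ₗ slice M S a +
      (-1 : S) ^ (u.length + 1) • shuffle (a :: u) v ∘ₗ slice M S b
termination_by u v => u.length + v.length

@[simp] theorem shuffle_nil_left (v : List A) (F : List A → M) : shuffle M S [] v F = F v := by
  simp [shuffle]

@[simp] theorem shuffle_nil_right (u : List A) (F : List A → M) : shuffle M S u [] F = F u := by
  cases u <;> simp [shuffle]

theorem shuffle_cons_cons (a b : A) (u v : List A) (F : List A → M) :
    shuffle M S (a :: u) (b :: v) F = shuffle M S u (b :: v) (slice M S a F) +
      (-1 : S) ^ (u.length + 1) • shuffle M S (a :: u) v (slice M S b F) := by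
  simp [shuffle]

theorem shuffle_comm (u v : List A) (F : List A → M) :
    shuffle M S u v F = (-1 : S) ^ (u.length * v.length) • shuffle M S v u F := by
  induction u generalizing v F with
  | nil => simp
  | cons a u ihu =>
    induction v generalizing F with
    | nil => simp
    | cons b v ihv =>
      rw [shuffle_cons_cons, shuffle_cons_cons, ihu, ihv]
      simp only [List.length_cons, add_mul, mul_add, pow_add, one_mul, mul_one, pow_one]
      rcases neg_one_pow_eq_or S u.length with h | h <;>
      rcases neg_one_pow_eq_or S v.length with h' | h' <;>
      rcases neg_one_pow_eq_or S (u.length * v.length) with h'' | h'' <;>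
      simp only [h, h', h''] <;> module

theorem shuffle_degreeSign (u v : List A) (F : List A → M) :
    shuffle M S u v (degreeSign M S F) =
      (-1 : S) ^ (u.length + v.length) • shuffle M S u v F := by
  induction u generalizing v F with
  | nil => simp
  | cons a u ihu =>
    induction v generalizing F with
    | nil => simp
    | cons b v ihv =>
      simp only [shuffle_cons_cons, slice_degreeSign, map_neg, ihu, ihv, List.length_cons,
        pow_succ, pow_add]
      module

variable (M S) in
/-- Contraction of a cochain with a word, the adjoint of the left shuffle product by this word. -/
def contract (w : List A) : (List A → M) →ₗ[S] (List A → M) :=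
  LinearMap.pi (shuffle M S w)

variable (M S) in
/-- The adjoint of the right shuffle product by a word. -/
def contractRight (w : List A) : (List A → M) →ₗ[S] (List A → M) :=
  LinearMap.pi fun t => shuffle M S t w

@[simp] theorem contract_apply (w v : List A) (F : List A → M) :
    contract M S w F v = shuffle M S w v F := rfl

@[simp] theorem contractRight_apply (w v : List A) (F : List A → M) :
    contractRight M S w F v = shuffle M S v w F := rfl

@[simp] theorem contract_nil (F : List A → M) : contract M S [] F = F :=
  funext fun v => shuffle_nil_left v F

@[simp] theorem contractRight_nil (F : List A → M) : contractRight M S [] F = F :=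
  funext fun v => shuffle_nil_right v F

theorem contract_apply_nil (w : List A) (F : List A → M) : contract M S w F [] = F w :=
  shuffle_nil_right w F

theorem slice_contract (a b : A) (u : List A) (F : List A → M) :
    slice M S b (contract M S (a :: u) F) = slice M S b (contract M S u (slice M S a F)) +
      (-1 : S) ^ (u.length + 1) • contract M S (a :: u) (slice M S b F) := by
  funext t
  simp [shuffle_cons_cons]

theorem slice_contractRight (a b : A) (v : List A) (F : List A → M) :
    slice M S b (contractRight M S (a :: v) F) = contractRight M S (a :: v) (slice M S b F) -
      degreeSign M S (slice M S b (contractRight M S v (slice M S a F))) := by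
  funext t
  simp [shuffle_cons_cons, pow_succ, sub_eq_add_neg]

theorem shuffle_assoc (u w v : List A) (F : List A → M) :
    shuffle M S w v (contract M S u F) = shuffle M S u w (contractRight M S v F) := by
  induction u generalizing w v F with
  | nil => simp
  | cons a u ihu =>
    induction w generalizing v F with
    | nil => simp
    | cons b w ihw =>
      induction v generalizing F with
      | nil => simp
      | cons c v ihv =>
        have h_left := ihu (b :: w) (c :: v) (slice M S a F)
        have h_mid := ihw (c :: v) (slice M S b F)
        have h_right := ihv (slice M S c F)
        rw [shuffle_cons_cons] at h_left
        rw [shuffle_cons_cons a b] at h_right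
        simp only [shuffle_cons_cons, slice_contract, slice_contractRight, map_add, map_sub,
          map_smul, shuffle_degreeSign, h_mid, h_right, ← h_left]
        simp only [List.length_cons, pow_succ, pow_add]
        rcases neg_one_pow_eq_or S u.length with h | h <;>
        rcases neg_one_pow_eq_or S w.length with h' | h' <;> simp only [h, h'] <;> module

theorem contract_contract (u w : List A) (F : List A → M) :
    contract M S u (contract M S w F) =
      (-1 : S) ^ (u.length * w.length) • contract M S w (contract M S u F) := by
  funext v
  simp only [contract_apply, Pi.smul_apply, shuffle_assoc w, shuffle_assoc u w]
  rw [shuffle_comm, mul_comm]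

theorem contract_singleton_anticomm (p q : A) (F : List A → M) :
    contract M S [p] (contract M S [q] F) = -contract M S [q] (contract M S [p] F) := by
  rw [contract_contract]
  simp

theorem contract_singleton_cons (p a : A) (t : List A) (F : List A → M) :
    contract M S [p] F (a :: t) = F (p :: a :: t) - contract M S [p] (slice M S a F) t := by
  simp [shuffle_cons_cons, sub_eq_add_neg]

theorem contract_pair_cons (p q a : A) (t : List A) (F : List A → M) :
    contract M S [p, q] F (a :: t) =
      contract M S [q] (slice M S p F) (a :: t) + contract M S [p, q] (slice M S a F) t := by
  simp [shuffle_cons_cons]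

theorem contract_contractRight (w u v : List A) (F : List A → M) :
    contract M S w (contractRight M S v F) u = shuffle M S u v (contract M S w F) :=
  (shuffle_assoc w u v F).symm

theorem contract_contract_apply (w u v : List A) (F : List A → M) :
    contract M S w (contract M S u F) v =
      (-1 : S) ^ (u.length * w.length) • shuffle M S u v (contract M S w F) := by
  rw [contract_contract, Pi.smul_apply, contract_apply, mul_comm]

/-! ### The second Adams operation -/

variable (M S) in
/-- The sum over all factorizations of a given word of the values of a function of two words. -/
def sumSplitsAt : List A → ((List A → List A → M) →ₗ[S] M)
  | [] => LinearMap.proj (φ := fun _ : List A => M) [] ∘ₗ LinearMap.proj []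
  | a :: t => LinearMap.proj (φ := fun _ : List A => M) (a :: t) ∘ₗ LinearMap.proj [] +
      sumSplitsAt t ∘ₗ LinearMap.funLeft S _ (List.cons a)

variable (M S) in
/-- The cochain `w ↦ ∑ G u v`, where the sum is over the factorizations `w = u v`. -/
def sumSplits : (List A → List A → M) →ₗ[S] (List A → M) :=
  LinearMap.pi (sumSplitsAt M S)

@[simp] theorem sumSplits_nil (G : List A → List A → M) : sumSplits M S G [] = G [] [] := rfl

theorem sumSplits_cons (a : A) (t : List A) (G : List A → List A → M) :
    sumSplits M S G (a :: t) = G [] (a :: t) + sumSplits M S (fun u => G (a :: u)) t := rfl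

theorem slice_sumSplits (a : A) (G : List A → List A → M) :
    slice M S a (sumSplits M S G) = slice M S a (G []) + sumSplits M S (fun u => G (a :: u)) := rfl

theorem contract_singleton_sumSplits (p : A) (G : List A → List A → M) :
    contract M S [p] (sumSplits M S G) =
      sumSplits M S ((fun u v => contract M S [p] (fun s => G s v) u) +
        fun u v => (-1 : S) ^ u.length • contract M S [p] (G u) v) := by
  funext w
  induction w generalizing G with
  | nil => simp [sumSplits_cons, add_comm]
  | cons a t ih =>
    have slice_summand : (fun u => ((fun u v => contract M S [p] (fun s => G s v) u) +
          fun u v => (-1 : S) ^ u.length • contract M S [p] (G u) v) (a :: u)) =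
        (fun u v => G (p :: a :: u) v) -
        ((fun u v => contract M S [p] (fun s => G (a :: s) v) u) +
          fun u v => (-1 : S) ^ u.length • contract M S [p] (G (a :: u)) v) := by
      funext u v
      simp only [Pi.add_apply, Pi.sub_apply, contract_singleton_cons, List.length_cons, pow_succ,
        slice_eq]
      module
    rw [sumSplits_cons, slice_summand, map_sub, Pi.sub_apply, ← ih, contract_singleton_cons,
      slice_sumSplits, map_add]
    simp only [Pi.add_apply, sumSplits_cons, contract_singleton_cons, List.length_nil,
      contract_apply_nil]
    module

theorem contract_pair_sumSplits (p q : A) (G : List A → List A → M) :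
    contract M S [p, q] (sumSplits M S G) =
      sumSplits M S ((fun u v => contract M S [p, q] (fun s => G s v) u) +
        (fun u v => contract M S [p, q] (G u) v) +
        fun u v => (-1 : S) ^ u.length •
          contract M S [p] (fun s => contract M S [q] (G s) v) u) := by
  funext w
  induction w generalizing G with
  | nil =>
    simp only [contract_apply, shuffle_nil_right, sumSplits_cons, sumSplits_nil, Pi.add_apply,
      List.length_nil, pow_zero, one_smul]
    abel
  | cons a t ih =>
    have slice_summand : (fun u => ((fun u v => contract M S [p, q] (fun s => G s v) u) +
          (fun u v => contract M S [p, q] (G u) v) +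
          fun u v => (-1 : S) ^ u.length •
            contract M S [p] (fun s => contract M S [q] (G s) v) u) (a :: u)) =
        (fun u => ((fun u v => contract M S [q] (fun s => G (p :: s) v) u) +
          fun u v => (-1 : S) ^ u.length • contract M S [q] (G (p :: u)) v) (a :: u)) +
        ((fun u v => contract M S [p, q] (fun s => G (a :: s) v) u) +
          (fun u v => contract M S [p, q] (G (a :: u)) v) +
          fun u v => (-1 : S) ^ u.length •
            contract M S [p] (fun s => contract M S [q] (G (a :: s)) v) u) := by
      funext u v
      simp only [Pi.add_apply, contract_pair_cons, List.length_cons, pow_succ]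
      rw [contract_singleton_cons p]
      simp only [slice_eq]
      module
    have h_letter := congr_fun (contract_singleton_sumSplits (S := S) q (fun u => G (p :: u)))
      (a :: t)
    rw [sumSplits_cons] at h_letter
    have h_pair := ih (fun u => G (a :: u))
    rw [sumSplits_cons, slice_summand, map_add, contract_pair_cons, slice_sumSplits,
      slice_sumSplits, map_add, map_add]
    simp only [Pi.add_apply (sumSplits M S _), Pi.add_apply (contract M S _ _), h_letter, h_pair]
    simp only [Pi.add_apply, contract_pair_cons, List.length_nil, contract_apply_nil]
    module

variable (M S) in
/-- The second Adams operation: the sum of the shuffles of all factorizations of a word. -/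
def adams : (List A → M) →ₗ[S] (List A → M) :=
  sumSplits M S ∘ₗ LinearMap.pi fun u => LinearMap.pi fun v => shuffle M S u v

theorem adams_eq (F : List A → M) :
    adams M S F = sumSplits M S (fun u v => shuffle M S u v F) := rfl

theorem contract_pair_adams (p q : A) (F : List A → M) :
    contract M S [p, q] (adams M S F) = (2 : S) • adams M S (contract M S [p, q] F) -
      adams M S (contract M S [p] (contract M S [q] F)) := by
  rw [adams_eq, contract_pair_sumSplits, adams_eq, adams_eq, ← map_smul, ← map_sub]
  congr 1
  funext u v
  have h_mixed : contract M S [p] (fun s => contract M S [q] (contract M S s F) v) u =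
      (-1 : S) ^ (u.length + 1) • shuffle M S u v (contract M S [p] (contract M S [q] F)) := by
    have h_q : (fun s => contract M S [q] (contract M S s F) v) =
        degreeSign M S (contractRight M S v (contract M S [q] F)) := by
      funext s
      simp [contract_contract_apply (S := S) [q]]
    rw [h_q, contract_apply, shuffle_degreeSign, ← contract_apply, contract_contractRight,
      List.length_singleton, add_comm]
  have h_left := contract_contractRight (S := S) [p, q] u v F
  have h_right := contract_contract_apply (S := S) [p, q] u v F
  rw [List.length_cons, List.length_singleton, pow_mul'] at h_right
  change contract M S [p, q] (contractRight M S v F) u + contract M S [p, q] (contract M S u F) v +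
    (-1 : S) ^ u.length • contract M S [p] (fun s => contract M S [q] (contract M S s F) v) u = _
  rw [h_left, h_right, h_mixed]
  change _ = (2 : S) • shuffle M S u v (contract M S [p, q] F) -
    shuffle M S u v (contract M S [p] (contract M S [q] F))
  simp only [pow_succ, pow_zero]
  rcases neg_one_pow_eq_or S u.length with h | h <;> simp only [h] <;> module

theorem contract_symm_pair_adams (p q : A) (F : List A → M) :
    (contract M S [p, q] + contract M S [q, p]) (adams M S F) =
      (2 : S) • adams M S ((contract M S [p, q] + contract M S [q, p]) F) := by
  rw [LinearMap.add_apply, LinearMap.add_apply, contract_pair_adams, contract_pair_adams,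
    contract_singleton_anticomm p q, map_add, map_neg]
  module

theorem adams_singleton (F : List A → M) (a : A) : adams M S F [a] = (2 : S) • F [a] := by
  simp [adams_eq, sumSplits_cons, two_smul]

theorem adams_pair_sub_swap (F : List A → M) (p q : A) :
    adams M S F [p, q] - adams M S F [q, p] = (2 : S) ^ 2 • (F [p, q] - F [q, p]) := by
  simp only [adams_eq, sumSplits_cons, sumSplits_nil, shuffle_nil_left, shuffle_nil_right,
    shuffle_cons_cons, slice_apply, List.length_nil]
  module

theorem adams_nil (F : List A → M) : adams M S F [] = F [] := by
  simp [adams_eq]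

end Shuffle

/-! ### The Hochschild coboundary -/

section Coboundary

variable {K A M S : Type*} [CommRing K] [CommRing A] [Algebra K A] [CommRing S] [Algebra K S]
  [AddCommGroup M] [Module S M]

variable (M) in
/-- The part of the Hochschild coboundary at a word `a w` that involves the product of `a` with the
first letter of `w`, or the right action of `a` if `w` is empty. The bimodule structure of `M` is
given by two homomorphisms `l` and `r` to a commutative algebra acting on `M`. -/
def merge (l r : A →ₐ[K] S) (a : A) : (List A → M) →ₗ[S] (List A → M) :=
  LinearMap.pi fun
    | [] => -(r a • LinearMap.proj [])
    | b :: t => l b • LinearMap.proj (a :: t) - LinearMap.proj (a * b :: t)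

@[simp] theorem merge_nil (l r : A →ₐ[K] S) (a : A) (F : List A → M) :
    merge M l r a F [] = -(r a • F []) := rfl

@[simp] theorem merge_cons (l r : A →ₐ[K] S) (a b : A) (t : List A) (F : List A → M) :
    merge M l r a F (b :: t) = l b • F (a :: t) - F (a * b :: t) := rfl

variable (M) in
/-- The value at a word of the Hochschild coboundary of a cochain. -/
def coboundaryAt (l r : A →ₐ[K] S) : List A → ((List A → M) →ₗ[S] M)
  | [] => 0
  | a :: t => l a • LinearMap.proj t - coboundaryAt l r t ∘ₗ slice M S a +
      LinearMap.proj t ∘ₗ merge M l r a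

variable (M) in
/-- The Hochschild coboundary. -/
def coboundary (l r : A →ₐ[K] S) : (List A → M) →ₗ[S] (List A → M) :=
  LinearMap.pi (coboundaryAt M l r)

@[simp] theorem coboundary_nil (l r : A →ₐ[K] S) (F : List A → M) : coboundary M l r F [] = 0 := rfl

@[simp] theorem coboundary_cons (l r : A →ₐ[K] S) (a : A) (t : List A) (F : List A → M) :
    coboundary M l r F (a :: t) =
      l a • F t - coboundary M l r (slice M S a F) t + merge M l r a F t := rfl

theorem slice_coboundary (l r : A →ₐ[K] S) (a : A) (F : List A → M) :
    slice M S a (coboundary M l r F) =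
      l a • F - coboundary M l r (slice M S a F) + merge M l r a F := rfl

theorem slice_merge (l r : A →ₐ[K] S) (a b : A) (F : List A → M) :
    slice M S b (merge M l r a F) = l b • slice M S a F - slice M S (a * b) F := rfl

theorem merge_merge (l r : A →ₐ[K] S) (a b : A) (F : List A → M) :
    merge M l r b (merge M l r a F) = -merge M l r (a * b) F := by
  funext t
  cases t with
  | nil => simp [smul_smul, mul_comm]
  | cons c t =>
    simp only [merge_cons, Pi.neg_apply, map_mul]
    rw [← mul_assoc a b c]
    module

theorem coboundary_merge (l r : A →ₐ[K] S) (a : A) (F : List A → M) :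
    coboundary M l r (merge M l r a F) = merge M l r a (coboundary M l r F) := by
  funext t
  cases t with
  | nil => simp
  | cons b t =>
    simp only [merge_cons, coboundary_cons, slice_merge, merge_merge, map_sub, map_smul,
      Pi.sub_apply, Pi.smul_apply, Pi.neg_apply, map_mul]
    module

theorem coboundary_coboundary (l r : A →ₐ[K] S) (F : List A → M) :
    coboundary M l r (coboundary M l r F) = 0 := by
  funext t
  induction t generalizing F with
  | nil => simp
  | cons a t ih =>
    rw [coboundary_cons, slice_coboundary]
    simp only [map_add, map_sub, map_smul, coboundary_merge, Pi.add_apply, Pi.sub_apply,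
      Pi.smul_apply, ih (slice M S a F), Pi.zero_apply]
    module

theorem coboundary_degreeSign (l r : A →ₐ[K] S) (F : List A → M) :
    coboundary M l r (degreeSign M S F) = -degreeSign M S (coboundary M l r F) := by
  funext t
  induction t generalizing F with
  | nil => simp
  | cons a t ih =>
    simp only [coboundary_cons, slice_degreeSign, map_neg, Pi.neg_apply, ih, degreeSign_apply]
    cases t with
    | nil =>
      simp only [coboundary_nil, merge_nil, degreeSign_apply, List.length_cons, List.length_nil]
      module
    | cons b t => simp only [merge_cons, degreeSign_apply, List.length_cons, pow_succ]; module

theorem shuffle_merge (l r : A →ₐ[K] S) (a b : A) (u v : List A) (F : List A → M) :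
    shuffle M S u (b :: v) (merge M l r a F) +
        (-1 : S) ^ (u.length + 1) • shuffle M S (a :: u) v (merge M l r b F) =
      merge M l r a (contractRight M S (b :: v) F) u
      - (-1 : S) ^ u.length • (l a • shuffle M S u v (slice M S b F) +
          merge M l r a (contractRight M S v (slice M S b F)) u)
      + (-1 : S) ^ (u.length + 1) • merge M l r b (contract M S (a :: u) F) v
      + (-1 : S) ^ u.length • (l b • shuffle M S u v (slice M S a F) +
          merge M l r b (contract M S u (slice M S a F)) v) := by
  rcases u with _ | ⟨c, u⟩ <;> rcases v with _ | ⟨d, v⟩ <;>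
  simp only [shuffle_nil_left, shuffle_nil_right, merge_nil, merge_cons, slice_apply,
    contract_apply, contractRight_apply, List.length_nil, List.length_cons, shuffle_cons_cons,
    slice_merge, map_sub, map_smul, mul_comm b a, pow_succ, pow_zero]
  case nil.nil | nil.cons => module
  all_goals rcases neg_one_pow_eq_or S u.length with h | h <;> simp only [h] <;> module

theorem shuffle_coboundary (l r : A →ₐ[K] S) (u v : List A) (F : List A → M) :
    shuffle M S u v (coboundary M l r F) =
      coboundary M l r (contractRight M S v F) u +
        (-1 : S) ^ u.length • coboundary M l r (contract M S u F) v := by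
  induction u generalizing v F with
  | nil => simp
  | cons a u ihu =>
    induction v generalizing F with
    | nil => simp
    | cons b v ihv =>
      have h_left := ihu (b :: v) (slice M S a F)
      have h_right := ihv (slice M S b F)
      have h_merge := shuffle_merge l r a b u v F
      rw [coboundary_cons] at h_left h_right
      simp only [shuffle_cons_cons, slice_coboundary, coboundary_cons, slice_contract,
        slice_contractRight, map_add, map_sub, map_smul, Pi.add_apply, Pi.sub_apply,
        Pi.smul_apply, Pi.neg_apply, coboundary_degreeSign, degreeSign_apply, h_left, h_right]
      rw [← sub_eq_zero] at h_merge ⊢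
      rw [← h_merge]
      simp only [contract_apply, contractRight_apply, List.length_cons, pow_succ]
      rcases neg_one_pow_eq_or S u.length with h | h <;> simp only [h] <;> module

theorem contract_pair_coboundary (l r : A →ₐ[K] S) (p q : A) (F : List A → M) :
    contract M S [p, q] (coboundary M l r F) =
      l p • contract M S [q] F - contract M S [p * q] F + r q • contract M S [p] F
        + coboundary M l r (contract M S [p, q] F) := by
  funext v
  rw [contract_apply, shuffle_coboundary]
  simp only [coboundary_cons, coboundary_nil, merge_nil, merge_cons, slice_apply,
    contractRight_apply, contract_apply, Pi.sub_apply, Pi.add_apply, Pi.smul_apply,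
    List.length_cons, List.length_nil]
  module

theorem merge_sumSplits (l r : A →ₐ[K] S) (hsym : ∀ a (m : M), l a • m = r a • m) (a : A)
    (t : List A) (G : List A → List A → M) :
    merge M l r a (sumSplits M S G) t = l a • G [] t + merge M l r a (G []) t +
      sumSplits M S (fun u v => merge M l r a (fun s => G s v) u) t := by
  cases t with
  | nil => simp [hsym]
  | cons b t =>
    have slice_summand : (fun u v => l b • G (a :: u) v - G (a * b :: u) v) =
        l b • (fun u => G (a :: u)) - fun u => G (a * b :: u) := rfl
    simp only [merge_cons, sumSplits_cons, merge_nil, hsym a]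
    rw [slice_summand, map_sub, map_smul, Pi.sub_apply, Pi.smul_apply]
    module

theorem coboundary_sumSplits (l r : A →ₐ[K] S) (hsym : ∀ a (m : M), l a • m = r a • m)
    (G : List A → List A → M) :
    coboundary M l r (sumSplits M S G) =
      sumSplits M S ((fun u v => coboundary M l r (fun s => G s v) u) +
        fun u v => (-1 : S) ^ u.length • coboundary M l r (G u) v) := by
  funext t
  induction t generalizing G with
  | nil => simp
  | cons a t ih =>
    have slice_summand : (fun u => ((fun u v => coboundary M l r (fun s => G s v) u) +
          fun u v => (-1 : S) ^ u.length • coboundary M l r (G u) v) (a :: u)) =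
        l a • G + (fun u v => merge M l r a (fun s => G s v) u) -
        ((fun u v => coboundary M l r (fun s => G (a :: s) v) u) +
          fun u v => (-1 : S) ^ u.length • coboundary M l r (G (a :: u)) v) := by
      funext u v
      simp only [Pi.add_apply, Pi.sub_apply, Pi.smul_apply, coboundary_cons, List.length_cons,
        pow_succ, slice_eq]
      module
    rw [sumSplits_cons, slice_summand, map_sub, map_add, map_smul, Pi.sub_apply, ← ih,
      coboundary_cons, slice_sumSplits, merge_sumSplits l r hsym]
    simp only [Pi.add_apply, Pi.smul_apply, map_add, coboundary_nil, coboundary_cons,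
      List.length_nil]
    module

theorem coboundary_adams (l r : A →ₐ[K] S) (hsym : ∀ a (m : M), l a • m = r a • m)
    (F : List A → M) : coboundary M l r (adams M S F) = adams M S (coboundary M l r F) := by
  rw [adams_eq, coboundary_sumSplits l r hsym, adams_eq]
  congr 1
  funext u v
  exact (shuffle_coboundary l r u v F).symm

end Coboundary

end WordCochain

/-! ### Multilinear cochains -/

namespace WordCochain

section Naturality

variable {K A M N S : Type*} [CommRing S] [AddCommGroup M] [Module S M] [AddCommGroup N]
  [Module S N]

theorem shuffle_comp (g : M →ₗ[S] N) (u v : List A) (F : List A → M) :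
    shuffle N S u v (g ∘ F) = g (shuffle M S u v F) := by
  induction u generalizing v F with
  | nil => simp
  | cons a u ihu =>
    induction v generalizing F with
    | nil => simp
    | cons b v ihv =>
      rw [shuffle_cons_cons, shuffle_cons_cons, map_add, map_smul, ← ihu, ← ihv]
      rfl

theorem contract_comp (g : M →ₗ[S] N) (w : List A) (F : List A → M) :
    contract N S w (g ∘ F) = g ∘ contract M S w F :=
  funext fun v => shuffle_comp g w v F

theorem coboundary_comp [CommRing K] [CommRing A] [Algebra K A] [Algebra K S] (l r : A →ₐ[K] S)
    (g : M →ₗ[S] N) (F : List A → M) :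
    coboundary N l r (g ∘ F) = g ∘ coboundary M l r F := by
  funext t
  induction t generalizing F with
  | nil => simp
  | cons a t ih =>
    have h_slice := ih (slice M S a F)
    simp only [Function.comp_apply] at h_slice ⊢
    rw [coboundary_cons, coboundary_cons, map_add, map_sub, map_smul, ← h_slice]
    congr 1
    cases t <;> simp

end Naturality

/-- The cochains of degree `n`: the functions on words that vanish outside length `n` and are
linear in every letter. -/
structure IsCochain (K : Type*) {A M : Type*} [CommRing K] [AddCommGroup A] [Module K A]
    [AddCommGroup M] [Module K M] (n : ℕ) (F : List A → M) : Prop where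
  eq_zero : ∀ t : List A, t.length ≠ n → F t = 0
  isLinearMap : ∀ u v : List A, IsLinearMap K fun a => F (u ++ a :: v)

namespace IsCochain

section Module

variable {K A M N S : Type*} [CommRing K] [AddCommGroup A] [Module K A]
  [CommRing S] [Algebra K S] [AddCommGroup M] [Module K M] [Module S M] [IsScalarTower K S M]
  [AddCommGroup N] [Module K N] {n : ℕ} {F G : List A → M}

theorem zero : IsCochain K n (0 : List A → M) :=
  ⟨fun _ _ => rfl, fun _ _ => (0 : A →ₗ[K] M).isLinear⟩

theorem add (hF : IsCochain K n F) (hG : IsCochain K n G) : IsCochain K n (F + G) where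
  eq_zero t ht := by simp [hF.eq_zero t ht, hG.eq_zero t ht]
  isLinearMap u v := ((hF.isLinearMap u v).mk' _ + (hG.isLinearMap u v).mk' _).isLinear

theorem map (g : M →ₗ[K] N) (hF : IsCochain K n F) : IsCochain K n (g ∘ F) where
  eq_zero t ht := by simp [hF.eq_zero t ht]
  isLinearMap u v := (g ∘ₗ (hF.isLinearMap u v).mk' _).isLinear

theorem smul (s : S) (hF : IsCochain K n F) : IsCochain K n (s • F) :=
  hF.map (Algebra.lsmul K K M s)

theorem neg (hF : IsCochain K n F) : IsCochain K n (-F) :=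
  hF.map (-LinearMap.id)

theorem sub (hF : IsCochain K n F) (hG : IsCochain K n G) : IsCochain K n (F - G) := by
  rw [sub_eq_add_neg]
  exact hF.add hG.neg

theorem sum {ι : Type*} {s : Finset ι} {F : ι → List A → M} (hF : ∀ i ∈ s, IsCochain K n (F i)) :
    IsCochain K n (∑ i ∈ s, F i) :=
  Finset.sum_induction F (IsCochain K n) (fun _ _ => add) zero hF

end Module

section Contraction

variable {K A M S : Type*} [CommRing K] [AddCommGroup A] [Module K A] [CommRing S]
  [AddCommGroup M] [Module K M] [Module S M] {n : ℕ} {F : List A → M}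

theorem slice (a : A) (hF : IsCochain K n F) : IsCochain K (n - 1) (slice M S a F) where
  eq_zero t ht := hF.eq_zero (a :: t) (by rw [List.length_cons]; omega)
  isLinearMap u v := hF.isLinearMap (a :: u) v

theorem slice_eq_zero (hF : IsCochain K 0 F) (a : A) : WordCochain.slice M S a F = 0 :=
  funext fun t => hF.eq_zero (a :: t) (by simp)

theorem isLinearMap_slice (hF : IsCochain K n F) :
    IsLinearMap K fun a => WordCochain.slice M S a F where
  map_add a b := funext fun t => (hF.isLinearMap [] t).map_add a b
  map_smul c a := funext fun t => (hF.isLinearMap [] t).map_smul c a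

theorem shuffle_eq_zero (hF : IsCochain K n F) {u v : List A} (h : u.length + v.length ≠ n) :
    shuffle M S u v F = 0 := by
  induction u generalizing n v F with
  | nil => simpa using hF.eq_zero v (by simpa using h)
  | cons a u ihu =>
    induction v generalizing n F with
    | nil => simpa using hF.eq_zero (a :: u) (by simpa using h)
    | cons b v ihv =>
      simp only [List.length_cons] at h ihv
      rw [shuffle_cons_cons, ihu (hF.slice a) (by rw [List.length_cons]; omega),
        ihv (hF.slice b) (by omega), smul_zero, add_zero]

variable [Algebra K S] [IsScalarTower K S M]

theorem isLinearMap_shuffle_right (hF : IsCochain K n F) (w u v : List A) :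
    IsLinearMap K fun c => shuffle M S w (u ++ c :: v) F := by
  induction w generalizing n u F with
  | nil => simpa using hF.isLinearMap u v
  | cons a w ihw =>
    induction u generalizing n F with
    | nil =>
      simp only [List.nil_append, shuffle_cons_cons]
      exact ((ihw (hF.slice (S := S) a) []).mk' _ + (-1 : S) ^ (w.length + 1) •
        ((shuffle M S (a :: w) v).restrictScalars K ∘ₗ
          (hF.isLinearMap_slice (S := S)).mk' _)).isLinear
    | cons b u ihu =>
      simp only [List.cons_append, shuffle_cons_cons]
      exact ((ihw (hF.slice (S := S) a) (b :: u)).mk' _ +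
        (-1 : S) ^ (w.length + 1) • (ihu (hF.slice (S := S) b)).mk' _).isLinear

theorem isLinearMap_shuffle_left (hF : IsCochain K n F) (w u v : List A) :
    IsLinearMap K fun c => shuffle M S (u ++ c :: v) w F := by
  simp only [shuffle_comm (u ++ _ :: v), List.length_append, List.length_cons]
  exact ((-1 : S) ^ _ • (hF.isLinearMap_shuffle_right w u v).mk' _).isLinear

theorem isLinearMap_contract (hF : IsCochain K n F) (u v : List A) :
    IsLinearMap K fun c => contract M S (u ++ c :: v) F where
  map_add a b := funext fun t => (hF.isLinearMap_shuffle_left t u v).map_add a b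
  map_smul c a := funext fun t => (hF.isLinearMap_shuffle_left t u v).map_smul c a

theorem contract (w : List A) (hF : IsCochain K n F) :
    IsCochain K (n - w.length) (contract M S w F) where
  eq_zero t ht := hF.shuffle_eq_zero (by omega)
  isLinearMap u v := hF.isLinearMap_shuffle_right w u v

end Contraction

section Coboundary

variable {K A M S : Type*} [CommRing K] [CommRing A] [Algebra K A]
  [CommRing S] [Algebra K S] [AddCommGroup M] [Module K M] [Module S M] [IsScalarTower K S M]
  {n : ℕ} {F : List A → M} (l r : A →ₐ[K] S)

theorem merge (a : A) (hF : IsCochain K n F) : IsCochain K n (merge M l r a F) where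
  eq_zero t ht := by
    cases t with
    | nil => simp [hF.eq_zero [] ht]
    | cons b t =>
      rw [merge_cons, hF.eq_zero (a :: t) ht, hF.eq_zero (a * b :: t) ht, smul_zero, sub_zero]
  isLinearMap u v := by
    cases u with
    | nil =>
      exact ((LinearMap.toSpanSingleton S M (F (a :: v))).restrictScalars K ∘ₗ l.toLinearMap -
        (hF.isLinearMap [] v).mk' _ ∘ₗ LinearMap.mulLeft K a).isLinear
    | cons b u =>
      exact (l b • (hF.isLinearMap (a :: u) v).mk' _ -
        (hF.isLinearMap (a * b :: u) v).mk' _).isLinear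

theorem isLinearMap_merge (hF : IsCochain K n F) (t : List A) :
    IsLinearMap K fun a => WordCochain.merge M l r a F t := by
  cases t with
  | nil =>
    exact (-((LinearMap.toSpanSingleton S M (F [])).restrictScalars K ∘ₗ r.toLinearMap)).isLinear
  | cons b t =>
    exact (l b • (hF.isLinearMap [] t).mk' _ -
      (hF.isLinearMap [] t).mk' _ ∘ₗ LinearMap.mulRight K b).isLinear

theorem coboundary (hF : IsCochain K n F) : IsCochain K (n + 1) (coboundary M l r F) where
  eq_zero t ht := by
    induction t generalizing n F with
    | nil => rfl
    | cons a t ih =>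
      have ht' : t.length ≠ n := by simpa using ht
      have h_slice : WordCochain.coboundary M l r (WordCochain.slice M S a F) t = 0 := by
        cases n with
        | zero => rw [hF.slice_eq_zero, map_zero, Pi.zero_apply]
        | succ n => exact ih (hF.slice a) ht'
      rw [coboundary_cons, hF.eq_zero t ht', (hF.merge l r a).eq_zero t ht', h_slice, smul_zero,
        sub_zero, add_zero]
  isLinearMap u v := by
    induction u generalizing n F with
    | nil =>
      exact ((LinearMap.toSpanSingleton S M (F v)).restrictScalars K ∘ₗ l.toLinearMap -
        (LinearMap.proj v ∘ₗ WordCochain.coboundary M l r).restrictScalars K ∘ₗ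
          (hF.isLinearMap_slice (S := S)).mk' _ + (hF.isLinearMap_merge l r v).mk' _).isLinear
    | cons b u ih =>
      exact (l b • (hF.isLinearMap u v).mk' _ - (ih (hF.slice b)).mk' _ +
        ((hF.merge l r b).isLinearMap u v).mk' _).isLinear

end Coboundary

end IsCochain

end WordCochain

/-! ### The enveloping algebra and the comparison maps -/

namespace WordCochain

open TensorProduct

/-- The enveloping algebra of a commutative algebra; its modules are the `A`-bimodules on which
`K` acts centrally. -/
def Env (K A : Type*) [CommRing K] [CommRing A] [Algebra K A] : Type _ := A ⊗[K] A

section Enveloping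

variable {K A M N : Type*} [CommRing K] [CommRing A] [Algebra K A]

instance : CommRing (Env K A) := inferInstanceAs (CommRing (A ⊗[K] A))

instance : Algebra K (Env K A) := inferInstanceAs (Algebra K (A ⊗[K] A))

variable (K A) in
/-- The left action of `A`, as a homomorphism to the enveloping algebra. -/
def left : A →ₐ[K] Env K A :=
  Algebra.TensorProduct.includeLeft (R := K) (S := K) (A := A) (B := A)

variable (K A) in
/-- The right action of `A`, as a homomorphism to the enveloping algebra. -/
def right : A →ₐ[K] Env K A :=
  Algebra.TensorProduct.includeRight (R := K) (A := A) (B := A)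

theorem left_mul_right (a b : A) : left K A a * right K A b = (a ⊗ₜ[K] b : A ⊗[K] A) := by
  change (a ⊗ₜ[K] (1 : A)) * ((1 : A) ⊗ₜ[K] b) = _
  rw [Algebra.TensorProduct.tmul_mul_tmul, mul_one, one_mul]

variable (K A) in
/-- The exchange of the two factors of the enveloping algebra. -/
def envSwap : Env K A →ₐ[K] Env K A :=
  (Algebra.TensorProduct.comm K A A : A ⊗[K] A ≃ₐ[K] A ⊗[K] A).toAlgHom

theorem envSwap_left (a : A) : envSwap K A (left K A a) = right K A a :=
  Algebra.TensorProduct.comm_tmul (R := K) (A := A) (B := A) a 1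

theorem envSwap_right (a : A) : envSwap K A (right K A a) = left K A a :=
  Algebra.TensorProduct.comm_tmul (R := K) (A := A) (B := A) 1 a

variable [AddCommGroup M] [Module (Env K A) M] [AddCommGroup N] [Module (Env K A) N]

variable (K A M) in
/-- The Hochschild coboundary with coefficients in a bimodule. -/
abbrev bimoduleCoboundary : (List A → M) →ₗ[Env K A] (List A → M) :=
  coboundary M (left K A) (right K A)

variable (K) in
/-- The difference of the left and the right action of an element. -/
def difference (a : A) : Env K A := left K A a - right K A a

variable (K) in
/-- The tensor presented by a finite set of pairs. -/
def presented (T : Finset (A × A)) : Env K A :=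
  ∑ p ∈ T, left K A p.1 * right K A p.2

variable (K) in
/-- The tensor presented by a finite set of pairs, with the factors exchanged. -/
def presentedSwap (T : Finset (A × A)) : Env K A :=
  ∑ p ∈ T, left K A p.2 * right K A p.1

theorem envSwap_difference (a : A) : envSwap K A (difference K a) = -difference K a := by
  rw [difference, map_sub, envSwap_left, envSwap_right, neg_sub]

theorem envSwap_presented (T : Finset (A × A)) :
    envSwap K A (presented K T) = presentedSwap K T := by
  simp only [presented, presentedSwap, map_sum, map_mul, envSwap_left, envSwap_right,
    mul_comm (right K A _)]

variable (K M) in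
/-- Contraction with the symmetrization of the bar chain `∑ [p₁|x]p₂`, the sum extending over the
pairs `p` in `T`. -/
def pairContraction (x : A) (T : Finset (A × A)) : (List A → M) →ₗ[Env K A] (List A → M) :=
  ∑ p ∈ T, (right K A p.2 • contract M (Env K A) [p.1, x] +
    left K A p.2 • contract M (Env K A) [x, p.1])

theorem pairContraction_apply (x : A) (T : Finset (A × A)) (F : List A → M) :
    pairContraction K M x T F = ∑ p ∈ T, (right K A p.2 • contract M (Env K A) [p.1, x] F +
      left K A p.2 • contract M (Env K A) [x, p.1] F) := by
  simp [pairContraction]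

theorem contract_pairContraction (w : List A) (x : A) (T : Finset (A × A)) (F : List A → M) :
    contract M (Env K A) w (pairContraction K M x T F) =
      pairContraction K M x T (contract M (Env K A) w F) := by
  simp only [pairContraction_apply, map_sum, map_add, map_smul]
  refine Finset.sum_congr rfl fun p _ => ?_
  rw [contract_contract w [p.1, x], contract_contract w [x, p.1]]
  simp

theorem pairContraction_comp (g : M →ₗ[Env K A] N) (x : A) (T : Finset (A × A))
    (F : List A → M) :
    pairContraction K N x T (g ∘ F) = g ∘ pairContraction K M x T F := by
  funext t
  simp [pairContraction_apply, contract_comp]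

variable [Module K M] [IsScalarTower K (Env K A) M]

/-- For a multilinear cochain `F`, the linear extension of `a ⊗ b ↦ φ b • contract [a] F`. -/
def contractTensor (φ : A →ₐ[K] Env K A) {n : ℕ} {F : List A → M} (hF : IsCochain K n F) :
    Env K A →ₗ[K] (List A → M) :=
  TensorProduct.lift <| (Algebra.lsmul K K (List A → M)).toLinearMap.flip.compl₁₂
    ((hF.isLinearMap_contract (S := Env K A) [] []).mk' _) φ.toLinearMap

theorem contractTensor_left_mul_right (φ : A →ₐ[K] Env K A) {n : ℕ} {F : List A → M}
    (hF : IsCochain K n F) (a b : A) :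
    contractTensor φ hF (left K A a * right K A b) = φ b • contract M (Env K A) [a] F := by
  rw [left_mul_right]
  rfl

theorem pairContraction_bimoduleCoboundary (x : A) (T : Finset (A × A)) {n : ℕ} {F : List A → M}
    (hF : IsCochain K n F) :
    pairContraction K M x T (bimoduleCoboundary K A M F) =
      bimoduleCoboundary K A M (pairContraction K M x T F) +
        (presented K T + presentedSwap K T) • contract M (Env K A) [x] F -
        contractTensor (right K A) hF (presented K T * difference K x) -
        contractTensor (left K A) hF (presented K T * difference K x) := by
  have mul_difference (p : A × A) : left K A p.1 * right K A p.2 * difference K x =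
      left K A (p.1 * x) * right K A p.2 - left K A p.1 * right K A (p.2 * x) := by
    rw [difference, map_mul, map_mul]
    ring
  simp only [pairContraction_apply, presented, presentedSwap, Finset.sum_mul, map_sum,
    Finset.sum_smul, add_smul]
  rw [← Finset.sum_add_distrib, ← Finset.sum_add_distrib, ← Finset.sum_sub_distrib,
    ← Finset.sum_sub_distrib]
  refine Finset.sum_congr rfl fun p _ => ?_
  simp only [mul_difference, map_sub, contractTensor_left_mul_right]
  simp only [contract_pair_coboundary, map_mul, map_add, map_smul, mul_comm x p.1]
  module

theorem IsCochain.pairContraction (x : A) (T : Finset (A × A)) {n : ℕ} {F : List A → M}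
    (hF : IsCochain K n F) : IsCochain K (n - 2) (pairContraction K M x T F) := by
  rw [pairContraction_apply]
  exact .sum fun p _ => .add (.smul _ (hF.contract (S := Env K A) [_, _]))
    (.smul _ (hF.contract (S := Env K A) [_, _]))

end Enveloping

/-- Elements `x`, `y` of `A` with a relation `∑ T · dx + ∑ U · dy = 0` in the enveloping algebra,
where `T` and `U` are finite sets of pairs `(p, q)` standing for `p ⊗ q`. -/
structure DifferenceRelation (K A : Type*) [CommRing K] [CommRing A] [Algebra K A] where
  x : A
  y : A
  T : Finset (A × A)
  U : Finset (A × A)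
  rel : presented K T * difference K x + presented K U * difference K y = 0

namespace DifferenceRelation

variable {K A M N : Type*} [Field K] [CommRing A] [Algebra K A]
  [AddCommGroup M] [Module (Env K A) M] [AddCommGroup N] [Module (Env K A) N]
  (D : DifferenceRelation K A)

/-- The difference `x ⊗ 1 - 1 ⊗ x`. -/
abbrev dx : Env K A := difference K D.x

/-- The difference `y ⊗ 1 - 1 ⊗ y`. -/
abbrev dy : Env K A := difference K D.y

/-- The symmetrization of the tensor presented by `T`. -/
def symT : Env K A := algebraMap K _ (1 / 2) * (presented K D.T + presentedSwap K D.T)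

/-- The symmetrization of the tensor presented by `U`. -/
def symU : Env K A := algebraMap K _ (1 / 2) * (presented K D.U + presentedSwap K D.U)

theorem symT_mul_dx_add_symU_mul_dy : D.symT * D.dx + D.symU * D.dy = 0 := by
  have h_swap := congr_arg (envSwap K A) D.rel
  rw [map_add, map_mul, map_mul, envSwap_presented, envSwap_presented, envSwap_difference,
    envSwap_difference, map_zero] at h_swap
  rw [symT, symU]
  linear_combination algebraMap K (Env K A) (1 / 2) * (D.rel - h_swap)

variable (M) in
/-- The contraction of degree two attached to the relation. -/
def omega : (List A → M) →ₗ[Env K A] (List A → M) :=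
  algebraMap K (Env K A) (1 / 2) • (pairContraction K M D.x D.T + pairContraction K M D.y D.U)

theorem omega_apply (F : List A → M) : D.omega M F = algebraMap K (Env K A) (1 / 2) •
    (pairContraction K M D.x D.T F + pairContraction K M D.y D.U F) := rfl

variable (M) in
/-- The defect `symT • contract [x] + symU • contract [y]` of `omega` as a morphism of
complexes. -/
def defect : (List A → M) →ₗ[Env K A] (List A → M) :=
  D.symT • contract M (Env K A) [D.x] + D.symU • contract M (Env K A) [D.y]

theorem defect_apply (F : List A → M) : D.defect M F =
    D.symT • contract M (Env K A) [D.x] F + D.symU • contract M (Env K A) [D.y] F := rfl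

theorem contract_omega (w : List A) (F : List A → M) :
    contract M (Env K A) w (D.omega M F) = D.omega M (contract M (Env K A) w F) := by
  rw [omega_apply, map_smul, map_add, contract_pairContraction, contract_pairContraction,
    omega_apply]

theorem commute_defect_omega : Commute (D.defect M) (D.omega M) :=
  LinearMap.ext fun F => by simp [defect_apply, contract_omega]

theorem omega_comp (g : M →ₗ[Env K A] N) (F : List A → M) :
    D.omega N (g ∘ F) = g ∘ D.omega M F := by
  rw [omega_apply, pairContraction_comp, pairContraction_comp]
  funext t
  simp [omega_apply]

variable (M) in
/-- The divided powers of `omega`. -/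
def dpow (k : ℕ) : (List A → M) →ₗ[Env K A] (List A → M) :=
  algebraMap K (Env K A) (k.factorial : K)⁻¹ • D.omega M ^ k

theorem dpow_apply (k : ℕ) (F : List A → M) : D.dpow M k F =
    algebraMap K (Env K A) (k.factorial : K)⁻¹ • (D.omega M ^ k) F := rfl

@[simp] theorem dpow_zero : D.dpow M 0 = LinearMap.id := by
  ext; simp [dpow_apply]

theorem dpow_comp (g : M →ₗ[Env K A] N) (k : ℕ) (F : List A → M) :
    D.dpow N k (g ∘ F) = g ∘ D.dpow M k F := by
  have h_pow : (D.omega N ^ k) (g ∘ F) = g ∘ (D.omega M ^ k) F := by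
    induction k generalizing F with
    | zero => simp
    | succ k ih =>
      rw [pow_succ, pow_succ, Module.End.mul_apply, omega_comp, ih, Module.End.mul_apply]
  rw [dpow_apply, h_pow]
  funext t
  simp [dpow_apply]

theorem contract_dpow (w : List A) (k : ℕ) (F : List A → M) :
    contract M (Env K A) w (D.dpow M k F) = D.dpow M k (contract M (Env K A) w F) := by
  have h_commute : Commute (contract M (Env K A) w) (D.omega M) :=
    LinearMap.ext fun F => D.contract_omega w F
  rw [dpow_apply, map_smul]
  exact congr_arg _ (LinearMap.congr_fun (h_commute.pow_right k) F)

theorem dpow_defect (k : ℕ) (F : List A → M) :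
    D.dpow M k (D.defect M F) = D.defect M (D.dpow M k F) := by
  simp [defect_apply, contract_dpow]

variable [Module K M] [IsScalarTower K (Env K A) M]

theorem omega_bimoduleCoboundary {n : ℕ} {F : List A → M} (hF : IsCochain K n F) :
    D.omega M (bimoduleCoboundary K A M F) =
      bimoduleCoboundary K A M (D.omega M F) + D.defect M F := by
  have h_rel (φ : A →ₐ[K] Env K A) : contractTensor φ hF (presented K D.T * D.dx) =
      -contractTensor φ hF (presented K D.U * D.dy) := by
    rw [← add_eq_zero_iff_eq_neg, ← map_add, D.rel, map_zero]
  rw [omega_apply, pairContraction_bimoduleCoboundary D.x D.T hF,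
    pairContraction_bimoduleCoboundary D.y D.U hF, h_rel, h_rel, omega_apply, map_smul, map_add,
    defect_apply, symT, symU]
  module

theorem _root_.WordCochain.IsCochain.omega {n : ℕ} {F : List A → M} (hF : IsCochain K n F) :
    IsCochain K (n - 2) (D.omega M F) :=
  .smul _ (.add (hF.pairContraction _ _) (hF.pairContraction _ _))

theorem omega_pow_bimoduleCoboundary (k : ℕ) {n : ℕ} {F : List A → M} (hF : IsCochain K n F) :
    (D.omega M ^ (k + 1)) (bimoduleCoboundary K A M F) =
      bimoduleCoboundary K A M ((D.omega M ^ (k + 1)) F) +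
        ((k + 1 : ℕ) : Env K A) • (D.omega M ^ k) (D.defect M F) := by
  induction k generalizing n F with
  | zero => simpa using D.omega_bimoduleCoboundary hF
  | succ k ih =>
    have h_commute : (D.omega M ^ k) (D.defect M (D.omega M F)) =
        (D.omega M ^ (k + 1)) (D.defect M F) := by
      rw [pow_succ, Module.End.mul_apply]
      exact congr_arg _ (LinearMap.congr_fun D.commute_defect_omega F)
    rw [pow_succ, Module.End.mul_apply, D.omega_bimoduleCoboundary hF, map_add, ih (hF.omega D),
      Module.End.mul_apply, h_commute]
    push_cast
    module

variable [CharZero K]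

theorem dpow_bimoduleCoboundary (k : ℕ) {n : ℕ} {F : List A → M} (hF : IsCochain K n F) :
    D.dpow M (k + 1) (bimoduleCoboundary K A M F) =
      bimoduleCoboundary K A M (D.dpow M (k + 1) F) + D.defect M (D.dpow M k F) := by
  have h_factorial :
      algebraMap K (Env K A) ((k + 1).factorial : K)⁻¹ * ((k + 1 : ℕ) : Env K A) =
        algebraMap K (Env K A) (k.factorial : K)⁻¹ := by
    rw [← map_natCast (algebraMap K (Env K A)), ← map_mul, Nat.factorial_succ, Nat.cast_mul,
      mul_inv_rev, inv_mul_cancel_right₀ (by exact_mod_cast k.succ_ne_zero)]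
  rw [dpow_apply, D.omega_pow_bimoduleCoboundary k hF, smul_add, smul_smul, h_factorial,
    dpow_apply, map_smul, ← dpow_defect, dpow_apply]

end DifferenceRelation

/-- The differential of a complex of pairs, of period two from degree one on, given by a matrix
factorization with entries `u`, `v`, `d`, `e`. In degree zero the second component is ignored. -/
def smallDifferential {S : Type*} [CommRing S] (M : Type*) [AddCommGroup M] [Module S M]
    (u v d e : S) (n : ℕ) : M × M →ₗ[S] M × M :=
  if n = 0 then (u • LinearMap.fst S M M).prod (v • LinearMap.fst S M M)
  else if Even n then (u • LinearMap.fst S M M - e • LinearMap.snd S M M).prod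
    (v • LinearMap.fst S M M + d • LinearMap.snd S M M)
  else (d • LinearMap.fst S M M + e • LinearMap.snd S M M).prod
    (u • LinearMap.snd S M M - v • LinearMap.fst S M M)

section SmallDifferential

variable {S M N : Type*} [CommRing S] [AddCommGroup M] [Module S M] [AddCommGroup N] [Module S N]
  (u v d e : S)

theorem smallDifferential_zero (c : M × M) :
    smallDifferential M u v d e 0 c = (u • c.1, v • c.1) := by
  simp [smallDifferential]

theorem smallDifferential_odd (k : ℕ) (c : M × M) :
    smallDifferential M u v d e (2 * k + 1) c = (d • c.1 + e • c.2, u • c.2 - v • c.1) := by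
  simp [smallDifferential]

theorem smallDifferential_even (k : ℕ) (c : M × M) :
    smallDifferential M u v d e (2 * (k + 1)) c = (u • c.1 - e • c.2, v • c.1 + d • c.2) := by
  simp [smallDifferential]

theorem smallDifferential_map (g : M →ₗ[S] N) (n : ℕ) (c : M × M) :
    smallDifferential N u v d e n (g.prodMap g c) =
      g.prodMap g (smallDifferential M u v d e n c) := by
  obtain ⟨_ | k, rfl | rfl⟩ := Nat.even_or_odd' n
  all_goals simp [smallDifferential]

variable {u v d e}

theorem smallDifferential_smallDifferential (h : d * u + e * v = 0) (n : ℕ) (c : M × M) :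
    smallDifferential M u v d e (n + 1) (smallDifferential M u v d e n c) = 0 := by
  have h_smul (m : M) : (d * u) • m + (e * v) • m = 0 := by rw [← add_smul, h, zero_smul]
  have h_even_odd (k : ℕ) : 2 * k + 1 + 1 = 2 * (k + 1) := by ring
  obtain ⟨_ | k, rfl | rfl⟩ := Nat.even_or_odd' n
  · rw [smallDifferential_odd _ _ _ _ 0, smallDifferential_zero]
    exact Prod.mk_eq_zero.2 ⟨by linear_combination (norm := module) h_smul c.1, by module⟩
  all_goals
    simp only [h_even_odd, smallDifferential_odd, smallDifferential_even]
    exact Prod.mk_eq_zero.2 ⟨by linear_combination (norm := module) h_smul c.1,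
      by linear_combination (norm := module) h_smul c.2⟩

end SmallDifferential

/-- Evaluation of word cochains at a word. -/
abbrev evalWord {A : Type*} (M S : Type*) [CommRing S] [AddCommGroup M] [Module S M] (w : List A) :
    (List A → M) →ₗ[S] M :=
  LinearMap.proj w

namespace DifferenceRelation

variable {K A M N : Type*} [Field K] [CommRing A] [Algebra K A]
  [AddCommGroup M] [Module (Env K A) M] [AddCommGroup N] [Module (Env K A) N]
  (D : DifferenceRelation K A)

variable (M) in
/-- The small complex attached to a relation between differences. -/
abbrev small (n : ℕ) : M × M →ₗ[Env K A] M × M :=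
  smallDifferential M D.dx D.dy D.symT D.symU n

variable (M) in
/-- The comparison map from word cochains to the small complex in degree `n`. -/
def toSmall (n : ℕ) : (List A → M) →ₗ[Env K A] M × M :=
  if n = 0 then (evalWord M _ []).prod 0
  else if Even n then (evalWord M _ [] ∘ₗ D.dpow M (n / 2)).prod
    ((evalWord M _ [D.x, D.y] - evalWord M _ [D.y, D.x]) ∘ₗ D.dpow M (n / 2 - 1))
  else (evalWord M _ [D.x] ∘ₗ D.dpow M (n / 2)).prod (evalWord M _ [D.y] ∘ₗ D.dpow M (n / 2))

theorem toSmall_zero (F : List A → M) : D.toSmall M 0 F = (F [], 0) := by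
  simp [toSmall]

theorem toSmall_odd (k : ℕ) (F : List A → M) :
    D.toSmall M (2 * k + 1) F = (D.dpow M k F [D.x], D.dpow M k F [D.y]) := by
  have h_half : (2 * k + 1) / 2 = k := by omega
  simp [toSmall, h_half]

theorem toSmall_even (k : ℕ) (F : List A → M) :
    D.toSmall M (2 * (k + 1)) F =
      (D.dpow M (k + 1) F [], D.dpow M k F [D.x, D.y] - D.dpow M k F [D.y, D.x]) := by
  simp [toSmall]

theorem toSmall_comp (g : M →ₗ[Env K A] N) (n : ℕ) (F : List A → M) :
    D.toSmall N n (g ∘ F) = g.prodMap g (D.toSmall M n F) := by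
  obtain ⟨k, rfl | rfl⟩ := Nat.even_or_odd' n
  · cases k <;> simp [toSmall_zero, toSmall_even, dpow_comp]
  · simp only [toSmall_odd, dpow_comp]
    rfl

theorem defect_nil (F : List A → M) :
    D.defect M F [] = D.symT • F [D.x] + D.symU • F [D.y] := by
  simp [defect_apply]

theorem defect_x (F : List A → M) :
    D.defect M F [D.x] = -(D.symU • (F [D.x, D.y] - F [D.y, D.x])) := by
  simp only [defect_apply, Pi.add_apply, Pi.smul_apply, contract_apply, shuffle_cons_cons,
    shuffle_nil_left, shuffle_nil_right, slice_apply, List.length_nil]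
  module

theorem defect_y (F : List A → M) :
    D.defect M F [D.y] = D.symT • (F [D.x, D.y] - F [D.y, D.x]) := by
  simp only [defect_apply, Pi.add_apply, Pi.smul_apply, contract_apply, shuffle_cons_cons,
    shuffle_nil_left, shuffle_nil_right, slice_apply, List.length_nil]
  module

theorem defect_xy_sub_yx (F : List A → M) :
    D.defect M F [D.x, D.y] - D.defect M F [D.y, D.x] = 0 := by
  simp only [defect_apply, Pi.add_apply, Pi.smul_apply, contract_apply, shuffle_cons_cons,
    shuffle_nil_left, shuffle_nil_right, slice_apply, List.length_nil]
  module

theorem bimoduleCoboundary_singleton (a : A) (F : List A → M) :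
    bimoduleCoboundary K A M F [a] = difference K a • F [] := by
  simp only [coboundary_cons, coboundary_nil, merge_nil, difference]
  module

theorem bimoduleCoboundary_pair_sub_swap (a b : A) (F : List A → M) :
    bimoduleCoboundary K A M F [a, b] - bimoduleCoboundary K A M F [b, a] =
      difference K a • F [b] - difference K b • F [a] := by
  simp only [coboundary_cons, coboundary_nil, merge_nil, merge_cons, slice_apply, difference,
    mul_comm b a]
  module

variable [Module K M] [IsScalarTower K (Env K A) M] [CharZero K]

theorem toSmall_bimoduleCoboundary (n : ℕ) {m : ℕ} {F : List A → M} (hF : IsCochain K m F) :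
    D.toSmall M (n + 1) (bimoduleCoboundary K A M F) = D.small M n (D.toSmall M n F) := by
  have h_succ (k : ℕ) : 2 * k + 1 + 1 = 2 * (k + 1) := by ring
  obtain ⟨k, rfl | rfl⟩ := Nat.even_or_odd' n
  · cases k with
    | zero =>
      rw [D.toSmall_odd 0, dpow_zero, smallDifferential_zero, toSmall_zero]
      simp only [LinearMap.id_apply, bimoduleCoboundary_singleton]
    | succ k =>
      rw [toSmall_odd, D.dpow_bimoduleCoboundary k hF, toSmall_even, smallDifferential_even]
      simp only [Pi.add_apply, bimoduleCoboundary_singleton, defect_x, defect_y]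
      rw [← sub_eq_add_neg]
  · rw [h_succ, toSmall_even, D.dpow_bimoduleCoboundary k hF, toSmall_odd, smallDifferential_odd]
    simp only [Pi.add_apply, coboundary_nil, defect_nil, zero_add, Prod.mk.injEq, true_and]
    cases k with
    | zero => simp only [dpow_zero, LinearMap.id_apply, bimoduleCoboundary_pair_sub_swap]
    | succ k =>
      rw [D.dpow_bimoduleCoboundary k hF]
      simp only [Pi.add_apply]
      rw [add_sub_add_comm, bimoduleCoboundary_pair_sub_swap, defect_xy_sub_yx, add_zero]

end DifferenceRelation

/-- The bimodule coinduced from a module over the base ring. -/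
def Coind (K A V : Type*) [CommRing K] [CommRing A] [Algebra K A] [AddCommGroup V] [Module K V] :
    Type _ :=
  Env K A →ₗ[K] V

namespace Coind

variable {K A V : Type*} [CommRing K] [CommRing A] [Algebra K A] [AddCommGroup V] [Module K V]

instance : AddCommGroup (Coind K A V) := inferInstanceAs (AddCommGroup (Env K A →ₗ[K] V))

instance : Module K (Coind K A V) := inferInstanceAs (Module K (Env K A →ₗ[K] V))

/-- Evaluation of an element of the coinduced bimodule. -/
def evalAt (z : Env K A) : Coind K A V →ₗ[K] V := LinearMap.applyₗ (R := K) z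

/-- The linear map underlying an element of the coinduced bimodule. -/
def toLinearMap (φ : Coind K A V) : Env K A →ₗ[K] V := φ

theorem evalAt_add_left (z z' : Env K A) (φ : Coind K A V) :
    evalAt (z + z') φ = evalAt z φ + evalAt z' φ := φ.toLinearMap.map_add z z'

theorem evalAt_smul_left (c : K) (z : Env K A) (φ : Coind K A V) :
    evalAt (c • z) φ = c • evalAt z φ := φ.toLinearMap.map_smul c z

@[ext] theorem ext {φ ψ : Coind K A V} (h : ∀ z : Env K A, evalAt z φ = evalAt z ψ) : φ = ψ :=
  LinearMap.ext h

theorem ext_left_mul_right {φ ψ : Coind K A V}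
    (h : ∀ p q : A, evalAt (left K A p * right K A q) φ = evalAt (left K A p * right K A q) ψ) :
    φ = ψ :=
  TensorProduct.ext' (M := A) (N := A) (P₂ := V) fun p q =>
    (congr_arg φ.toLinearMap (left_mul_right p q)).symm.trans
      ((h p q).trans (congr_arg ψ.toLinearMap (left_mul_right p q)))

instance : SMul (Env K A) (Coind K A V) where
  smul s φ := φ.toLinearMap ∘ₗ LinearMap.mulLeft K s

theorem evalAt_smul (s z : Env K A) (φ : Coind K A V) : evalAt z (s • φ) = evalAt (s * z) φ := rfl

instance : Module (Env K A) (Coind K A V) where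
  one_smul φ := by ext z; rw [evalAt_smul, one_mul]
  mul_smul s s' φ := by ext z; simp only [evalAt_smul]; ring_nf
  smul_zero _ := rfl
  smul_add _ _ _ := rfl
  add_smul s s' φ := by
    ext z
    rw [map_add, evalAt_smul, evalAt_smul, evalAt_smul, add_mul, evalAt_add_left]
  zero_smul φ := by
    ext z
    rw [evalAt_smul, zero_mul, map_zero]
    exact φ.toLinearMap.map_zero

instance : IsScalarTower K (Env K A) (Coind K A V) where
  smul_assoc c s φ := by
    ext z
    rw [evalAt_smul, smul_mul_assoc, evalAt_smul_left, map_smul, evalAt_smul]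

end Coind

open Coind

section Acyclic

variable {K A V : Type*} [CommRing K] [CommRing A] [Algebra K A] [AddCommGroup V] [Module K V]

theorem IsCochain.of_evalAt {n : ℕ} {G : List A → Coind K A V}
    (h : ∀ p q : A, IsCochain K n (evalAt (left K A p * right K A q) ∘ G)) : IsCochain K n G where
  eq_zero t ht := ext_left_mul_right fun p q => by simpa using (h p q).eq_zero t ht
  isLinearMap u v :=
    { map_add a b := ext_left_mul_right fun p q => by
        simpa using ((h p q).isLinearMap u v).map_add a b
      map_smul c a := ext_left_mul_right fun p q => by
        simpa using ((h p q).isLinearMap u v).map_smul c a }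

theorem evalAt_bimoduleCoboundary {G : List A → Coind K A V} {H : A → List A → Coind K A V}
    (h : ∀ t p q, evalAt (left K A p * right K A q) (G t) = evalAt (right K A q) (H p t))
    (a : A) (t : List A) (p q : A) :
    evalAt (left K A p * right K A q) (bimoduleCoboundary K A _ G (a :: t)) =
      evalAt (right K A q) (bimoduleCoboundary K A _ (H p) (a :: t)) +
        evalAt (right K A q) (H (p * a) t) - evalAt (left K A a * right K A q) (H p t) := by
  have h_left (b : A) (t : List A) :
      evalAt (left K A b * (left K A p * right K A q)) (G t) =
        evalAt (right K A q) (H (p * b) t) := by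
    rw [← h, map_mul]
    ring_nf
  have h_right (b : A) (t : List A) :
      evalAt (right K A b * (left K A p * right K A q)) (G t) =
        evalAt (right K A b * right K A q) (H p t) := by
    rw [← map_mul, ← h, map_mul]
    ring_nf
  induction t generalizing G H a with
  | nil =>
    simp only [coboundary_cons, coboundary_nil, merge_nil, map_add, map_sub, map_neg, map_zero,
      evalAt_smul, h_left, h_right]
    abel
  | cons b t ih =>
    have h_slice := ih (G := slice _ (Env K A) a G) (H := fun p => slice _ (Env K A) a (H p))
      (fun t p q => h _ p q) b (fun b t => h_left b _) (fun b t => h_right b _)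
    rw [coboundary_cons, coboundary_cons _ _ a]
    simp only [merge_cons, map_add, map_sub, evalAt_smul, h_left, h, h_slice]
    simp only [slice_apply]
    abel

theorem exists_bimoduleCoboundary_eq {n : ℕ} {F : List A → Coind K A V}
    (hF : IsCochain K (n + 1) F) (h0 : bimoduleCoboundary K A _ F = 0) :
    ∃ G, IsCochain K n G ∧ bimoduleCoboundary K A _ G = F := by
  let G : List A → Coind K A V := fun t => TensorProduct.lift (LinearMap.mk₂ K
    (fun p q => evalAt (right K A q) (F (p :: t)))
    (fun p p' q => (congr_arg _ ((hF.isLinearMap [] t).map_add p p')).trans (map_add _ _ _))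
    (fun c p q => (congr_arg _ ((hF.isLinearMap [] t).map_smul c p)).trans (map_smul _ _ _))
    (fun p q q' => by rw [map_add, evalAt_add_left])
    (fun c p q => by rw [map_smul, evalAt_smul_left]))
  have hG (t : List A) (p q : A) : evalAt (left K A p * right K A q) (G t) =
      evalAt (right K A q) (slice _ (Env K A) p F t) := by
    rw [left_mul_right]
    rfl
  refine ⟨G, .of_evalAt fun p q => ?_, funext fun t => ext_left_mul_right fun p q => ?_⟩
  · rw [show evalAt (left K A p * right K A q) ∘ G = _ from funext fun t => hG t p q]
    exact (hF.slice (S := Env K A) p).map (evalAt (right K A q))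
  · cases t with
    | nil => rw [hF.eq_zero [] (Nat.succ_ne_zero n).symm, coboundary_nil]
    | cons a t =>
      have h_cocycle := congr_arg (evalAt (V := V) (right K A q)) (congr_fun h0 (p :: a :: t))
      rw [coboundary_cons] at h_cocycle
      rw [evalAt_bimoduleCoboundary (H := fun p => slice _ (Env K A) p F) hG]
      simp only [merge_cons, map_add, map_sub, evalAt_smul, Pi.zero_apply, map_zero,
        slice_apply] at h_cocycle ⊢
      rw [← sub_eq_zero, ← neg_eq_zero, ← h_cocycle]
      abel

end Acyclic

theorem exists_comp_eq_of_ker_le {K V W X : Type*} [Field K] [AddCommGroup V] [Module K V]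
    [AddCommGroup W] [Module K W] [AddCommGroup X] [Module K X] (g : V →ₗ[K] W) (f : V →ₗ[K] X)
    (h : LinearMap.ker g ≤ LinearMap.ker f) : ∃ e : W →ₗ[K] X, e ∘ₗ g = f := by
  obtain ⟨e, he⟩ := LinearMap.exists_extend
    ((LinearMap.ker g).liftQ f h ∘ₗ g.quotKerEquivRange.symm.toLinearMap)
  refine ⟨e, LinearMap.ext fun v => ?_⟩
  have h_symm : g.quotKerEquivRange.symm (g.rangeRestrict v) = (LinearMap.ker g).mkQ v :=
    (LinearEquiv.symm_apply_eq _).2 rfl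
  simpa [h_symm] using LinearMap.congr_fun he (g.rangeRestrict v)

section SmallAcyclic

variable {K A V : Type*} [Field K] [CommRing A] [Algebra K A] [AddCommGroup V] [Module K V]

/-- The transpose of `smallDifferential`. -/
def smallTranspose {S : Type*} [CommRing S] (u v d e : S) (n : ℕ) : S × S →ₗ[S] S × S :=
  if n = 0 then (u • LinearMap.fst S S S + v • LinearMap.snd S S S).prod 0
  else if Even n then (u • LinearMap.fst S S S + v • LinearMap.snd S S S).prod
    (d • LinearMap.snd S S S - e • LinearMap.fst S S S)
  else (d • LinearMap.fst S S S - v • LinearMap.snd S S S).prod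
    (e • LinearMap.fst S S S + u • LinearMap.snd S S S)

variable (K A V) in
/-- The duality between pairs of elements of a coinduced bimodule and functionals on pairs. -/
def pairing : (Coind K A V × Coind K A V) ≃ₗ[K] (Env K A × Env K A →ₗ[K] V) :=
  LinearMap.coprodEquiv (R := K) K

theorem pairing_apply (c : Coind K A V × Coind K A V) (z : Env K A × Env K A) :
    pairing K A V c z = evalAt z.1 c.1 + evalAt z.2 c.2 := rfl

theorem pairing_smallDifferential (u v d e : Env K A) (n : ℕ) (c : Coind K A V × Coind K A V)
    (z : Env K A × Env K A) :
    pairing K A V (smallDifferential _ u v d e n c) z =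
      pairing K A V c (smallTranspose u v d e n z) := by
  have h_sub (z z' : Env K A) (φ : Coind K A V) : evalAt (z - z') φ = evalAt z φ - evalAt z' φ :=
    φ.toLinearMap.map_sub z z'
  have h_zero (φ : Coind K A V) : evalAt 0 φ = 0 := φ.toLinearMap.map_zero
  unfold smallDifferential smallTranspose
  split_ifs
  all_goals
    simp only [LinearMap.prod_apply, Function.prod, LinearMap.add_apply, LinearMap.sub_apply,
      LinearMap.smul_apply, LinearMap.fst_apply, LinearMap.snd_apply, LinearMap.zero_apply,
      pairing_apply, map_add, map_sub, evalAt_smul, smul_eq_mul, evalAt_add_left, h_sub, h_zero]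
    abel

theorem ker_smallTranspose_le {S : Type*} [CommRing S] {u v d e : S}
    (exact_odd : ∀ p q, u * p + v * q = 0 → ∃ s t, p = d * s - v * t ∧ q = e * s + u * t)
    (exact_even : ∀ p q, d * p - v * q = 0 → e * p + u * q = 0 →
      ∃ s t, p = u * s + v * t ∧ q = d * t - e * s) (n : ℕ) (z : S × S)
    (hz : smallTranspose u v d e n z = 0) : ∃ w, smallTranspose u v d e (n + 1) w = z := by
  obtain ⟨p, q⟩ := z
  by_cases hn : Even n
  · have h_rel : u * p + v * q = 0 := by
      unfold smallTranspose at hz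
      split_ifs at hz
      all_goals simpa using congr_arg Prod.fst hz
    obtain ⟨s, t, rfl, rfl⟩ := exact_odd p q h_rel
    exact ⟨(s, t), by simp [smallTranspose, hn, Nat.even_add_one]⟩
  · have hn0 : n ≠ 0 := by rintro rfl; simp at hn
    simp only [smallTranspose, hn, hn0, if_false] at hz
    obtain ⟨s, t, rfl, rfl⟩ := exact_even p q (by simpa using congr_arg Prod.fst hz)
      (by simpa using congr_arg Prod.snd hz)
    exact ⟨(s, t), by simp [smallTranspose, hn, Nat.even_add_one]⟩

theorem exists_smallDifferential_eq {u v d e : Env K A}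
    (exact_odd : ∀ p q, u * p + v * q = 0 → ∃ s t, p = d * s - v * t ∧ q = e * s + u * t)
    (exact_even : ∀ p q, d * p - v * q = 0 → e * p + u * q = 0 →
      ∃ s t, p = u * s + v * t ∧ q = d * t - e * s)
    (n : ℕ) {c : Coind K A V × Coind K A V} (hc : smallDifferential _ u v d e (n + 1) c = 0) :
    ∃ b, smallDifferential _ u v d e n b = c := by
  obtain ⟨g, hg⟩ := exists_comp_eq_of_ker_le
    ((smallTranspose u v d e n).restrictScalars K) (pairing K A V c) fun z hz => by
      obtain ⟨w, rfl⟩ := ker_smallTranspose_le exact_odd exact_even n z hz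
      rw [LinearMap.mem_ker, ← pairing_smallDifferential, hc, map_zero, LinearMap.zero_apply]
  refine ⟨(pairing K A V).symm g, (pairing K A V).injective (LinearMap.ext fun z => ?_)⟩
  rw [pairing_smallDifferential, LinearEquiv.apply_symm_apply, ← hg]
  rfl

end SmallAcyclic

open Coind

universe u v

section DimensionShift

variable {K : Type v} {A M : Type u} [Field K] [CommRing A] [Algebra K A] [AddCommGroup M]
  [Module K M] [Module (Env K A) M] [IsScalarTower K (Env K A) M]

variable (K A M) in
/-- The embedding of a bimodule into a coinduced one. -/
def embed : M →ₗ[Env K A] Coind K A M where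
  toFun m := (LinearMap.toSpanSingleton (Env K A) M m).restrictScalars K
  map_add' m m' := Coind.ext fun z => smul_add z m m'
  map_smul' s m := Coind.ext fun z => by
    change z • s • m = (s * z) • m
    rw [smul_smul, mul_comm]

theorem evalAt_one_embed (m : M) : evalAt 1 (embed K A M m) = m := one_smul _ m

theorem embed_injective : Function.Injective (embed K A M) :=
  Function.LeftInverse.injective evalAt_one_embed

variable (K A M) in
/-- The quotient of the coinduced bimodule by the image of `embed`. -/
abbrev CoindQuotient : Type u := Coind K A M ⧸ LinearMap.range (embed K A M)

variable (K A M) in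
/-- The projection to `CoindQuotient`. -/
abbrev proj : Coind K A M →ₗ[Env K A] CoindQuotient K A M := (LinearMap.range (embed K A M)).mkQ

theorem exact_embed_proj : Function.Exact (embed K A M) (proj K A M) :=
  LinearMap.exact_map_mkQ_range _

theorem proj_surjective : Function.Surjective (proj K A M) := Submodule.mkQ_surjective _

variable (K A M) in
/-- The embedding of pairs into pairs of elements of a coinduced bimodule. -/
abbrev embedPair : M × M →ₗ[Env K A] Coind K A M × Coind K A M :=
  (embed K A M).prodMap (embed K A M)

variable (K A M) in
/-- The projection of pairs of elements of a coinduced bimodule. -/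
abbrev projPair : Coind K A M × Coind K A M →ₗ[Env K A] CoindQuotient K A M × CoindQuotient K A M :=
  (proj K A M).prodMap (proj K A M)

theorem exact_embedPair_projPair : Function.Exact (embedPair K A M) (projPair K A M) := fun c => by
  rw [LinearMap.prodMap_apply, Prod.mk_eq_zero, exact_embed_proj, exact_embed_proj]
  exact ⟨fun ⟨⟨a, ha⟩, ⟨b, hb⟩⟩ => ⟨(a, b), Prod.ext ha hb⟩,
    fun ⟨b, hb⟩ => ⟨⟨b.1, congr_arg Prod.fst hb⟩, ⟨b.2, congr_arg Prod.snd hb⟩⟩⟩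

theorem embedPair_injective : Function.Injective (embedPair K A M) :=
  embed_injective.prodMap embed_injective

theorem embed_comp_injective {F G : List A → M} (h : embed K A M ∘ F = embed K A M ∘ G) : F = G :=
  embed_injective.comp_left h

theorem IsCochain.exists_embed_comp_eq {n : ℕ} {F : List A → Coind K A M} (hF : IsCochain K n F)
    (h : proj K A M ∘ F = 0) : ∃ G, IsCochain K n G ∧ embed K A M ∘ G = F := by
  refine ⟨evalAt 1 ∘ F, hF.map (evalAt 1), funext fun t => ?_⟩
  obtain ⟨m, hm⟩ := (exact_embed_proj _).1 (congr_fun h t)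
  rw [Function.comp_apply, Function.comp_apply, ← hm, evalAt_one_embed]

theorem IsCochain.exists_proj_comp_eq {n : ℕ} {F : List A → CoindQuotient K A M}
    (hF : IsCochain K n F) : ∃ G, IsCochain K n G ∧ proj K A M ∘ G = F := by
  obtain ⟨s, hs⟩ := ((proj K A M).restrictScalars K).exists_rightInverse_of_surjective
    (LinearMap.range_eq_top.2 proj_surjective)
  exact ⟨s ∘ F, hF.map s, funext fun t => LinearMap.congr_fun hs (F t)⟩

theorem IsCochain.exists_bimoduleCoboundary_eq_embed_comp {n : ℕ} {F : List A → M}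
    (hF : IsCochain K (n + 1) F) (h0 : bimoduleCoboundary K A M F = 0) :
    ∃ G, IsCochain K n G ∧ bimoduleCoboundary K A _ G = embed K A M ∘ F :=
  exists_bimoduleCoboundary_eq (hF.map ((embed K A M).restrictScalars K)) <| by
    rw [coboundary_comp, h0]
    exact funext fun _ => map_zero _

end DimensionShift

/-- The cochain of degree zero given by an element. -/
def single {A M : Type*} [Zero M] (m : M) : List A → M
  | [] => m
  | _ :: _ => 0

theorem IsCochain.single {K A M : Type*} [CommRing K] [AddCommGroup A] [Module K A]
    [AddCommGroup M] [Module K M] (m : M) : IsCochain K 0 (single m : List A → M) where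
  eq_zero t ht := by
    cases t
    exacts [absurd rfl ht, rfl]
  isLinearMap u v := by
    cases u <;> exact LinearMap.isLinear (0 : A →ₗ[K] M)

namespace DifferenceRelation

section Comparison

variable {K : Type v} {A M : Type u} [Field K] [CommRing A] [Algebra K A] [AddCommGroup M]
  [Module K M] [Module (Env K A) M] [IsScalarTower K (Env K A) M] (D : DifferenceRelation K A)

/-- The conditions under which the small complexes compute Hochschild cohomology: `x` and `y`
generate the differences, and the complex of free modules over the enveloping algebra attached to
the matrix factorization `D.dx`, `D.dy`, `D.symT`, `D.symU` is exact in positive degrees. -/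
structure IsResolution : Prop where
  span_difference : ∀ a : A, ∃ p q, difference K a = p * D.dx + q * D.dy
  exact_odd : ∀ p q, D.dx * p + D.dy * q = 0 →
    ∃ s t, p = D.symT * s - D.dy * t ∧ q = D.symU * s + D.dx * t
  exact_even : ∀ p q, D.symT * p - D.dy * q = 0 → D.symU * p + D.dx * q = 0 →
    ∃ s t, p = D.dx * s + D.dy * t ∧ q = D.symT * t - D.symU * s

variable (M) in
/-- The comparison map is injective on cohomology in degree `n + 1` (`exists_primitive`) and
surjective (`exists_cocycle`). -/
structure IsComparison (n : ℕ) : Prop where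
  exists_primitive : ∀ F, IsCochain K (n + 1) F → bimoduleCoboundary K A M F = 0 →
    (∃ c, D.small M n c = D.toSmall M (n + 1) F) →
      ∃ G, IsCochain K n G ∧ bimoduleCoboundary K A M G = F
  exists_cocycle : ∀ c, D.small M (n + 1) c = 0 →
    ∃ F, IsCochain K (n + 1) F ∧ bimoduleCoboundary K A M F = 0 ∧
      ∃ b, D.toSmall M (n + 1) F = c + D.small M n b

variable {D}

theorem IsResolution.exists_small_eq {V : Type*} [AddCommGroup V] [Module K V]
    (hD : D.IsResolution) (n : ℕ) {c : Coind K A V × Coind K A V} (hc : D.small _ (n + 1) c = 0) :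
    ∃ b, D.small _ n b = c :=
  exists_smallDifferential_eq hD.exact_odd hD.exact_even n hc

theorem IsResolution.exists_small_eq_embed (hD : D.IsResolution) (n : ℕ) {c : M × M}
    (hc : D.small M (n + 1) c = 0) : ∃ e, D.small _ n e = embedPair K A M c :=
  hD.exists_small_eq n (by rw [smallDifferential_map, hc, map_zero])

theorem IsResolution.bimoduleCoboundary_eq_zero (hD : D.IsResolution) {G : List A → M}
    (hG : IsCochain K 0 G) (h : D.small M 0 (D.toSmall M 0 G) = 0) :
    bimoduleCoboundary K A M G = 0 := by
  rw [toSmall_zero, smallDifferential_zero, Prod.mk_eq_zero] at h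
  funext t
  by_cases ht : t.length = 1
  · obtain ⟨a, rfl⟩ := List.length_eq_one_iff.1 ht
    obtain ⟨p, q, hpq⟩ := hD.span_difference a
    rw [bimoduleCoboundary_singleton, hpq, add_smul, mul_smul, mul_smul, h.1, h.2]
    simp
  · exact (hG.coboundary _ _).eq_zero t ht

variable [CharZero K]

theorem IsResolution.exists_primitive_zero (hD : D.IsResolution) {F : List A → M}
    (hF : IsCochain K 1 F) (h0 : bimoduleCoboundary K A M F = 0)
    (h_small : ∃ c, D.small M 0 c = D.toSmall M 1 F) :
    ∃ G, IsCochain K 0 G ∧ bimoduleCoboundary K A M G = F := by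
  obtain ⟨κ, hκ⟩ := h_small
  obtain ⟨G, hG, hGF⟩ := hF.exists_bimoduleCoboundary_eq_embed_comp h0
  refine ⟨single κ.1, IsCochain.single _, embed_comp_injective (K := K) ?_⟩
  have h_single : IsCochain K 0 (embed K A M ∘ (single κ.1 : List A → M)) :=
    (IsCochain.single κ.1).map ((embed K A M).restrictScalars K)
  rw [← coboundary_comp, ← hGF, eq_comm, ← sub_eq_zero, ← map_sub]
  refine hD.bimoduleCoboundary_eq_zero (hG.sub h_single) ?_
  rw [map_sub, map_sub, ← D.toSmall_bimoduleCoboundary 0 hG, hGF, toSmall_comp, toSmall_comp, ← hκ,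
    smallDifferential_map, toSmall_zero, smallDifferential_zero, smallDifferential_zero]
  exact sub_self _

theorem IsResolution.exists_cocycle_zero (hD : D.IsResolution) {c : M × M}
    (hc : D.small M 1 c = 0) : ∃ F, IsCochain K 1 F ∧ bimoduleCoboundary K A M F = 0 ∧
      ∃ b, D.toSmall M 1 F = c + D.small M 0 b := by
  obtain ⟨e, he⟩ := hD.exists_small_eq_embed 0 hc
  have h_toSmall : D.small _ 0 (D.toSmall _ 0 (single e.1)) = embedPair K A M c := by
    rw [← he, toSmall_zero, smallDifferential_zero, smallDifferential_zero]
    rfl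
  have h_cocycle : bimoduleCoboundary K A _ (proj K A M ∘ single e.1) = 0 := by
    refine hD.bimoduleCoboundary_eq_zero
      ((IsCochain.single (K := K) e.1).map ((proj K A M).restrictScalars K)) ?_
    rw [toSmall_comp, smallDifferential_map, h_toSmall]
    exact exact_embedPair_projPair.apply_apply_eq_zero c
  rw [coboundary_comp] at h_cocycle
  obtain ⟨F, hF, hFe⟩ :=
    ((IsCochain.single (K := K) e.1).coboundary _ _).exists_embed_comp_eq h_cocycle
  refine ⟨F, hF, embed_comp_injective (K := K) ?_, 0, embedPair_injective (K := K) (A := A) ?_⟩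
  · rw [← coboundary_comp, hFe, coboundary_coboundary]
    exact funext fun _ => (map_zero _).symm
  · rw [← toSmall_comp, hFe, D.toSmall_bimoduleCoboundary 0 (.single e.1), h_toSmall, map_zero,
      add_zero]

theorem IsResolution.exists_primitive_succ (hD : D.IsResolution) {n : ℕ}
    (ih : D.IsComparison (CoindQuotient K A M) n) {F : List A → M}
    (hF : IsCochain K (n + 2) F) (h0 : bimoduleCoboundary K A M F = 0)
    (h_small : ∃ c, D.small M (n + 1) c = D.toSmall M (n + 2) F) :
    ∃ G, IsCochain K (n + 1) G ∧ bimoduleCoboundary K A M G = F := by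
  obtain ⟨κ, hκ⟩ := h_small
  obtain ⟨G, hG, hGF⟩ := hF.exists_bimoduleCoboundary_eq_embed_comp h0
  have h_cocycle : D.small _ (n + 1) (D.toSmall _ (n + 1) G - embedPair K A M κ) = 0 := by
    rw [map_sub, ← D.toSmall_bimoduleCoboundary (n + 1) hG, hGF, toSmall_comp, ← hκ,
      smallDifferential_map, sub_self]
  obtain ⟨b, hb⟩ := hD.exists_small_eq n h_cocycle
  obtain ⟨_, h_quot, hHG⟩ := ih.exists_primitive (proj K A M ∘ G)
    (hG.map ((proj K A M).restrictScalars K))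
    (by
      rw [coboundary_comp, hGF]
      exact funext fun t => exact_embed_proj.apply_apply_eq_zero (F t))
    ⟨projPair K A M b, by
      rw [smallDifferential_map, hb, toSmall_comp, map_sub,
        exact_embedPair_projPair.apply_apply_eq_zero κ, sub_zero]⟩
  obtain ⟨H, hH, rfl⟩ := h_quot.exists_proj_comp_eq
  rw [coboundary_comp] at hHG
  obtain ⟨G', hG', hGG⟩ := (hG.sub (hH.coboundary (left K A) (right K A))).exists_embed_comp_eq
    (funext fun t => by
      simpa [sub_eq_zero] using (congr_fun hHG t).symm)
  refine ⟨G', hG', embed_comp_injective (K := K) ?_⟩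
  rw [← coboundary_comp, hGG, map_sub, coboundary_coboundary, sub_zero, hGF]

theorem IsResolution.exists_cocycle_succ (hD : D.IsResolution) {n : ℕ}
    (ih : D.IsComparison (CoindQuotient K A M) n) {c : M × M}
    (hc : D.small M (n + 2) c = 0) :
    ∃ F, IsCochain K (n + 2) F ∧ bimoduleCoboundary K A M F = 0 ∧
      ∃ b, D.toSmall M (n + 2) F = c + D.small M (n + 1) b := by
  obtain ⟨e, he⟩ := hD.exists_small_eq_embed (n + 1) hc
  obtain ⟨_, h_quot, hF0, b, hb⟩ := ih.exists_cocycle (projPair K A M e) (by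
    rw [smallDifferential_map, he]
    exact exact_embedPair_projPair.apply_apply_eq_zero c)
  obtain ⟨F, hF, rfl⟩ := h_quot.exists_proj_comp_eq
  obtain ⟨b, rfl⟩ := proj_surjective.prodMap proj_surjective b
  rw [coboundary_comp] at hF0
  obtain ⟨G, hG, hGF⟩ := (hF.coboundary _ _).exists_embed_comp_eq hF0
  obtain ⟨m, hm⟩ := (exact_embedPair_projPair (D.toSmall _ (n + 1) F - (e + D.small _ n b))).1 (by
    rw [map_sub, ← toSmall_comp, hb, map_add, ← smallDifferential_map]
    exact sub_self _)
  have h_rel : D.symT * D.dx + D.symU * D.dy = 0 := D.symT_mul_dx_add_symU_mul_dy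
  refine ⟨G, hG, embed_comp_injective (K := K) ?_, m, embedPair_injective (K := K) (A := A) ?_⟩
  · rw [← coboundary_comp, hGF, coboundary_coboundary]
    exact funext fun _ => (map_zero _).symm
  · rw [← toSmall_comp, hGF, D.toSmall_bimoduleCoboundary (n + 1) hF, map_add,
      ← smallDifferential_map, hm, map_sub, map_add, he, smallDifferential_smallDifferential h_rel]
    abel

theorem IsResolution.isComparison (hD : D.IsResolution) (n : ℕ) :
    ∀ (M : Type u) [AddCommGroup M] [Module K M] [Module (Env K A) M]
      [IsScalarTower K (Env K A) M], D.IsComparison M n := by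
  induction n with
  | zero =>
    exact fun M _ _ _ _ => ⟨fun _ => hD.exists_primitive_zero, fun _ => hD.exists_cocycle_zero⟩
  | succ n ih =>
    exact fun M _ _ _ _ => ⟨fun _ => hD.exists_primitive_succ (ih _),
      fun _ => hD.exists_cocycle_succ (ih _)⟩

end Comparison

end DifferenceRelation

end WordCochain

/-! ### The resolution of a plane curve -/

namespace WordCochain

open TensorProduct

section Factorization

/-- Exactness in degree one of the Koszul complex of two elements. -/
def KoszulExact {B : Type*} [CommRing B] (u v : B) : Prop :=
  ∀ p q, u * p + v * q = 0 → ∃ t, p = -(v * t) ∧ q = u * t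

theorem KoszulExact.of_ringEquiv {B C : Type*} [CommRing B] [CommRing C] (f : B ≃+* C) {u v : B}
    (h : KoszulExact (f u) (f v)) : KoszulExact u v := by
  intro p q hpq
  obtain ⟨t, hp, hq⟩ := h (f p) (f q) (by rw [← map_mul, ← map_mul, ← map_add, hpq, map_zero])
  exact ⟨f.symm t, f.injective (by simp [hp]), f.injective (by simp [hq])⟩

variable {B S : Type*} [CommRing B] [CommRing S] {π : B →+* S} {u v d e : B}

theorem KoszulExact.exists_of_factorization (h : KoszulExact u v) (hπ : Function.Surjective π)
    (h_ker : RingHom.ker π = Ideal.span {d * u + e * v})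
    (p q : S) (hpq : π u * p + π v * q = 0) :
    ∃ s t, p = π d * s - π v * t ∧ q = π e * s + π u * t := by
  obtain ⟨p, rfl⟩ := hπ p
  obtain ⟨q, rfl⟩ := hπ q
  obtain ⟨c, hc⟩ := Ideal.mem_span_singleton'.1
    (h_ker.le ((by simpa using hpq) : π (u * p + v * q) = 0))
  obtain ⟨t, hp, hq⟩ := h (p - d * c) (q - e * c) (by linear_combination -hc)
  refine ⟨π c, π t, ?_, ?_⟩
  · rw [sub_eq_iff_eq_add.1 hp, map_add, map_neg, map_mul, map_mul, neg_add_eq_sub]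
  · rw [sub_eq_iff_eq_add.1 hq, map_add, map_mul, map_mul, add_comm]

theorem exists_of_factorization (hπ : Function.Surjective π)
    (h_ker : RingHom.ker π = Ideal.span {d * u + e * v})
    (h_reg : ∀ b, (d * u + e * v) * b = 0 → b = 0)
    (p q : S) (h₁ : π d * p - π v * q = 0) (h₂ : π e * p + π u * q = 0) :
    ∃ s t, p = π u * s + π v * t ∧ q = π d * t - π e * s := by
  obtain ⟨p, rfl⟩ := hπ p
  obtain ⟨q, rfl⟩ := hπ q
  obtain ⟨a, ha⟩ := Ideal.mem_span_singleton'.1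
    (h_ker.le ((by simpa using h₁) : π (d * p - v * q) = 0))
  obtain ⟨b, hb⟩ := Ideal.mem_span_singleton'.1
    (h_ker.le ((by simpa using h₂) : π (e * p + u * q) = 0))
  have hp : p = u * a + v * b :=
    sub_eq_zero.1 (h_reg _ (by linear_combination -u * ha - v * hb))
  have hq : q = d * b - e * a :=
    sub_eq_zero.1 (h_reg _ (by linear_combination e * ha - d * hb))
  exact ⟨π a, π b, by rw [hp, map_add, map_mul, map_mul],
    by rw [hq, map_sub, map_mul, map_mul]⟩

end Factorization

section Koszul

theorem eq_zero_of_C_sub_X_mul {B : Type*} [CommRing B] (c : B) {p : Polynomial B}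
    (h : (Polynomial.C c - Polynomial.X) * p = 0) : p = 0 :=
  (Polynomial.monic_X_sub_C c).isRegular.left
    (by simp only [mul_zero]; linear_combination -h)

open Polynomial in
theorem koszulExact_polynomial {B : Type*} [CommRing B] (c : B) {w : B}
    (hw : ∀ b, w * b = 0 → b = 0) : KoszulExact (C c - X) (C w) := by
  intro p q h
  have h_eval := congr_arg (eval c) h
  simp only [eval_add, eval_mul, eval_sub, eval_C, eval_X, sub_self, zero_mul, zero_add,
    eval_zero] at h_eval
  obtain ⟨t, rfl⟩ := dvd_iff_isRoot.2 (hw _ h_eval : IsRoot q c)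
  have hp : p - C w * t = 0 := eq_zero_of_C_sub_X_mul c (by linear_combination h)
  exact ⟨-t, by linear_combination hp, by ring⟩

open MvPolynomial in
theorem koszulExact_mvPolynomial {B : Type*} [CommRing B] (c : Fin 2 → B) :
    KoszulExact (C (c 0) - X 0 : MvPolynomial (Fin 2) B) (C (c 1) - X 1) := by
  refine .of_ringEquiv (finSuccEquiv B 1).toRingEquiv ?_
  have h₀ : (finSuccEquiv B 1).toRingEquiv (C (c 0) - X 0) =
      Polynomial.C (C (c 0)) - Polynomial.X := by
    change finSuccEquiv B 1 _ = _
    simp [finSuccEquiv_apply]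
  have h₁ : (finSuccEquiv B 1).toRingEquiv (C (c 1) - X 1) = Polynomial.C (C (c 1) - X 0) := by
    change finSuccEquiv B 1 (C (c 1) - X (Fin.succ 0)) = _
    rw [map_sub, finSuccEquiv_X_succ, finSuccEquiv_apply]
    simp
  rw [h₀, h₁]
  refine koszulExact_polynomial _ fun b hb => ?_
  have h_succ := congr_arg (finSuccEquiv B 0) hb
  rw [map_mul, map_sub, finSuccEquiv_X_zero, map_zero, finSuccEquiv_apply, eval₂Hom_C] at h_succ
  simpa using eq_zero_of_C_sub_X_mul _ h_succ

variable {K A : Type*} [CommRing K] [CommRing A] [Algebra K A]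

theorem koszulExact_tensor (c : Fin 2 → A) :
    KoszulExact (c 0 ⊗ₜ 1 - 1 ⊗ₜ MvPolynomial.X 0 : A ⊗[K] MvPolynomial (Fin 2) K)
      (c 1 ⊗ₜ 1 - 1 ⊗ₜ MvPolynomial.X 1) := by
  refine .of_ringEquiv (MvPolynomial.algebraTensorAlgEquiv K A).toRingEquiv ?_
  have h : ∀ i, (MvPolynomial.algebraTensorAlgEquiv K A).toRingEquiv
      (c i ⊗ₜ 1 - 1 ⊗ₜ MvPolynomial.X i) = MvPolynomial.C (c i) - MvPolynomial.X i := fun i => by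
    change MvPolynomial.algebraTensorAlgEquiv K A _ = _
    simp [MvPolynomial.algebraTensorAlgEquiv_tmul, MvPolynomial.smul_eq_C_mul]
  rw [h, h]
  exact koszulExact_mvPolynomial c

theorem eq_zero_of_one_tmul_mul [Module.Flat K A] {P : Type*} [CommRing P] [IsDomain P]
    [Algebra K P] {R : P} (hR : R ≠ 0) {z : A ⊗[K] P} (h : ((1 : A) ⊗ₜ[K] R) * z = 0) :
    z = 0 := by
  have h_lTensor : ∀ z : A ⊗[K] P, (1 : A) ⊗ₜ[K] R * z = (LinearMap.mulLeft K R).lTensor A z := by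
    intro z
    induction z with
    | zero => simp
    | tmul a b => simp
    | add a b ha hb => rw [mul_add, map_add, ha, hb]
  exact Module.Flat.lTensor_preserves_injective_linearMap (M := A) (LinearMap.mulLeft K R)
    (mul_right_injective₀ hR) (by rw [← h_lTensor, h, map_zero])

end Koszul

section Functoriality

variable {K A B : Type*} [CommRing K] [CommRing A] [Algebra K A] [CommRing B] [Algebra K B]

theorem env_algHom_ext {C : Type*} [CommRing C] [Algebra K C] {f g : Env K A →ₐ[K] C}
    (h_left : ∀ a, f (left K A a) = g (left K A a))
    (h_right : ∀ a, f (right K A a) = g (right K A a)) : f = g :=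
  Algebra.TensorProduct.ext (A := A) (B := A) (AlgHom.ext h_left) (AlgHom.ext h_right)

/-- Functoriality of the enveloping algebra. -/
def envMap (f : A →ₐ[K] B) : Env K A →ₐ[K] Env K B := Algebra.TensorProduct.map f f

@[simp] theorem envMap_left (f : A →ₐ[K] B) (a : A) :
    envMap f (left K A a) = left K B (f a) :=
  (Algebra.TensorProduct.map_tmul f f a 1).trans (by rw [map_one]; rfl)

@[simp] theorem envMap_right (f : A →ₐ[K] B) (a : A) :
    envMap f (right K A a) = right K B (f a) :=
  (Algebra.TensorProduct.map_tmul f f 1 a).trans (by rw [map_one]; rfl)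

theorem envMap_difference (f : A →ₐ[K] B) (a : A) :
    envMap f (difference K a) = difference K (f a) := by
  rw [difference, map_sub, envMap_left, envMap_right, difference]

theorem envMap_envSwap (f : A →ₐ[K] B) (z : Env K A) :
    envMap f (envSwap K A z) = envSwap K B (envMap f z) :=
  DFunLike.congr_fun (f := (envMap f).comp (envSwap K A)) (g := (envSwap K B).comp (envMap f))
    (env_algHom_ext (by simp [envSwap_left]) (by simp [envSwap_right])) z

variable (K A) in
/-- The multiplication of `A`, as a homomorphism from the enveloping algebra. -/
def envMul : Env K A →ₐ[K] A := Algebra.TensorProduct.lmul' K (S := A)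

@[simp] theorem envMul_left (a : A) : envMul K A (left K A a) = a := by
  change Algebra.TensorProduct.lmul' K (a ⊗ₜ[K] (1 : A)) = a
  simp

@[simp] theorem envMul_right (a : A) : envMul K A (right K A a) = a := by
  change Algebra.TensorProduct.lmul' K ((1 : A) ⊗ₜ[K] a) = a
  simp

theorem envMul_difference (a : A) : envMul K A (difference K a) = 0 := by
  rw [difference, map_sub, envMul_left, envMul_right, sub_self]

theorem envMul_envSwap (z : Env K A) : envMul K A (envSwap K A z) = envMul K A z :=
  DFunLike.congr_fun (f := (envMul K A).comp (envSwap K A)) (g := envMul K A)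
    (env_algHom_ext (by simp [envSwap_left]) (by simp [envSwap_right])) z

theorem envMul_envMap (f : A →ₐ[K] B) (z : Env K A) :
    envMul K B (envMap f z) = f (envMul K A z) :=
  DFunLike.congr_fun (f := (envMul K B).comp (envMap f)) (g := f.comp (envMul K A))
    (env_algHom_ext (by simp) (by simp)) z

/-- The derivation `a ⊗ b ↦ δ a * b` along the multiplication. -/
def envDerivation (δ : Derivation K A A) : Env K A →ₗ[K] A :=
  (LinearMap.mul' K A) ∘ₗ (LinearMap.rTensor A (δ : A →ₗ[K] A))

theorem envDerivation_left_mul_right (δ : Derivation K A A) (a b : A) :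
    envDerivation δ (left K A a * right K A b) = δ a * b := by
  rw [left_mul_right]
  rfl

theorem envDerivation_difference (δ : Derivation K A A) (a : A) :
    envDerivation δ (difference K a) = δ a := by
  have h_left := envDerivation_left_mul_right δ a 1
  have h_right := envDerivation_left_mul_right δ 1 a
  rw [map_one, mul_one, mul_one] at h_left
  rw [map_one, one_mul, Derivation.map_one_eq_zero, zero_mul] at h_right
  rw [difference, map_sub, h_left, h_right, sub_zero]

theorem env_induction {p : Env K A → Prop} (zero : p 0)
    (left_mul_right : ∀ a b, p (left K A a * right K A b))
    (add : ∀ z w, p z → p w → p (z + w)) (z : Env K A) : p z :=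
  TensorProduct.induction_on (motive := p) z zero
    (fun a b => WordCochain.left_mul_right (K := K) a b ▸ left_mul_right a b) add

theorem envDerivation_mul (δ : Derivation K A A) (z w : Env K A) : envDerivation δ (z * w) =
    envMul K A z * envDerivation δ w + envMul K A w * envDerivation δ z := by
  induction z using env_induction with
  | zero => simp
  | add z z' hz hz' =>
    rw [add_mul, map_add, map_add, map_add, hz, hz']
    ring
  | left_mul_right a b =>
    induction w using env_induction with
    | zero => simp
    | add w w' hw hw' =>
      rw [mul_add, map_add, map_add, map_add, hw, hw']
      ring
    | left_mul_right c d =>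
      rw [mul_mul_mul_comm, ← map_mul, ← map_mul]
      simp only [envDerivation_left_mul_right, Derivation.leibniz, smul_eq_mul,
        map_mul (envMul K A), envMul_left, envMul_right]
      ring

theorem exists_presented_eq (z : Env K A) : ∃ T : Finset (A × A), presented K T = z := by
  obtain ⟨T, hT⟩ := TensorProduct.exists_finset (R := K) (M := A) (N := A) z
  exact ⟨T, (Finset.sum_congr rfl fun p _ => left_mul_right p.1 p.2).trans hT.symm⟩

/-- The homomorphism `a ⊗ a' ↦ f a ⊗ a'`. -/
def envLeft (f : A →ₐ[K] B) : Env K A →ₐ[K] B ⊗[K] A :=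
  Algebra.TensorProduct.map f (AlgHom.id K A)

theorem envLeft_left (f : A →ₐ[K] B) (a : A) : envLeft f (left K A a) = f a ⊗ₜ 1 :=
  Algebra.TensorProduct.map_tmul f (AlgHom.id K A) a 1

theorem envLeft_right (f : A →ₐ[K] B) (a : A) : envLeft f (right K A a) = 1 ⊗ₜ a :=
  (Algebra.TensorProduct.map_tmul f (AlgHom.id K A) 1 a).trans (by rw [map_one]; rfl)

theorem envLeft_difference (f : A →ₐ[K] B) (a : A) :
    envLeft f (difference K a) = f a ⊗ₜ 1 - 1 ⊗ₜ a := by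
  rw [difference, map_sub, envLeft_left, envLeft_right]

/-- The homomorphism `b ⊗ a ↦ b ⊗ f a`. -/
def envRight (f : A →ₐ[K] B) : B ⊗[K] A →ₐ[K] Env K B :=
  Algebra.TensorProduct.map (AlgHom.id K B) f

theorem envRight_envLeft (f : A →ₐ[K] B) (z : Env K A) :
    envRight f (envLeft f z) = envMap f z := by
  refine DFunLike.congr_fun (f := (envRight f).comp (envLeft f)) (g := envMap f)
    (env_algHom_ext (fun a => ?_) fun a => ?_) z
  · rw [AlgHom.comp_apply, envLeft_left, envMap_left]
    exact (Algebra.TensorProduct.map_tmul (AlgHom.id K B) f _ 1).trans (by rw [map_one]; rfl)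
  · rw [AlgHom.comp_apply, envLeft_right, envMap_right]
    exact Algebra.TensorProduct.map_tmul (AlgHom.id K B) f 1 a

theorem envRight_surjective {f : A →ₐ[K] B} (hf : Function.Surjective f) :
    Function.Surjective (envRight f) :=
  LinearMap.lTensor_surjective B (g := f.toLinearMap) hf

theorem ker_envRight {f : A →ₐ[K] B} (hf : Function.Surjective f) {R : A}
    (h_ker : RingHom.ker f = Ideal.span {R}) :
    RingHom.ker (envRight f) = Ideal.span {((1 : B) ⊗ₜ[K] R : B ⊗[K] A)} := by
  have h := Algebra.TensorProduct.lTensor_ker (A := B) f hf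
  rw [h_ker, Ideal.map_span, Set.image_singleton] at h
  exact h

end Functoriality

section Symmetrize

variable {K A B : Type*} [Field K] [CommRing A] [Algebra K A] [CommRing B] [Algebra K B]

/-- The symmetrization in the enveloping algebra. -/
def symmetrize (z : Env K A) : Env K A := algebraMap K _ (1 / 2) * (z + envSwap K A z)

theorem envMap_symmetrize (f : A →ₐ[K] B) (z : Env K A) :
    envMap f (symmetrize z) = symmetrize (envMap f z) := by
  rw [symmetrize, map_mul, map_add, envMap_envSwap, AlgHom.commutes, symmetrize]

theorem symmetrize_presented (T : Finset (A × A)) : symmetrize (presented K T) =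
    algebraMap K _ (1 / 2) * (presented K T + presentedSwap K T) := by
  rw [symmetrize, envSwap_presented]

variable [CharZero K]

theorem algebraMap_half_mul_two (S : Type*) [CommRing S] [Algebra K S] :
    algebraMap K S (1 / 2) * 2 = 1 := by
  rw [← map_ofNat (algebraMap K S) 2, ← map_mul, one_div_mul_cancel two_ne_zero, map_one]

theorem envMul_symmetrize (z : Env K A) : envMul K A (symmetrize z) = envMul K A z := by
  rw [symmetrize, map_mul, map_add, envMul_envSwap, AlgHom.commutes, ← two_mul, ← mul_assoc,
    algebraMap_half_mul_two, one_mul]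

theorem difference_eq_symmetrize {a x y : A} {t u : Env K A}
    (h : difference K a = t * difference K x + u * difference K y) :
    difference K a = symmetrize t * difference K x + symmetrize u * difference K y := by
  have h_swap := congr_arg (envSwap K A) h
  rw [map_add, map_mul, map_mul, envSwap_difference, envSwap_difference, envSwap_difference]
    at h_swap
  rw [symmetrize, symmetrize]
  linear_combination (-difference K a) * algebraMap_half_mul_two (K := K) (Env K A) +
    algebraMap K (Env K A) (1 / 2) * (h - h_swap)

end Symmetrize

section PlaneCurve

open MvPolynomial

theorem exists_difference_eq {K : Type*} [CommRing K] (f : MvPolynomial (Fin 2) K) :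
    ∃ t u : Env K (MvPolynomial (Fin 2) K),
      difference K f = t * difference K (X 0) + u * difference K (X 1) := by
  let I : Ideal (Env K (MvPolynomial (Fin 2) K)) :=
    Ideal.span {difference K (X 0), difference K (X 1)}
  have h_eq : (Ideal.Quotient.mkₐ K I).comp (left K _) =
      (Ideal.Quotient.mkₐ K I).comp (right K _) := by
    refine MvPolynomial.algHom_ext fun i => Ideal.Quotient.eq.2 (Ideal.subset_span ?_)
    fin_cases i
    exacts [Or.inl rfl, Or.inr rfl]
  have h_mem : difference K f ∈ I := Ideal.Quotient.eq.1 (DFunLike.congr_fun h_eq f)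
  obtain ⟨t, u, h⟩ := Ideal.mem_span_pair.1 h_mem
  exact ⟨t, u, h.symm⟩

theorem envMul_eq_pderiv {K : Type*} [CommRing K] {R : MvPolynomial (Fin 2) K}
    {t u : Env K (MvPolynomial (Fin 2) K)}
    (h : difference K R = t * difference K (X 0) + u * difference K (X 1)) :
    envMul K _ t = pderiv 0 R ∧ envMul K _ u = pderiv 1 R := by
  have h_pderiv : ∀ i : Fin 2, pderiv i R = envMul K _ t * pderiv i (X 0) +
      envMul K _ u * pderiv i (X 1 : MvPolynomial (Fin 2) K) := fun i => by
    have h_i := congr_arg (envDerivation (pderiv i)) h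
    simpa only [map_add, envDerivation_mul, envMul_difference, envDerivation_difference,
      zero_mul, add_zero] using h_i
  exact ⟨by simp [h_pderiv 0], by simp [h_pderiv 1]⟩

variable {K A : Type*} [Field K] [CommRing A] [Algebra K A]
  {f : MvPolynomial (Fin 2) K →ₐ[K] A} {R : MvPolynomial (Fin 2) K}
  {t u : Env K (MvPolynomial (Fin 2) K)}

/-- The two differences form a regular sequence in `A ⊗ K[x, y]`, and the enveloping algebra is the
quotient by the nonzerodivisor `1 ⊗ R`, which `h` expresses through them. -/
theorem DifferenceRelation.isResolution_of_difference_eq (D : DifferenceRelation K A)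
    (hf : Function.Surjective f) (h_ker : RingHom.ker f = Ideal.span {R}) (hR : R ≠ 0)
    (h : difference K R = t * difference K (X 0) + u * difference K (X 1))
    (hx : D.x = f (X 0)) (hy : D.y = f (X 1))
    (hT : D.symT = envMap f t) (hU : D.symU = envMap f u) : D.IsResolution := by
  have h_zero : f R = 0 := h_ker.ge (Ideal.mem_span_singleton_self R)
  have h_factor : envLeft f t * envLeft f (difference K (X 0)) +
      envLeft f u * envLeft f (difference K (X 1)) = -((1 : A) ⊗ₜ[K] R) := by
    rw [← map_mul, ← map_mul, ← map_add, ← h, envLeft_difference, h_zero, zero_tmul, zero_sub]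
  have h_koszul : KoszulExact (envLeft f (difference K (X 0)))
      (envLeft f (difference K (X 1))) := by
    simpa only [envLeft_difference] using koszulExact_tensor fun i => f (X i)
  have h_span : RingHom.ker (envRight f : A ⊗[K] MvPolynomial (Fin 2) K →+* Env K A) =
      Ideal.span {envLeft f t * envLeft f (difference K (X 0)) +
        envLeft f u * envLeft f (difference K (X 1))} := by
    rw [h_factor, Ideal.span_singleton_neg]
    exact ker_envRight hf h_ker
  have h_dx : D.dx = envRight f (envLeft f (difference K (X 0))) := by
    rw [envRight_envLeft, envMap_difference, ← hx]
  have h_dy : D.dy = envRight f (envLeft f (difference K (X 1))) := by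
    rw [envRight_envLeft, envMap_difference, ← hy]
  refine ⟨fun a => ?_, ?_, ?_⟩
  · obtain ⟨g, rfl⟩ := hf a
    obtain ⟨p, q, hpq⟩ := exists_difference_eq g
    refine ⟨envMap f p, envMap f q, ?_⟩
    rw [← envMap_difference, hpq, map_add, map_mul, map_mul, envMap_difference, envMap_difference,
      ← hx, ← hy]
  · rw [h_dx, h_dy, hT, hU, ← envRight_envLeft, ← envRight_envLeft]
    exact h_koszul.exists_of_factorization (envRight_surjective hf) h_span
  · rw [h_dx, h_dy, hT, hU, ← envRight_envLeft, ← envRight_envLeft]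
    refine exists_of_factorization (envRight_surjective hf) h_span fun b hb => ?_
    rw [h_factor, neg_mul, neg_eq_zero] at hb
    exact eq_zero_of_one_tmul_mul hR hb

theorem exists_isResolution [CharZero K] (hf : Function.Surjective f)
    (h_ker : RingHom.ker f = Ideal.span {R}) (hR : R ≠ 0) :
    ∃ D : DifferenceRelation K A, D.IsResolution ∧
      envMul K A D.symT = f (pderiv 0 R) ∧ envMul K A D.symU = f (pderiv 1 R) := by
  obtain ⟨t, u, h⟩ := exists_difference_eq R
  obtain ⟨T, hT⟩ := exists_presented_eq (envMap f t)
  obtain ⟨U, hU⟩ := exists_presented_eq (envMap f u)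
  have h_rel : presented K T * difference K (f (X 0)) +
      presented K U * difference K (f (X 1)) = 0 := by
    have h_zero : f R = 0 := h_ker.ge (Ideal.mem_span_singleton_self R)
    rw [hT, hU, ← envMap_difference, ← envMap_difference, ← map_mul, ← map_mul, ← map_add, ← h,
      envMap_difference, h_zero, difference, map_zero, map_zero, sub_zero]
  have h_symT : algebraMap K _ (1 / 2) * (presented K T + presentedSwap K T) =
      envMap f (symmetrize t) := by
    rw [← symmetrize_presented, hT, envMap_symmetrize]
  have h_symU : algebraMap K _ (1 / 2) * (presented K U + presentedSwap K U) =
      envMap f (symmetrize u) := by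
    rw [← symmetrize_presented, hU, envMap_symmetrize]
  let D : DifferenceRelation K A := ⟨f (X 0), f (X 1), T, U, h_rel⟩
  refine ⟨D, D.isResolution_of_difference_eq hf h_ker hR (difference_eq_symmetrize h) rfl rfl
    h_symT h_symU, ?_, ?_⟩
  · rw [show D.symT = envMap f (symmetrize t) from h_symT, envMul_envMap, envMul_symmetrize,
      (envMul_eq_pderiv h).1]
  · rw [show D.symU = envMap f (symmetrize u) from h_symU, envMul_envMap, envMul_symmetrize,
      (envMul_eq_pderiv h).2]

end PlaneCurve

end WordCochain

/-! ### Sorting permutations and the Hodge idempotents -/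

namespace Hochschild

open Finset Equiv.Perm

section Count

variable {n : ℕ}

/-- The number of maps `Fin n → Fin m` that are sorted by `σ`. -/
def sortCount (m : ℕ) (σ : Equiv.Perm (Fin n)) : ℕ := #{f : Fin n → Fin m | Tuple.sort f = σ}

theorem sum_comp_sort {V : Type*} [AddCommMonoid V] (m : ℕ) (F : Equiv.Perm (Fin n) → V) :
    ∑ f : Fin n → Fin m, F (Tuple.sort f) = ∑ σ, sortCount m σ • F σ := by
  rw [← sum_fiberwise univ (Tuple.sort (α := Fin m))]
  refine sum_congr rfl fun σ _ => ?_
  rw [sortCount, ← sum_const]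
  exact sum_congr rfl fun f hf => by rw [(mem_filter.1 hf).2]

/-- The number of ascents of `σ` in positions smaller than `i`. -/
def ascentsBelow (σ : Equiv.Perm (Fin (n + 1))) (i : Fin (n + 1)) : ℕ :=
  #{j : Fin n | j.castSucc < i ∧ σ j.castSucc < σ j.succ}

variable (σ : Equiv.Perm (Fin (n + 1)))

theorem ascentsBelow_zero : ascentsBelow σ 0 = 0 := by
  simp [ascentsBelow]

theorem ascentsBelow_succ (j : Fin n) : ascentsBelow σ j.succ =
    ascentsBelow σ j.castSucc + if σ j.castSucc < σ j.succ then 1 else 0 := by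
  simp only [ascentsBelow, Fin.castSucc_lt_succ_iff, Fin.castSucc_lt_castSucc_iff, card_filter]
  rw [← Fintype.sum_ite_eq' j fun k => if σ k.castSucc < σ k.succ then 1 else 0,
    ← sum_add_distrib]
  refine sum_congr rfl fun k _ => ?_
  grind

theorem ascentsBelow_mono : Monotone (ascentsBelow σ) :=
  Fin.monotone_iff_le_succ.2 fun j => (ascentsBelow_succ σ j).symm ▸ Nat.le_add_right _ _

theorem ascentsBelow_last_add_descents : ascentsBelow σ (Fin.last n) + descents σ = n := by
  have h_descents : descents σ = #{j : Fin n | ¬ σ j.castSucc < σ j.succ} := by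
    rw [descents, ← Fintype.card_subtype, ← Nat.card_eq_fintype_card]
    symm
    refine Nat.card_congr (Equiv.ofBijective (fun j => ⟨j.1.castSucc, by simp, ?_⟩)
      ⟨fun j k h => ?_, fun i => ?_⟩)
    · exact (not_lt.1 j.2).lt_of_ne (σ.injective.ne Fin.castSucc_lt_succ.ne')
    · ext
      simpa [Fin.ext_iff] using h
    · obtain ⟨i, hi, h⟩ := i
      exact ⟨⟨⟨i, by omega⟩, not_lt.2 h.le⟩, rfl⟩
  have h_ascents : ascentsBelow σ (Fin.last n) = #{j : Fin n | σ j.castSucc < σ j.succ} := by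
    simp [ascentsBelow, Fin.castSucc_lt_last]
  rw [h_descents, h_ascents, card_filter_add_card_filter_not, card_univ, Fintype.card_fin]

theorem sort_eq_iff {m : ℕ} (f : Fin (n + 1) → Fin m) :
    Tuple.sort f = σ ↔ StrictMono fun i => (f (σ i) : ℕ) + ascentsBelow σ i := by
  rw [eq_comm, Tuple.eq_sort_iff', Fin.strictMono_iff_lt_succ, Fin.strictMono_iff_lt_succ]
  refine forall_congr' fun j => ?_
  rw [ascentsBelow_succ]
  change toLex (f (σ j.castSucc), σ j.castSucc) < toLex (f (σ j.succ), σ j.succ) ↔ _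
  rw [Prod.Lex.toLex_lt_toLex, Fin.lt_def, Fin.ext_iff]
  split_ifs with h <;> simp only [h, and_true, and_false, or_false] <;> omega

section OrderEmbedding

variable {N : ℕ} (h : Fin (n + 1) ↪o Fin N)

theorem monotone_sub_ascentsBelow : Monotone fun i => (h i : ℤ) - ascentsBelow σ i := by
  refine Fin.monotone_iff_le_succ.2 fun j => ?_
  have h_lt : (h j.castSucc : ℕ) < h j.succ := h.strictMono Fin.castSucc_lt_succ
  have h_succ := ascentsBelow_succ σ j
  split_ifs at h_succ <;> omega

theorem ascentsBelow_le (i : Fin (n + 1)) : ascentsBelow σ i ≤ h i := by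
  have h_zero := monotone_sub_ascentsBelow σ h (Fin.zero_le i)
  simp only [ascentsBelow_zero] at h_zero
  omega

theorem lt_add_ascentsBelow {m : ℕ}
    (h : Fin (n + 1) ↪o Fin (m + ascentsBelow σ (Fin.last n))) (i : Fin (n + 1)) :
    (h i : ℕ) < m + ascentsBelow σ i := by
  have h_last := monotone_sub_ascentsBelow σ h (Fin.le_last i)
  simp only at h_last
  omega

end OrderEmbedding

/-- Adding the number of ascents makes the increasing rearrangement of `f` strictly increasing. -/
def sortEquiv (m : ℕ) : {f : Fin (n + 1) → Fin m // Tuple.sort f = σ} ≃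
    (Fin (n + 1) ↪o Fin (m + ascentsBelow σ (Fin.last n))) where
  toFun f := OrderEmbedding.ofStrictMono
    (fun i => ⟨(f.1 (σ i) : ℕ) + ascentsBelow σ i,
      add_lt_add_of_lt_of_le (f.1 (σ i)).2 (ascentsBelow_mono σ (Fin.le_last i))⟩)
    ((sort_eq_iff σ f.1).1 f.2)
  invFun h := ⟨fun x => ⟨h (σ.symm x) - ascentsBelow σ (σ.symm x), by
      have h_lt := lt_add_ascentsBelow σ h (σ.symm x)
      have h_le := ascentsBelow_le σ h (σ.symm x)
      omega⟩, by
    rw [sort_eq_iff]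
    intro i j hij
    simpa [Nat.sub_add_cancel (ascentsBelow_le σ h _)] using hij⟩
  left_inv f := by
    ext x
    change (f.1 (σ (σ.symm x)) : ℕ) + ascentsBelow σ (σ.symm x) - ascentsBelow σ (σ.symm x) = _
    rw [Nat.add_sub_cancel, Equiv.apply_symm_apply]
  right_inv h := by
    ext i
    simp [Nat.sub_add_cancel (ascentsBelow_le σ h i)]

theorem sortCount_eq_choose (m : ℕ) :
    sortCount m σ = (m + ascentsBelow σ (Fin.last n)).choose (n + 1) := by
  rw [sortCount, ← Fintype.card_subtype, ← Nat.card_eq_fintype_card,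
    Nat.card_congr ((sortEquiv σ m).trans Set.powersetCard.ofFinEmbEquiv), Set.powersetCard.card,
    Nat.card_fin]

end Count

section Garsia

variable {n : ℕ}

open Polynomial in
/-- The coefficient of `σ` in the generating function of the idempotents `e_n(k)`, up to the sign
of `σ`. -/
def garsiaPolynomial (σ : Equiv.Perm (Fin n)) : ℂ[X] :=
  C (n.factorial : ℂ)⁻¹ * ∏ i ∈ range n, (X - C (descents σ : ℂ) + C (i : ℂ))

theorem idempotentCoeff_eq (k : ℕ) (σ : Equiv.Perm (Fin n)) :
    idempotentCoeff n k σ = ((sign σ : ℤ) : ℂ) * (garsiaPolynomial σ).coeff k := by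
  rw [idempotentCoeff, garsiaPolynomial, Polynomial.coeff_C_mul]
  ring

theorem garsiaPolynomial_eval (σ : Equiv.Perm (Fin n)) (m : ℕ) :
    (garsiaPolynomial σ).eval (m : ℂ) = sortCount m σ := by
  cases n with
  | zero => simp [garsiaPolynomial, sortCount, Subsingleton.elim _ σ]
  | succ n =>
    have h_descents : (ascentsBelow σ (Fin.last n) : ℂ) + descents σ = n :=
      mod_cast ascentsBelow_last_add_descents σ
    rw [sortCount_eq_choose, garsiaPolynomial, Polynomial.eval_mul, Polynomial.eval_C,
      inv_mul_eq_iff_eq_mul₀ (Nat.cast_ne_zero.2 (Nat.factorial_ne_zero _)), ← Nat.cast_mul,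
      ← Nat.descFactorial_eq_factorial_mul_choose, ← descPochhammer_eval_eq_descFactorial,
      descPochhammer_eval_eq_prod_range, ← prod_range_reflect, Polynomial.eval_prod]
    refine prod_congr rfl fun i hi => ?_
    simp only [Polynomial.eval_add, Polynomial.eval_sub, Polynomial.eval_X, Polynomial.eval_C]
    rw [Nat.add_sub_cancel, Nat.cast_sub (Nat.le_of_lt_succ (mem_range.1 hi))]
    push_cast
    linear_combination -h_descents

theorem natDegree_garsiaPolynomial_le (σ : Equiv.Perm (Fin n)) :
    (garsiaPolynomial σ).natDegree ≤ n := by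
  refine (Polynomial.natDegree_C_mul_le _ _).trans ((Polynomial.natDegree_prod_le _ _).trans ?_)
  refine (sum_le_sum fun i _ => (?_ : _ ≤ 1)).trans (by simp)
  rw [sub_add, ← map_sub]
  exact Polynomial.natDegree_X_sub_C_le _

theorem sortCount_one (σ : Equiv.Perm (Fin n)) : sortCount 1 σ = if σ = 1 then 1 else 0 := by
  have h_sort : ∀ f : Fin n → Fin 1, Tuple.sort f = 1 := fun f =>
    Tuple.sort_eq_refl_iff_monotone.2 fun i j _ => (Subsingleton.elim (f i) (f j)).le
  simp only [sortCount, h_sort, eq_comm (a := (1 : Equiv.Perm (Fin n)))]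
  split_ifs with h <;> simp [h]

theorem sum_coeff_garsiaPolynomial {N : ℕ} (hN : n < N) (σ : Equiv.Perm (Fin n)) :
    ∑ k ∈ range N, (garsiaPolynomial σ).coeff k = if σ = 1 then 1 else 0 := by
  have h_eval := garsiaPolynomial_eval σ 1
  rw [Polynomial.eval_eq_sum_range' ((natDegree_garsiaPolynomial_le σ).trans_lt hN),
    sortCount_one] at h_eval
  simpa using h_eval

theorem sort_lex {a b : ℕ} (g : Fin n → Fin a) (f : Fin n → Fin b) :
    Tuple.sort (fun x => finProdFinEquiv (g ((Tuple.sort f).symm x), f x)) =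
      Tuple.sort f * Tuple.sort g := by
  have hf := Tuple.eq_sort_iff.1 (rfl : Tuple.sort f = Tuple.sort f)
  have hg := Tuple.eq_sort_iff.1 (rfl : Tuple.sort g = Tuple.sort g)
  refine (Tuple.eq_sort_iff.2 ⟨fun i j hij => ?_, fun i j hij h => ?_⟩).symm
  · rw [Fin.le_def]
    simp only [Function.comp_apply, finProdFinEquiv_apply_val, Equiv.Perm.mul_apply,
      Equiv.symm_apply_apply]
    rcases hij.eq_or_lt with rfl | hij
    · exact le_rfl
    have h_le : g (Tuple.sort g i) ≤ g (Tuple.sort g j) := hg.1 hij.le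
    rcases h_le.eq_or_lt with hgij | hgij
    · rw [hgij]
      exact Nat.add_le_add_right (Fin.le_def.1 (hf.1 (hg.2 i j hij hgij).le)) _
    · have h_mul := Nat.mul_le_mul_left b (Nat.succ_le_of_lt (Fin.lt_def.1 hgij))
      have h_lt := (f (Tuple.sort f (Tuple.sort g i))).2
      rw [Nat.mul_succ] at h_mul
      omega
  · have h_eq := finProdFinEquiv.injective h
    simp only [Equiv.Perm.mul_apply, Equiv.symm_apply_apply, Prod.mk.injEq] at h_eq
    exact hf.2 _ _ (hg.2 i j hij h_eq.1) h_eq.2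

theorem sum_sortCount_mul (a b : ℕ) (σ : Equiv.Perm (Fin n)) :
    ∑ τ : Equiv.Perm (Fin n), sortCount a τ * sortCount b (σ * τ⁻¹) = sortCount (a * b) σ := by
  have h_reindex : ∀ f : Fin n → Fin b,
      ∑ g : Fin n → Fin a, (if Tuple.sort (fun x => finProdFinEquiv (g x, f x)) = σ then 1 else 0) =
        ∑ g : Fin n → Fin a, if Tuple.sort f * Tuple.sort g = σ then 1 else 0 := fun f => by
    rw [← Equiv.sum_comp ((Tuple.sort f).arrowCongr (.refl (Fin a)))]
    exact sum_congr rfl fun g _ => by rw [← sort_lex]; rfl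
  calc ∑ τ : Equiv.Perm (Fin n), sortCount a τ * sortCount b (σ * τ⁻¹)
      = ∑ g : Fin n → Fin a, sortCount b (σ * (Tuple.sort g)⁻¹) :=
        (sum_comp_sort a fun τ => sortCount b (σ * τ⁻¹)).symm
    _ = ∑ f : Fin n → Fin b, ∑ g : Fin n → Fin a,
          if Tuple.sort f * Tuple.sort g = σ then 1 else 0 := by
        simp only [sortCount, card_filter, eq_mul_inv_iff_mul_eq]
        exact sum_comm
    _ = ∑ f : Fin n → Fin b, ∑ g : Fin n → Fin a,
          if Tuple.sort (fun x => finProdFinEquiv (g x, f x)) = σ then 1 else 0 :=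
        sum_congr rfl fun f _ => (h_reindex f).symm
    _ = ∑ h : Fin n → Fin (a * b), if Tuple.sort h = σ then 1 else 0 := by
        rw [sum_comm, ← Fintype.sum_prod_type']
        exact Equiv.sum_comp ((Equiv.arrowProdEquivProdArrow (Fin n) (fun _ => Fin a)
          fun _ => Fin b).symm.trans ((Equiv.refl (Fin n)).arrowCongr finProdFinEquiv))
          fun h : Fin n → Fin (a * b) => if Tuple.sort h = σ then 1 else 0
    _ = sortCount (a * b) σ := (card_filter _ _).symm

theorem sum_sortCount_mul_coeff (a k : ℕ) (σ : Equiv.Perm (Fin n)) :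
    ∑ τ : Equiv.Perm (Fin n), (sortCount a τ : ℂ) * (garsiaPolynomial (σ * τ⁻¹)).coeff k =
      (a : ℂ) ^ k * (garsiaPolynomial σ).coeff k := by
  have h_comp : ∑ τ : Equiv.Perm (Fin n),
      Polynomial.C (sortCount a τ : ℂ) * garsiaPolynomial (σ * τ⁻¹) =
        (garsiaPolynomial σ).comp (Polynomial.C (a : ℂ) * Polynomial.X) := by
    refine Polynomial.eq_of_infinite_eval_eq _ _
      ((Set.infinite_range_of_injective (Nat.cast_injective (R := ℂ))).mono ?_)
    rintro _ ⟨m, rfl⟩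
    simp only [Set.mem_ofPred_eq, Polynomial.eval_finsetSum, Polynomial.eval_mul, Polynomial.eval_C,
      Polynomial.eval_comp, Polynomial.eval_X, garsiaPolynomial_eval]
    rw [← Nat.cast_mul, garsiaPolynomial_eval, ← sum_sortCount_mul]
    push_cast
    rfl
  have h_coeff := congr_arg (fun p => Polynomial.coeff p k) h_comp
  simp only [Polynomial.finsetSum_coeff, Polynomial.coeff_C_mul,
    Polynomial.comp_C_mul_X_coeff] at h_coeff
  rw [h_coeff, mul_comm]

end Garsia

section AdamsOperation

variable {A : Type*} [CommRing A] [Algebra ℂ A] {n k : ℕ}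

variable (A n) in
/-- The second Adams operation on Hochschild cochains. -/
def adamsOperation : Cochain A n →ₗ[ℂ] Cochain A n :=
  ∑ σ : Equiv.Perm (Fin n), ((sortCount 2 σ : ℂ) * ((sign σ : ℤ) : ℂ)) •
    (MultilinearMap.domDomCongrLinearEquiv ℂ ℂ A A σ⁻¹).toLinearMap

theorem adamsOperation_apply (C : Cochain A n) (a : Fin n → A) :
    adamsOperation A n C a = ∑ σ : Equiv.Perm (Fin n),
      ((sortCount 2 σ : ℂ) * ((sign σ : ℤ) : ℂ)) • C (fun i => a (σ⁻¹ i)) := by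
  simp [adamsOperation]

theorem adamsOperation_apply_eq_sum_sort (C : Cochain A n) (a : Fin n → A) :
    adamsOperation A n C a = ∑ f : Fin n → Fin 2,
      ((sign (Tuple.sort f) : ℤ) : ℂ) • C (fun i => a ((Tuple.sort f)⁻¹ i)) := by
  rw [adamsOperation_apply,
    sum_comp_sort 2 fun σ => ((sign σ : ℤ) : ℂ) • C (fun i => a (σ⁻¹ i))]
  simp only [mul_smul, Nat.cast_smul_eq_nsmul]

theorem sum_sortCount_mul_idempotentCoeff (σ : Equiv.Perm (Fin n)) :
    ∑ τ : Equiv.Perm (Fin n), ((sortCount 2 τ : ℂ) * ((sign τ : ℤ) : ℂ)) *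
      idempotentCoeff n k (σ * τ⁻¹) = (2 : ℂ) ^ k * idempotentCoeff n k σ := by
  have h_sign : ∀ τ : Equiv.Perm (Fin n),
      ((sign τ : ℤ) : ℂ) * ((sign (σ * τ⁻¹) : ℤ) : ℂ) = ((sign σ : ℤ) : ℂ) := fun τ => by
    rw [← Int.cast_mul, ← Units.val_mul, ← Equiv.Perm.sign_mul, Equiv.Perm.sign_mul,
      Equiv.Perm.sign_mul, Equiv.Perm.sign_inv, mul_comm, mul_assoc, Int.units_mul_self, mul_one]
  have h_sum := sum_sortCount_mul_coeff 2 k σ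
  rw [Nat.cast_ofNat] at h_sum
  rw [idempotentCoeff_eq, mul_left_comm, ← h_sum, mul_sum]
  refine sum_congr rfl fun τ _ => ?_
  rw [idempotentCoeff_eq]
  linear_combination (sortCount 2 τ : ℂ) * (garsiaPolynomial (σ * τ⁻¹)).coeff k * h_sign τ

theorem adamsOperation_hodgeProjector (C : Cochain A n) :
    adamsOperation A n (hodgeProjector A n k C) = (2 : ℂ) ^ k • hodgeProjector A n k C := by
  ext a
  simp only [adamsOperation_apply, _root_.smul_apply, hodgeProjector_apply, smul_sum]
  calc ∑ τ : Equiv.Perm (Fin n), ∑ ρ : Equiv.Perm (Fin n), ((sortCount 2 τ : ℂ) *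
        ((sign τ : ℤ) : ℂ)) • idempotentCoeff n k ρ • C (fun i => a (τ⁻¹ (ρ⁻¹ i)))
      = ∑ τ : Equiv.Perm (Fin n), ∑ σ : Equiv.Perm (Fin n), (((sortCount 2 τ : ℂ) *
          ((sign τ : ℤ) : ℂ)) * idempotentCoeff n k (σ * τ⁻¹)) • C (fun i => a (σ⁻¹ i)) :=
        sum_congr rfl fun τ _ => by
          rw [← Equiv.sum_comp (Equiv.mulRight τ⁻¹)]
          simp [mul_smul]
    _ = ∑ σ : Equiv.Perm (Fin n), (2 : ℂ) ^ k • idempotentCoeff n k σ •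
          C (fun i => a (σ⁻¹ i)) := by
        rw [sum_comm]
        exact sum_congr rfl fun σ _ => by
          rw [← sum_smul, sum_sortCount_mul_idempotentCoeff, mul_smul]

theorem sum_hodgeProjector {N : ℕ} (hN : n < N) (C : Cochain A n) :
    ∑ k ∈ range N, hodgeProjector A n k C = C := by
  ext a
  simp only [_root_.sum_apply, hodgeProjector_apply]
  rw [sum_comm]
  simp only [idempotentCoeff_eq, ← sum_smul, ← mul_sum, sum_coeff_garsiaPolynomial hN]
  rw [sum_eq_single 1 (fun σ _ h => by simp [h]) (by simp), if_pos rfl, inv_one]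
  simp

theorem eq_zero_of_sum_eigenvectors_eq_zero {V : Type*} [AddCommGroup V] [Module ℂ V]
    (T : V →ₗ[ℂ] V) {c : ℕ → V} {s : Finset ℕ} (hc : ∀ k ∈ s, T (c k) = (2 : ℂ) ^ k • c k)
    (h_sum : ∑ k ∈ s, c k = 0) : ∀ k ∈ s, c k = 0 := by
  have h_inj : Function.Injective fun k : ℕ => (2 : ℂ) ^ k := fun i j hij =>
    Nat.pow_right_injective le_rfl (Nat.cast_injective (R := ℂ) (by push_cast; exact hij))
  have h_indep := (Module.End.eigenspaces_iSupIndep (T : Module.End ℂ V)).comp h_inj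
  rw [iSupIndep_iff_finsetSum_eq_zero_imp_eq_zero] at h_indep
  exact h_indep s c (fun k hk => Module.End.mem_eigenspace_iff.2 (hc k hk)) h_sum

theorem hodgeProjector_eq_self {C : Cochain A n} (h : adamsOperation A n C = (2 : ℂ) ^ k • C) :
    hodgeProjector A n k C = C := by
  classical
  have hk : k ∈ range (max n k + 1) := mem_range.2 (by omega)
  refine sub_eq_zero.1 ((eq_zero_of_sum_eigenvectors_eq_zero (adamsOperation A n)
    (c := fun j => hodgeProjector A n j C - if j = k then C else 0) (fun j _ => ?_) ?_ k hk).symm ▸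
      by rw [if_pos rfl])
  · rw [map_sub, smul_sub, adamsOperation_hodgeProjector]
    split_ifs with hj
    · rw [hj, h]
    · rw [map_zero, smul_zero]
  · rw [sum_sub_distrib, sum_hodgeProjector (by omega), sum_ite_eq', if_pos hk, sub_self]

theorem mem_hodgeCochains {C : Cochain A n} :
    C ∈ hodgeCochains A n k ↔ adamsOperation A n C = (2 : ℂ) ^ k • C :=
  ⟨by rintro ⟨D, rfl⟩; exact adamsOperation_hodgeProjector D,
    fun h => ⟨C, hodgeProjector_eq_self h⟩⟩

end AdamsOperation

end Hochschild

/-! ### Hochschild cochains as functions on words -/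

namespace WordCochain

open Finset

section SortShuffle

/-- The permutation that takes the value `0` at `p` and agrees with `σ` elsewhere, up to the order
preserving relabelling of the indices and of the values. -/
def insertZero {n : ℕ} (p : Fin (n + 1)) (σ : Equiv.Perm (Fin n)) : Equiv.Perm (Fin (n + 1)) :=
  Equiv.Perm.decomposeFin.symm (0, σ) * p.cycleRange

theorem insertZero_self {n : ℕ} (p : Fin (n + 1)) (σ : Equiv.Perm (Fin n)) :
    insertZero p σ p = 0 := by
  rw [insertZero, Equiv.Perm.mul_apply, Fin.cycleRange_self,
    Equiv.Perm.decomposeFin_symm_apply_zero]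

theorem insertZero_succAbove {n : ℕ} (p : Fin (n + 1)) (σ : Equiv.Perm (Fin n)) (k : Fin n) :
    insertZero p σ (p.succAbove k) = (σ k).succ := by
  rw [insertZero, Equiv.Perm.mul_apply, Fin.cycleRange_succAbove,
    Equiv.Perm.decomposeFin_symm_apply_succ, Equiv.swap_self, Equiv.refl_apply]

theorem sign_insertZero {n : ℕ} (p : Fin (n + 1)) (σ : Equiv.Perm (Fin n)) :
    Equiv.Perm.sign (insertZero p σ) = (-1) ^ (p : ℕ) * Equiv.Perm.sign σ := by
  rw [insertZero, Equiv.Perm.sign_mul, Fin.sign_cycleRange, Equiv.Perm.decomposeFin.symm_sign,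
    if_pos rfl, one_mul, mul_comm]

theorem sort_cons {n m : ℕ} (c : Fin m) (f : Fin n → Fin m) (p : Fin (n + 1))
    (hp : (p : ℕ) = #{j | f j < c}) :
    Tuple.sort (Fin.cons c f : Fin (n + 1) → Fin m) = insertZero p (Tuple.sort f) := by
  have hf := Tuple.eq_sort_iff.1 (rfl : Tuple.sort f = Tuple.sort f)
  have h_lt_iff : ∀ k : Fin n, (k : ℕ) < p ↔ f (Tuple.sort f k) < c := fun k => by
    rw [hp, card_equiv (Tuple.sort f).symm (t := {j | (f ∘ Tuple.sort f) j < c}) (by simp)]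
    exact Tuple.lt_card_lt_iff_apply_lt_of_monotone hf.1
  refine (Tuple.eq_sort_iff'.2 fun i j hij => ?_).symm
  change toLex ((Fin.cons c f : Fin (n + 1) → Fin m) (insertZero p (Tuple.sort f) i),
    insertZero p (Tuple.sort f) i) < toLex ((Fin.cons c f : Fin (n + 1) → Fin m)
    (insertZero p (Tuple.sort f) j), insertZero p (Tuple.sort f) j)
  rw [Prod.Lex.toLex_lt_toLex]
  rcases Fin.eq_self_or_eq_succAbove p i with hi | ⟨k, rfl⟩ <;>
    rcases Fin.eq_self_or_eq_succAbove p j with hj | ⟨l, rfl⟩ <;>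
    simp only [*, insertZero_self, insertZero_succAbove, Fin.cons_zero, Fin.cons_succ] at hij ⊢
  · exact absurd hij (lt_irrefl _)
  · have h_le : c ≤ f (Tuple.sort f l) := by
      rw [← not_lt, ← h_lt_iff, not_lt]
      exact (Fin.lt_succAbove_iff_le_castSucc _ _).1 hij
    exact h_le.lt_or_eq.imp_right fun h => ⟨h, Fin.succ_pos _⟩
  · exact .inl ((h_lt_iff k).1 ((Fin.succAbove_lt_iff_castSucc_lt _ _).1 hij))
  · have hkl : k < l := Fin.succAbove_lt_succAbove_iff.1 hij
    have h_le : f (Tuple.sort f k) ≤ f (Tuple.sort f l) := hf.1 hkl.le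
    exact h_le.lt_or_eq.imp_right fun h => ⟨h, Fin.succ_lt_succ_iff.2 (hf.2 _ _ hkl h)⟩

variable {A M S : Type*} [CommRing S] [AddCommGroup M] [Module S M] {n : ℕ}

theorem sumSplits_eq_sum (G : List A → List A → M) (t : List A) :
    sumSplits M S G t = ∑ z ∈ range (t.length + 1), G (t.take z) (t.drop z) := by
  induction t generalizing G with
  | nil => simp
  | cons a t ih =>
    rw [sumSplits_cons, ih, List.length_cons, sum_range_succ' _ (t.length + 1), add_comm]
    rfl

variable (S) in
/-- The summand of the shuffle product in which the letter in position `i` comes from the factor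
with the number `f i`. -/
def sortTerm (F : List A → M) (a : Fin n → A) (f : Fin n → Fin 2) : M :=
  ((Equiv.Perm.sign (Tuple.sort f) : ℤ) : S) •
    F (List.ofFn fun i => a ((Tuple.sort f)⁻¹ i))

theorem sortTerm_of_monotone (F : List A → M) (a : Fin n → A) {f : Fin n → Fin 2}
    (hf : Monotone f) : sortTerm S F a f = F (List.ofFn a) := by
  rw [sortTerm, Tuple.sort_eq_refl_iff_monotone.2 hf]
  simp

theorem sortTerm_cons (F : List A → M) (a : Fin (n + 1) → A) (c : Fin 2)
    (f : Fin n → Fin 2) (p : Fin (n + 1)) (hp : (p : ℕ) = #{j | f j < c}) :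
    sortTerm S F a (Fin.cons c f : Fin (n + 1) → Fin 2) =
      (-1 : S) ^ (p : ℕ) • sortTerm S (slice M S (a p) F) (fun i => a (p.succAbove i)) f := by
  have h_zero : (insertZero p (Tuple.sort f))⁻¹ 0 = p := by
    rw [Equiv.Perm.inv_eq_iff_eq, insertZero_self]
  have h_succ : ∀ i : Fin n, (insertZero p (Tuple.sort f))⁻¹ i.succ =
      p.succAbove ((Tuple.sort f)⁻¹ i) := fun i => by
    rw [Equiv.Perm.inv_eq_iff_eq, insertZero_succAbove, Equiv.Perm.coe_inv,
      Equiv.apply_symm_apply]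
  rw [sortTerm, sortTerm, sort_cons c f p hp, sign_insertZero, List.ofFn_succ, h_zero, slice_apply,
    smul_smul]
  simp only [h_succ]
  push_cast
  rfl

variable (S) in
/-- The shuffle product of the first `z` letters of a word with the remaining ones, as a sum over
permutations. -/
def sortSum (F : List A → M) (a : Fin n → A) (z : ℕ) : M :=
  ∑ f : Fin n → Fin 2, if #{j | f j < 1} = z then sortTerm S F a f else 0

theorem sortSum_of_forall_eq (F : List A → M) (a : Fin n → A) (z : ℕ) (c : Fin 2)
    (hz : ∀ f : Fin n → Fin 2, #{j | f j < 1} = z ↔ f = fun _ => c) :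
    sortSum S F a z = F (List.ofFn a) := by
  simp only [sortSum, hz, sum_ite_eq', mem_univ, if_true]
  exact sortTerm_of_monotone F a monotone_const

theorem sortSum_zero (F : List A → M) (a : Fin n → A) : sortSum S F a 0 = F (List.ofFn a) := by
  refine sortSum_of_forall_eq F a 0 1 fun f => ?_
  rw [card_eq_zero, filter_eq_empty_iff, funext_iff]
  exact ⟨fun h j => by have := h (mem_univ j); omega, fun h j _ => by have := h j; omega⟩

theorem sortSum_self (F : List A → M) (a : Fin n → A) : sortSum S F a n = F (List.ofFn a) := by
  refine sortSum_of_forall_eq F a n 0 fun f => ?_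
  have h_card : #{j | f j < 1} = n ↔ ∀ j ∈ univ, f j < 1 := by
    rw [← card_filter_eq_iff, card_fin]
  rw [h_card, funext_iff]
  exact ⟨fun h j => by have := h j (mem_univ j); omega, fun h j _ => by have := h j; omega⟩

theorem card_lt_one_cons (f : Fin n → Fin 2) (c : Fin 2) :
    #{j | (Fin.cons c f : Fin (n + 1) → Fin 2) j < 1} =
      #{j | f j < 1} + if c < 1 then 1 else 0 := by
  rw [Fin.card_filter_univ_succ]
  simp only [Fin.cons_zero, Fin.cons_succ]
  split_ifs <;> rfl

theorem sortSum_succ (F : List A → M) (a : Fin (n + 1) → A) {z : ℕ} (hz : z + 1 < n + 1) :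
    sortSum S F a (z + 1) = sortSum S (slice M S (a 0) F) (fun i => a i.succ) z +
      (-1 : S) ^ (z + 1) • sortSum S (slice M S (a ⟨z + 1, hz⟩) F)
        (fun i => a ((⟨z + 1, hz⟩ : Fin (n + 1)).succAbove i)) (z + 1) := by
  simp only [sortSum]
  rw [← Equiv.sum_comp (Fin.consEquiv fun _ => Fin 2), Fintype.sum_prod_type, Fin.sum_univ_two,
    smul_sum]
  refine congr_arg₂ _ (sum_congr rfl fun f _ => ?_) (sum_congr rfl fun f _ => ?_)
  · change (if #{j | (Fin.cons 0 f : Fin (n + 1) → Fin 2) j < 1} = z + 1 then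
      sortTerm S F a (Fin.cons 0 f : Fin (n + 1) → Fin 2) else 0) = _
    rw [card_lt_one_cons, if_pos Fin.zero_lt_one, sortTerm_cons F a 0 f 0 (by simp)]
    simp
  · change (if #{j | (Fin.cons 1 f : Fin (n + 1) → Fin 2) j < 1} = z + 1 then
      sortTerm S F a (Fin.cons 1 f : Fin (n + 1) → Fin 2) else 0) = _
    rw [card_lt_one_cons, if_neg (lt_irrefl _), add_zero, smul_ite, smul_zero]
    split_ifs with h
    · exact sortTerm_cons F a 1 f ⟨z + 1, hz⟩ h.symm
    · rfl

theorem drop_ofFn (a : Fin (n + 1) → A) (p : Fin (n + 1)) :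
    (List.ofFn a).drop p = a p :: (List.ofFn fun i => a (p.succAbove i)).drop p := by
  refine List.ext_getElem ?_ fun i h1 h2 => ?_
  · simp only [List.length_drop, List.length_cons, List.length_ofFn]
    omega
  cases i with
  | zero => simp only [List.getElem_drop, List.getElem_ofFn, List.getElem_cons_zero]; rfl
  | succ i =>
    simp only [List.getElem_drop, List.getElem_ofFn, List.getElem_cons_succ]
    congr 1
    rw [Fin.succAbove_of_le_castSucc _ _ (by simp [Fin.le_def])]
    ext
    simp only [Fin.succ_mk]
    omega

theorem take_ofFn (a : Fin (n + 1) → A) (p : Fin (n + 1)) :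
    (List.ofFn a).take p = (List.ofFn fun i => a (p.succAbove i)).take p := by
  refine List.ext_getElem ?_ fun i h1 h2 => ?_
  · simp only [List.length_take, List.length_ofFn]
    omega
  simp only [List.length_take, List.length_ofFn, lt_inf_iff] at h1
  simp only [List.getElem_take, List.getElem_ofFn]
  congr 1
  rw [Fin.succAbove_of_castSucc_lt _ _ (by simp [Fin.lt_def, h1.1])]
  rfl

theorem shuffle_take_drop {z : ℕ} (hz : z ≤ n) (F : List A → M) (a : Fin n → A) :
    shuffle M S ((List.ofFn a).take z) ((List.ofFn a).drop z) F = sortSum S F a z := by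
  induction n generalizing z F with
  | zero => simp [Nat.le_zero.1 hz, sortSum_zero]
  | succ n ih =>
    cases z with
    | zero => simp [sortSum_zero]
    | succ z =>
      obtain h_eq | h_lt := hz.eq_or_lt
      · rw [h_eq, sortSum_self, List.take_of_length_le (by simp), List.drop_of_length_le (by simp),
          shuffle_nil_right]
      · have h_drop := drop_ofFn a ⟨z + 1, h_lt⟩
        have h_take := take_ofFn a ⟨z + 1, h_lt⟩
        dsimp only at h_drop h_take
        rw [sortSum_succ F a h_lt, ← ih (by omega), ← ih (by omega), ← h_take, h_drop,
          List.ofFn_succ, List.take_succ_cons, shuffle_cons_cons, ← h_drop]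
        simp [min_eq_left (by omega : z ≤ n)]

theorem adams_ofFn (F : List A → M) (a : Fin n → A) :
    adams M S F (List.ofFn a) = ∑ f : Fin n → Fin 2, sortTerm S F a f := by
  rw [adams_eq, sumSplits_eq_sum, List.length_ofFn, sum_congr rfl fun z hz =>
    shuffle_take_drop (Nat.lt_succ_iff.1 (mem_range.1 hz)) F a]
  simp only [sortSum]
  rw [sum_comm]
  refine sum_congr rfl fun f _ => ?_
  have h_card := card_le_univ ({j | f j < 1} : Finset (Fin n))
  rw [Fintype.card_fin] at h_card
  rw [sum_ite_eq, if_pos (mem_range.2 (by omega))]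

end SortShuffle

end WordCochain

namespace Hochschild

open WordCochain

theorem ext_ofFn {A M : Type*} [Zero M] {n : ℕ} {F G : List A → M}
    (hF : ∀ t : List A, t.length ≠ n → F t = 0) (hG : ∀ t : List A, t.length ≠ n → G t = 0)
    (h : ∀ a : Fin n → A, F (List.ofFn a) = G (List.ofFn a)) : F = G := by
  funext t
  by_cases ht : t.length = n
  · subst ht
    rw [← List.ofFn_get t]
    exact h _
  · rw [hF t ht, hG t ht]

theorem ofFn_update {A : Type*} {n : ℕ} (a : Fin n → A) (i : Fin n) (b : A) :
    List.ofFn (Function.update a i b) =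
      (List.ofFn a).take i ++ b :: (List.ofFn a).drop (i + 1) := by
  have h_set : List.ofFn (Function.update a i b) = (List.ofFn a).set i b :=
    List.ext_getElem (by simp) fun j _ _ => by
      simp [List.getElem_set, Function.update_apply, Fin.ext_iff, eq_comm]
  rw [h_set, List.set_eq_take_append_cons_drop, if_pos (by simp)]

theorem contractNth_zero {A : Type*} [Mul A] {n : ℕ} (a : Fin (n + 2) → A) :
    Fin.contractNth (Fin.castSucc 0) (· * ·) a =
      (Fin.cons (a 0 * a 1) (Fin.tail (Fin.tail a)) : Fin (n + 1) → A) := by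
  funext i
  refine Fin.cases ?_ (fun i => ?_) i <;> simp [Fin.contractNth, Fin.tail]

theorem contractNth_succ {A : Type*} [Mul A] {n : ℕ} (a : Fin (n + 2) → A)
    (j : Fin n) :
    Fin.contractNth j.succ.castSucc (· * ·) a =
      (Fin.cons (a 0) (Fin.contractNth j.castSucc (· * ·) (Fin.tail a)) : Fin (n + 1) → A) := by
  funext i
  refine Fin.cases ?_ (fun i => ?_) i <;> simp [Fin.contractNth, Fin.tail]

theorem init_eq_cons {A : Type*} {n : ℕ} (a : Fin (n + 2) → A) :
    Fin.init a = (Fin.cons (a 0) (Fin.init (Fin.tail a)) : Fin (n + 1) → A) := by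
  funext i
  exact Fin.cases rfl (fun _ => rfl) i

section ToWords

variable {A : Type*} [CommRing A] [Algebra ℂ A] {n : ℕ}

/-- The function on words given by a Hochschild cochain; it vanishes on the words of length
different from the degree. -/
def toWords (n : ℕ) : Cochain A n →ₗ[ℂ] (List A → A) where
  toFun C t := if h : t.length = n then C fun i => t.get (Fin.cast h.symm i) else 0
  map_add' C D := by
    funext t
    by_cases h : t.length = n <;> simp [h]
  map_smul' c C := by
    funext t
    by_cases h : t.length = n <;> simp [h]

theorem toWords_of_length_ne (C : Cochain A n) {t : List A} (h : t.length ≠ n) :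
    toWords n C t = 0 :=
  dif_neg h

theorem toWords_ofFn (C : Cochain A n) (a : Fin n → A) : toWords n C (List.ofFn a) = C a := by
  refine (dif_pos List.length_ofFn).trans (congr_arg C ?_)
  funext i
  simp

theorem toWords_cons_ofFn (C : Cochain A (n + 1)) (a : A) (b : Fin n → A) :
    toWords (n + 1) C (a :: List.ofFn b) = C (Fin.cons a b) := by
  rw [← List.ofFn_cons, toWords_ofFn]

theorem toWords_injective (n : ℕ) : Function.Injective (toWords (A := A) n) := fun C D h => by
  ext a
  rw [← toWords_ofFn, h, toWords_ofFn]

theorem toWords_curryLeft (C : Cochain A (n + 1)) (a : A) :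
    (fun t => toWords (n + 1) C (a :: t)) = toWords n (C.curryLeft a) :=
  ext_ofFn (fun t ht => toWords_of_length_ne C (by simpa using ht))
    (fun t ht => toWords_of_length_ne _ ht)
    fun b => by rw [toWords_cons_ofFn, toWords_ofFn]; rfl

theorem isCochain_toWords (C : Cochain A n) : IsCochain ℂ n (toWords n C) where
  eq_zero t ht := toWords_of_length_ne C ht
  isLinearMap u v := by
    induction n generalizing u with
    | zero =>
      simp only [toWords_of_length_ne C (t := u ++ _ :: v) (by simp)]
      exact (0 : A →ₗ[ℂ] A).isLinear
    | succ n ih =>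
      cases u with
      | nil =>
        have h_eq : (fun a => toWords (n + 1) C (a :: v)) = fun a => toWords n (C.curryLeft a) v :=
          funext fun a => congr_fun (toWords_curryLeft C a) v
        change IsLinearMap ℂ fun a => toWords (n + 1) C (a :: v)
        rw [h_eq]
        exact (LinearMap.proj v ∘ₗ toWords n ∘ₗ C.curryLeft).isLinear
      | cons b u =>
        have h_eq : (fun a => toWords (n + 1) C (b :: (u ++ a :: v))) =
            fun a => toWords n (C.curryLeft b) (u ++ a :: v) :=
          funext fun a => congr_fun (toWords_curryLeft C b) _
        exact h_eq ▸ ih (C.curryLeft b) u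

theorem exists_toWords_eq {F : List A → A} (hF : IsCochain ℂ n F) :
    ∃ C : Cochain A n, toWords n C = F := by
  refine ⟨.mk' (fun a => F (List.ofFn a)) (fun a i b c => ?_) (fun a i k b => ?_),
    ext_ofFn (fun t ht => toWords_of_length_ne _ ht) hF.eq_zero fun a => toWords_ofFn _ a⟩
  · simp only [ofFn_update]
    exact (hF.isLinearMap _ _).map_add b c
  · simp only [ofFn_update]
    exact (hF.isLinearMap _ _).map_smul k b

/-- A commutative algebra as a symmetric bimodule over itself. -/
instance envModule : Module (Env ℂ A) A :=
  Module.compHom A (envMul ℂ A : Env ℂ A →+* A)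

theorem env_smul_def (z : Env ℂ A) (a : A) : z • a = envMul ℂ A z * a := rfl

instance envScalarTower : IsScalarTower ℂ (Env ℂ A) A :=
  ⟨fun c z a => by rw [env_smul_def, env_smul_def, map_smul, smul_mul_assoc]⟩

theorem coboundary_succ_apply (C : Cochain A (n + 1)) (a : Fin (n + 2) → A) :
    coboundary A (n + 1) C a = a 0 * C (Fin.tail a) -
      coboundary A n (C.curryLeft (a 0)) (Fin.tail a) +
      (a 1 * C (Fin.cons (a 0) (Fin.tail (Fin.tail a))) -
        C (Fin.cons (a 0 * a 1) (Fin.tail (Fin.tail a)))) := by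
  have h_last : Fin.tail a (Fin.last n) = a (Fin.last (n + 1)) := rfl
  have h_one : Fin.tail a 0 = a 1 := rfl
  rw [coboundary_apply, coboundary_apply, Fin.sum_univ_succ, contractNth_zero, init_eq_cons,
    h_last, h_one]
  simp only [contractNth_succ, MultilinearMap.curryLeft_apply, Fin.val_zero, Fin.val_succ, pow_succ,
    zero_add, pow_zero, mul_neg, mul_one, neg_smul, one_smul, neg_neg, Finset.sum_neg_distrib]
  ring

theorem bimoduleCoboundary_toWords (C : Cochain A n) :
    bimoduleCoboundary ℂ A A (toWords n C) = toWords (n + 1) (coboundary A n C) := by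
  refine ext_ofFn ((isCochain_toWords C).coboundary _ _).eq_zero
    (fun t ht => toWords_of_length_ne _ ht) fun a => ?_
  rw [toWords_ofFn]
  induction n with
  | zero =>
    have h_nil : ∀ b : Fin 0 → A, toWords 0 C [] = C b := fun b => by
      rw [← List.ofFn_zero (f := b), toWords_ofFn]
    have h_init : Fin.init a = Fin.tail a := Subsingleton.elim _ _
    rw [coboundary_apply, List.ofFn_succ, List.ofFn_zero, coboundary_cons]
    simp [env_smul_def, h_nil (Fin.tail a), h_init, mul_comm]
  | succ n ih =>
    have h_tail : List.ofFn (Fin.tail a) = a 1 :: List.ofFn (Fin.tail (Fin.tail a)) :=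
      List.ofFn_succ
    have h_slice : slice A (Env ℂ A) (a 0) (toWords (n + 1) C) = toWords n (C.curryLeft (a 0)) :=
      toWords_curryLeft C (a 0)
    rw [coboundary_succ_apply, List.ofFn_succ]
    change bimoduleCoboundary ℂ A A (toWords (n + 1) C) (a 0 :: List.ofFn (Fin.tail a)) = _
    rw [coboundary_cons, h_slice, ih, toWords_ofFn, h_tail, merge_cons, toWords_cons_ofFn,
      toWords_cons_ofFn]
    simp only [env_smul_def, envMul_left]

theorem adams_toWords (C : Cochain A n) :
    adams A (Env ℂ A) (toWords n C) = toWords n (adamsOperation A n C) := by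
  funext t
  obtain ⟨m, a, rfl⟩ : ∃ (m : ℕ) (a : Fin m → A), t = List.ofFn a :=
    ⟨t.length, t.get, (List.ofFn_get t).symm⟩
  rw [adams_ofFn]
  by_cases h : m = n
  · subst h
    rw [toWords_ofFn, adamsOperation_apply_eq_sum_sort]
    refine Finset.sum_congr rfl fun f _ => ?_
    rw [sortTerm, toWords_ofFn, env_smul_def, map_intCast, Int.cast_smul_eq_zsmul, zsmul_eq_mul]
  · rw [toWords_of_length_ne _ (by simpa using h)]
    refine Finset.sum_eq_zero fun f _ => ?_
    rw [sortTerm, toWords_of_length_ne _ (by simpa using h), smul_zero]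

theorem coboundary_adamsOperation (C : Cochain A n) :
    coboundary A n (adamsOperation A n C) = adamsOperation A (n + 1) (coboundary A n C) := by
  apply toWords_injective
  rw [← bimoduleCoboundary_toWords, ← adams_toWords, ← adams_toWords, ← bimoduleCoboundary_toWords]
  exact coboundary_adams _ _ (fun a m => by simp only [env_smul_def, envMul_left, envMul_right]) _

end ToWords

end Hochschild

/-! ### Hodge components in the small complex -/

namespace WordCochain

open Hochschild

section Weights

variable {A : Type*} [CommRing A] [Algebra ℂ A]

theorem pairContraction_adams (x : A) (T : Finset (A × A)) (F : List A → A) :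
    pairContraction ℂ A x T (adams A (Env ℂ A) F) =
      (2 : Env ℂ A) • adams A (Env ℂ A) (pairContraction ℂ A x T F) := by
  have h_symm (F : List A → A) : pairContraction ℂ A x T F = ∑ p ∈ T, left ℂ A p.2 •
      (contract A (Env ℂ A) [p.1, x] + contract A (Env ℂ A) [x, p.1]) F := by
    rw [pairContraction_apply]
    refine Finset.sum_congr rfl fun p _ => ?_
    rw [LinearMap.add_apply, smul_add]
    congr 1
    funext t
    simp [env_smul_def]
  rw [h_symm, h_symm, map_sum, Finset.smul_sum]
  refine Finset.sum_congr rfl fun p _ => ?_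
  rw [contract_symm_pair_adams, map_smul, smul_comm]

namespace DifferenceRelation

variable (D : DifferenceRelation ℂ A)

theorem omega_adams (F : List A → A) :
    D.omega A (adams A (Env ℂ A) F) = (2 : Env ℂ A) • adams A (Env ℂ A) (D.omega A F) := by
  rw [omega_apply, omega_apply, pairContraction_adams, pairContraction_adams, ← smul_add,
    ← map_add, map_smul, smul_comm]

theorem dpow_adams (k : ℕ) (F : List A → A) : D.dpow A k (adams A (Env ℂ A) F) =
    (2 : Env ℂ A) ^ k • adams A (Env ℂ A) (D.dpow A k F) := by
  have h_pow (F : List A → A) : (D.omega A ^ k) (adams A (Env ℂ A) F) =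
      (2 : Env ℂ A) ^ k • adams A (Env ℂ A) ((D.omega A ^ k) F) := by
    induction k generalizing F with
    | zero => simp
    | succ k ih =>
      rw [pow_succ, Module.End.mul_apply, Module.End.mul_apply, omega_adams, map_smul, ih,
        smul_smul, pow_succ, mul_comm]
  rw [dpow_apply, dpow_apply, h_pow, map_smul, smul_comm]

theorem toSmall_odd_adams (k : ℕ) (F : List A → A) :
    D.toSmall A (2 * k + 1) (adams A (Env ℂ A) F) =
      (2 : Env ℂ A) ^ (k + 1) • D.toSmall A (2 * k + 1) F := by
  simp only [toSmall_odd, dpow_adams, Pi.smul_apply, adams_singleton, Prod.smul_mk, smul_smul,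
    pow_succ]

theorem toSmall_even_adams (k : ℕ) (F : List A → A) :
    D.toSmall A (2 * (k + 1)) (adams A (Env ℂ A) F) =
      ((2 : Env ℂ A) ^ (k + 1) • (D.toSmall A (2 * (k + 1)) F).1,
        (2 : Env ℂ A) ^ (k + 2) • (D.toSmall A (2 * (k + 1)) F).2) := by
  simp only [toSmall_even, dpow_adams, Pi.smul_apply, adams_nil, ← smul_sub, adams_pair_sub_swap,
    smul_smul, ← pow_add]

end DifferenceRelation

end Weights

end WordCochain

namespace Hochschild

open WordCochain

universe u

section HodgeProjector

variable {A : Type*} [CommRing A] [Algebra ℂ A] {n k : ℕ}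

theorem hodgeProjector_mem (C : Cochain A n) : hodgeProjector A n k C ∈ hodgeCochains A n k :=
  ⟨C, rfl⟩

theorem coboundary_hodgeProjector (C : Cochain A n) :
    coboundary A n (hodgeProjector A n k C) = hodgeProjector A (n + 1) k (coboundary A n C) := by
  have h_zero := eq_zero_of_sum_eigenvectors_eq_zero (adamsOperation A (n + 1))
    (c := fun j => coboundary A n (hodgeProjector A n j C) -
      hodgeProjector A (n + 1) j (coboundary A n C)) (s := Finset.range (max (n + 1) k + 1))
    (fun j _ => by
      rw [map_sub, smul_sub, adamsOperation_hodgeProjector, ← coboundary_adamsOperation,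
        adamsOperation_hodgeProjector, map_smul])
    (by rw [Finset.sum_sub_distrib, ← map_sum, sum_hodgeProjector (by omega),
      sum_hodgeProjector (by omega), sub_self])
  exact sub_eq_zero.1 (h_zero k (Finset.mem_range.2 (by omega)))

theorem hodgeProjector_mem_hodgeCocycles {C : Cochain A n} (hC : C ∈ cocycles A n) :
    hodgeProjector A n k C ∈ hodgeCocycles A n k := by
  refine ⟨LinearMap.mem_ker.2 ?_, hodgeProjector_mem C⟩
  rw [coboundary_hodgeProjector, LinearMap.mem_ker.1 hC, map_zero]

theorem map_hodgeProjector_eq {W : Type*} [AddCommGroup W] [Module ℂ W]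
    (L : cocycles A n →ₗ[ℂ] W)
    (hL : ∀ j, j ≠ k → ∀ C (hC : C ∈ hodgeCocycles A n j), L ⟨C, hC.1⟩ = 0)
    {C : Cochain A n} (hC : C ∈ cocycles A n) :
    L ⟨hodgeProjector A n k C, (hodgeProjector_mem_hodgeCocycles hC).1⟩ = L ⟨C, hC⟩ := by
  have h_sum : (⟨C, hC⟩ : cocycles A n) = ∑ j ∈ Finset.range (max n k + 1),
      ⟨hodgeProjector A n j C, (hodgeProjector_mem_hodgeCocycles hC).1⟩ :=
    Subtype.ext (by rw [AddSubmonoidClass.coe_finsetSum, sum_hodgeProjector (by omega)])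
  rw [h_sum, map_sum, Finset.sum_eq_single k
    (fun j _ hj => hL j hj _ (hodgeProjector_mem_hodgeCocycles hC))
    (fun h => absurd (Finset.mem_range.2 (by omega)) h)]

end HodgeProjector

section SmallComponents

variable {A : Type u} [CommRing A] [Algebra ℂ A] (D : DifferenceRelation ℂ A)

/-- The comparison map from Hochschild cochains to the small complex. -/
def smallComponents (n : ℕ) : Cochain A n →ₗ[ℂ] A × A :=
  (D.toSmall A n).restrictScalars ℂ ∘ₗ toWords n

variable {D}

theorem smallComponents_apply (n : ℕ) (C : Cochain A n) :
    smallComponents D n C = D.toSmall A n (toWords n C) := rfl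

theorem toSmall_adams_of_mem {n j : ℕ} {C : Cochain A n} (hC : C ∈ hodgeCochains A n j) :
    D.toSmall A n (adams A (Env ℂ A) (toWords n C)) = (2 : ℂ) ^ j • smallComponents D n C := by
  rw [adams_toWords, mem_hodgeCochains.1 hC, map_smul, smallComponents_apply,
    LinearMap.map_smul_of_tower]

theorem eq_zero_of_two_pow_smul_eq {i j : ℕ} (hij : i ≠ j) {a : A}
    (h : (2 : Env ℂ A) ^ j • a = (2 : ℂ) ^ i • a) : a = 0 := by
  have h_pow : (2 : ℂ) ^ i - 2 ^ j ≠ 0 := sub_ne_zero.2 fun e => hij <|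
    Nat.pow_right_injective le_rfl (Nat.cast_injective (R := ℂ) (by push_cast; exact e))
  rw [env_smul_def, map_pow, map_ofNat, ← map_ofNat (algebraMap ℂ A), ← map_pow,
    ← Algebra.smul_def, eq_comm, ← sub_eq_zero, ← sub_smul] at h
  exact (smul_eq_zero.1 h).resolve_left h_pow

theorem smallComponents_odd_eq_zero {m j : ℕ} (hj : j ≠ m + 1) {C : Cochain A (2 * m + 1)}
    (hC : C ∈ hodgeCochains A (2 * m + 1) j) : smallComponents D (2 * m + 1) C = 0 := by
  have h := toSmall_adams_of_mem (D := D) hC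
  rw [D.toSmall_odd_adams, ← smallComponents_apply] at h
  exact Prod.ext (eq_zero_of_two_pow_smul_eq hj (congr_arg Prod.fst h))
    (eq_zero_of_two_pow_smul_eq hj (congr_arg Prod.snd h))

theorem smallComponents_even_fst_eq_zero {m j : ℕ} (hj : j ≠ m + 1)
    {C : Cochain A (2 * (m + 1))} (hC : C ∈ hodgeCochains A (2 * (m + 1)) j) :
    (smallComponents D (2 * (m + 1)) C).1 = 0 := by
  have h := toSmall_adams_of_mem (D := D) hC
  rw [D.toSmall_even_adams, ← smallComponents_apply] at h
  exact eq_zero_of_two_pow_smul_eq hj (congr_arg Prod.fst h)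

theorem smallComponents_even_snd_eq_zero {m j : ℕ} (hj : j ≠ m + 2)
    {C : Cochain A (2 * (m + 1))} (hC : C ∈ hodgeCochains A (2 * (m + 1)) j) :
    (smallComponents D (2 * (m + 1)) C).2 = 0 := by
  have h := toSmall_adams_of_mem (D := D) hC
  rw [D.toSmall_even_adams, ← smallComponents_apply] at h
  exact eq_zero_of_two_pow_smul_eq hj (congr_arg Prod.snd h)

theorem difference_smul (a b : A) : difference ℂ a • b = 0 := by
  rw [env_smul_def, envMul_difference, zero_mul]

theorem small_zero (c : A × A) : D.small A 0 c = 0 := by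
  rw [smallDifferential_zero, difference_smul, difference_smul]
  rfl

theorem small_odd (m : ℕ) (c : A × A) : D.small A (2 * m + 1) c =
    (envMul ℂ A D.symT * c.1 + envMul ℂ A D.symU * c.2, 0) := by
  rw [smallDifferential_odd, difference_smul, difference_smul, sub_zero]
  rfl

theorem small_even (m : ℕ) (c : A × A) : D.small A (2 * (m + 1)) c =
    (-(envMul ℂ A D.symU * c.2), envMul ℂ A D.symT * c.2) := by
  rw [smallDifferential_even, difference_smul, difference_smul, zero_add, zero_sub]
  rfl

theorem smallComponents_coboundary {n : ℕ} (C : Cochain A n) :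
    smallComponents D (n + 1) (coboundary A n C) = D.small A n (smallComponents D n C) := by
  rw [smallComponents_apply, ← bimoduleCoboundary_toWords,
    D.toSmall_bimoduleCoboundary n (isCochain_toWords C), smallComponents_apply]

theorem small_smallComponents {n : ℕ} {C : Cochain A n} (hC : C ∈ cocycles A n) :
    D.small A n (smallComponents D n C) = 0 := by
  rw [← smallComponents_coboundary, LinearMap.mem_ker.1 hC, map_zero]

variable (D) in
/-- The cocycles of the small complex. -/
def smallCocycles (n : ℕ) : Submodule ℂ (A × A) :=
  (LinearMap.ker (D.small A n)).restrictScalars ℂ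

variable (D) in
/-- The comparison map from Hochschild cocycles to cocycles of the small complex. -/
def toSmallCocycles (n : ℕ) : cocycles A n →ₗ[ℂ] smallCocycles D n :=
  (smallComponents D n).restrict fun _ hC => LinearMap.mem_ker.2 (small_smallComponents hC)

end SmallComponents

section Resolution

variable {A : Type u} [CommRing A] [Algebra ℂ A] {D : DifferenceRelation ℂ A}

theorem exists_coboundary_eq (hD : D.IsResolution) {n : ℕ} {C : Cochain A (n + 1)}
    (hC : C ∈ cocycles A (n + 1)) (c : A × A)
    (hc : D.small A n c = smallComponents D (n + 1) C) : ∃ B, coboundary A n B = C := by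
  obtain ⟨G, hG, h⟩ := (hD.isComparison n A).exists_primitive _ (isCochain_toWords C)
    (by rw [bimoduleCoboundary_toWords, LinearMap.mem_ker.1 hC, map_zero]) ⟨c, hc⟩
  obtain ⟨B, rfl⟩ := exists_toWords_eq hG
  rw [bimoduleCoboundary_toWords] at h
  exact ⟨B, toWords_injective _ h⟩

theorem exists_cocycle_smallComponents_eq (hD : D.IsResolution) (n : ℕ) {c : A × A}
    (hc : D.small A (n + 1) c = 0) :
    ∃ C ∈ cocycles A (n + 1), ∃ b, smallComponents D (n + 1) C = c + D.small A n b := by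
  obtain ⟨F, hF, h, b, hb⟩ := (hD.isComparison n A).exists_cocycle c hc
  obtain ⟨C, rfl⟩ := exists_toWords_eq hF
  refine ⟨C, LinearMap.mem_ker.2 (toWords_injective _ ?_), b, hb⟩
  rw [← bimoduleCoboundary_toWords, h, map_zero]

theorem mem_hodgeCoboundaries_iff (hD : D.IsResolution) {n j : ℕ} {C : Cochain A (n + 1)}
    (hC : C ∈ hodgeCocycles A (n + 1) j) : C ∈ hodgeCoboundaries A (n + 1) j ↔
      ∃ c, D.small A n c = smallComponents D (n + 1) C := by
  constructor
  · rintro ⟨B, -, rfl⟩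
    exact ⟨_, (smallComponents_coboundary B).symm⟩
  · rintro ⟨c, hc⟩
    obtain ⟨B, rfl⟩ := exists_coboundary_eq hD hC.1 c hc
    refine ⟨hodgeProjector A n j B, hodgeProjector_mem B, ?_⟩
    rw [coboundary_hodgeProjector, hodgeProjector_eq_self (mem_hodgeCochains.1 hC.2)]

theorem subsingleton_hodgeCohomology (hD : D.IsResolution) {n j : ℕ} (hn : 0 < n)
    (h0 : n ≠ 2 * j) (h1 : n + 1 ≠ 2 * j) (h2 : n + 2 ≠ 2 * j) :
    Subsingleton (HodgeCohomology A n j) := by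
  refine Submodule.Quotient.subsingleton_iff.2 (Submodule.submoduleOf_eq_top.2 fun C hC => ?_)
  obtain ⟨m, rfl | rfl⟩ := Nat.even_or_odd' n
  · obtain ⟨m, rfl⟩ : ∃ k, m = k + 1 := ⟨m - 1, by omega⟩
    refine (mem_hodgeCoboundaries_iff (n := 2 * m + 1) hD hC).2 ⟨0, ?_⟩
    rw [map_zero]
    exact (Prod.ext (smallComponents_even_fst_eq_zero (by omega) hC.2)
      (smallComponents_even_snd_eq_zero (by omega) hC.2)).symm
  · refine (mem_hodgeCoboundaries_iff hD hC).2 ⟨0, ?_⟩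
    rw [map_zero, smallComponents_odd_eq_zero (by omega) hC.2]

theorem nonempty_subquotient_equiv {V W : Type*} [AddCommGroup V] [Module ℂ V] [AddCommGroup W]
    [Module ℂ W] {Z B : Submodule ℂ V} (ψ : Z →ₗ[ℂ] W) (hψ : Function.Surjective ψ)
    (h_ker : ∀ z : Z, ψ z = 0 ↔ (z : V) ∈ B) : Nonempty (Subquotient Z B ≃ₗ[ℂ] W) := by
  have h_eq : B.submoduleOf Z = LinearMap.ker ψ := Submodule.ext fun z => (h_ker z).symm
  exact ⟨(Submodule.quotEquivOfEq _ _ h_eq).trans (ψ.quotKerEquivOfSurjective hψ)⟩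

variable {W : Type*} [AddCommGroup W] [Module ℂ W] {n : ℕ}

theorem exists_cocycle_map_eq (hD : D.IsResolution) (φ : smallCocycles D (n + 1) →ₗ[ℂ] W)
    (h_boundary : ∀ c : smallCocycles D (n + 1), (∃ b, D.small A n b = c) → φ c = 0)
    (c : smallCocycles D (n + 1)) : ∃ C, φ (toSmallCocycles D (n + 1) C) = φ c := by
  obtain ⟨C, hC, b, hb⟩ := exists_cocycle_smallComponents_eq hD n c.2
  refine ⟨⟨C, hC⟩, sub_eq_zero.1 ?_⟩
  rw [← map_sub]
  exact h_boundary _ ⟨b, (sub_eq_of_eq_add' hb).symm⟩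

theorem nonempty_cohomology_equiv (hD : D.IsResolution) (φ : smallCocycles D (n + 1) →ₗ[ℂ] W)
    (hφ : Function.Surjective φ)
    (h_ker : ∀ c : smallCocycles D (n + 1), φ c = 0 ↔ ∃ b, D.small A n b = c) :
    Nonempty (Cohomology A (n + 1) ≃ₗ[ℂ] W) := by
  refine nonempty_subquotient_equiv (φ ∘ₗ toSmallCocycles D (n + 1)) (fun w => ?_) fun C => ?_
  · obtain ⟨c, rfl⟩ := hφ w
    exact exists_cocycle_map_eq hD φ (fun c => (h_ker c).2) c
  · refine (h_ker _).trans ⟨fun ⟨b, hb⟩ => exists_coboundary_eq hD C.2 b hb, ?_⟩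
    rintro ⟨B, hB⟩
    exact ⟨smallComponents D n B, by rw [← smallComponents_coboundary, hB]; rfl⟩

theorem nonempty_hodgeCohomology_equiv (hD : D.IsResolution) {k : ℕ}
    (φ : smallCocycles D (n + 1) →ₗ[ℂ] W) (hφ : Function.Surjective φ)
    (h_boundary : ∀ c : smallCocycles D (n + 1), (∃ b, D.small A n b = c) → φ c = 0)
    (h_other : ∀ j, j ≠ k → ∀ C (hC : C ∈ hodgeCocycles A (n + 1) j),
      φ (toSmallCocycles D (n + 1) ⟨C, hC.1⟩) = 0)
    (h_ker : ∀ C (hC : C ∈ hodgeCocycles A (n + 1) k),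
      φ (toSmallCocycles D (n + 1) ⟨C, hC.1⟩) = 0 →
        ∃ b, D.small A n b = smallComponents D (n + 1) C) :
    Nonempty (HodgeCohomology A (n + 1) k ≃ₗ[ℂ] W) := by
  refine nonempty_subquotient_equiv
    ((φ ∘ₗ toSmallCocycles D (n + 1)) ∘ₗ Submodule.inclusion inf_le_left) (fun w => ?_) fun C => ?_
  · obtain ⟨c, rfl⟩ := hφ w
    obtain ⟨⟨C, hC⟩, h⟩ := exists_cocycle_map_eq hD φ h_boundary c
    exact ⟨⟨_, hodgeProjector_mem_hodgeCocycles hC⟩,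
      (map_hodgeProjector_eq (φ ∘ₗ toSmallCocycles D (n + 1)) h_other hC).trans h⟩
  · rw [mem_hodgeCoboundaries_iff hD C.2]
    exact ⟨h_ker C C.2, h_boundary (toSmallCocycles D (n + 1) ⟨C, C.2.1⟩)⟩

end Resolution

end Hochschild

/-! ### Hochschild cohomology of a plane curve -/

namespace PlaneCurve

open MvPolynomial Hochschild WordCochain

section PositivePart

theorem coeff_mul_eq_zero_of_forall_le {σ S : Type*} [CommSemiring S] {p : MvPolynomial σ S}
    (q : MvPolynomial σ S) {m : σ →₀ ℕ} (hp : ∀ l ≤ m, coeff l p = 0) : coeff m (p * q) = 0 := by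
  classical
  rw [coeff_mul]
  refine Finset.sum_eq_zero fun l hl => ?_
  rw [hp l.1 (Finset.HasAntidiagonal.mem_antidiagonal.1 hl ▸ le_self_add), zero_mul]

theorem coeff_mul_of_forall_lt {σ S : Type*} [CommSemiring S] (p : MvPolynomial σ S)
    {q : MvPolynomial σ S} {m : σ →₀ ℕ} (hq : ∀ l < m, coeff l q = 0) :
    coeff m (p * q) = constantCoeff p * coeff m q := by
  classical
  rw [coeff_mul, Finset.sum_eq_single (0, m)]
  · rfl
  · rintro ⟨k, l⟩ hkl h_ne
    have h_add : k + l = m := Finset.HasAntidiagonal.mem_antidiagonal.1 hkl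
    have hl : l < m := lt_of_le_of_ne (h_add ▸ le_add_self) fun h_eq =>
      h_ne (Prod.ext (add_eq_right.1 (h_eq ▸ h_add)) h_eq)
    rw [hq l hl, mul_zero]
  · exact fun h => absurd (Finset.HasAntidiagonal.mem_antidiagonal.2 (zero_add m)) h

theorem eq_zero_of_dvd_mul_pderiv {σ S : Type*} [CommRing S] [IsDomain S] [CharZero S]
    {f R : MvPolynomial σ S} (hf : constantCoeff f ≠ 0) (h_dvd : ∀ i, R ∣ f * pderiv i R)
    (hR : constantCoeff R = 0) : R = 0 := by
  classical
  ext m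
  rw [coeff_zero]
  induction m using WellFoundedLT.induction with
  | ind m ih =>
    obtain rfl | hm := eq_or_ne m 0
    · exact hR
    obtain ⟨i, hi⟩ := Finsupp.ne_iff.1 hm
    obtain ⟨l, rfl⟩ : ∃ l, m = l + Finsupp.single i 1 := ⟨m - Finsupp.single i 1,
      (tsub_add_cancel_of_le (Finsupp.single_le_iff.2 (Nat.one_le_iff_ne_zero.2 hi))).symm⟩
    have h_lt : l < l + Finsupp.single i 1 :=
      lt_add_of_pos_right l (pos_iff_ne_zero.2 (Finsupp.single_ne_zero.2 one_ne_zero))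
    obtain ⟨g, hg⟩ := h_dvd i
    have h_coeff : constantCoeff f * coeff l (pderiv i R) = 0 := by
      rw [← coeff_mul_of_forall_lt, hg]
      · exact coeff_mul_eq_zero_of_forall_le g fun k hk => ih k (hk.trans_lt h_lt)
      · intro k hk
        rw [coeff_pderiv, ih _ (add_lt_add_left hk _), zero_mul]
    rw [coeff_pderiv] at h_coeff
    exact (mul_eq_zero.1 ((mul_eq_zero.1 h_coeff).resolve_left hf)).resolve_right
      (Nat.cast_add_one_ne_zero _)

variable {R : MvPolynomial (Fin 2) ℂ}

theorem mk_mem_positivePart {f : MvPolynomial (Fin 2) ℂ} (hf : constantCoeff f = 0) :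
    Ideal.Quotient.mk (Ideal.span {R}) f ∈ positivePart R :=
  Ideal.mem_map_of_mem _ (RingHom.mem_ker.2 hf)

theorem mem_positivePart_of_mul_partialR_eq_zero (hR : R ≠ 0) {a : CoordRing R}
    (ha : ∀ i, a * partialR R i = 0) : a ∈ positivePart R := by
  obtain ⟨f, rfl⟩ := Ideal.Quotient.mk_surjective a
  by_cases hf : constantCoeff f = 0
  · exact mk_mem_positivePart hf
  have h_dvd (i : Fin 2) : R ∣ f * pderiv i R := by
    rw [← Ideal.mem_span_singleton, ← Ideal.Quotient.eq_zero_iff_mem, map_mul]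
    exact ha i
  have hR0 : constantCoeff R ≠ 0 := fun h => hR (eq_zero_of_dvd_mul_pderiv hf h_dvd h)
  have h_mk : Ideal.Quotient.mk (Ideal.span {R}) f =
      Ideal.Quotient.mk (Ideal.span {R}) (f - C (constantCoeff f / constantCoeff R) * R) := by
    rw [map_sub, map_mul, Ideal.Quotient.eq_zero_iff_mem.2 (Ideal.mem_span_singleton_self R),
      mul_zero, sub_zero]
  rw [h_mk]
  refine mk_mem_positivePart ?_
  rw [map_sub, map_mul, constantCoeff_C, div_mul_cancel₀ _ hR0, sub_self]

theorem mem_gradientAnnihilator (hR : R ≠ 0) {a : CoordRing R} :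
    a ∈ gradientAnnihilator R ↔ partialR R 0 * a = 0 ∧ partialR R 1 * a = 0 := by
  rw [← Fin.forall_fin_two (p := fun i => partialR R i * a = 0)]
  simp only [mul_comm _ a]
  exact ⟨And.right, fun h => ⟨mem_positivePart_of_mul_partialR_eq_zero hR h, h⟩⟩

end PositivePart

section VectorFields

variable (R : MvPolynomial (Fin 2) ℂ)

/-- The vector field with given components. -/
def fieldOf : CoordRing R × CoordRing R →ₗ[ℂ] VectorField R where
  toFun c := mkDerivation ℂ ![c.1, c.2]
  map_add' c d := derivation_ext fun i => by fin_cases i <;> simp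
  map_smul' s c := derivation_ext fun i => by fin_cases i <;> simp

theorem fieldOf_X_zero (c : CoordRing R × CoordRing R) : fieldOf R c (X 0) = c.1 := by
  simp [fieldOf]

theorem fieldOf_X_one (c : CoordRing R × CoordRing R) : fieldOf R c (X 1) = c.2 := by
  simp [fieldOf]

theorem fieldOf_components (v : VectorField R) : fieldOf R (v (X 0), v (X 1)) = v :=
  derivation_ext fun i => by
    fin_cases i
    · exact fieldOf_X_zero R _
    · exact fieldOf_X_one R _

theorem fieldOf_injective : Function.Injective (fieldOf R) := fun c d h =>
  Prod.ext (by rw [← fieldOf_X_zero, h, fieldOf_X_zero]) (by rw [← fieldOf_X_one, h, fieldOf_X_one])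

theorem fieldOf_apply (c : CoordRing R × CoordRing R) (f : MvPolynomial (Fin 2) ℂ) :
    fieldOf R c f = Ideal.Quotient.mk (Ideal.span {R}) (pderiv 0 f) * c.1 +
      Ideal.Quotient.mk (Ideal.span {R}) (pderiv 1 f) * c.2 := by
  have h_eq : fieldOf R c =
      c.1 • (Algebra.linearMap (MvPolynomial (Fin 2) ℂ) (CoordRing R)).compDer
          (pderiv (R := ℂ) (0 : Fin 2)) +
        c.2 • (Algebra.linearMap (MvPolynomial (Fin 2) ℂ) (CoordRing R)).compDer
          (pderiv (R := ℂ) (1 : Fin 2)) := by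
    refine derivation_ext fun i => ?_
    fin_cases i <;> simp [fieldOf, pderiv_X]
  rw [h_eq, mul_comm, mul_comm _ c.2]
  rfl

variable {R}

theorem fieldOf_mem_tangentFields {c : CoordRing R × CoordRing R} :
    fieldOf R c ∈ tangentFields R ↔ partialR R 0 * c.1 + partialR R 1 * c.2 = 0 := by
  change fieldOf R c R = 0 ↔ _
  rw [fieldOf_apply]
  rfl

theorem fieldOf_mem_dualGradientMultiples {c : CoordRing R × CoordRing R} :
    fieldOf R c ∈ dualGradientMultiples R ↔
      ∃ b, (-(partialR R 1 * b), partialR R 0 * b) = c := by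
  have h_smul (b : CoordRing R) :
      fieldOf R (-(partialR R 1 * b), partialR R 0 * b) = (-b) • dualGradient R :=
    derivation_ext fun i => by
      fin_cases i <;> simp [fieldOf, dualGradient] <;> ring
  constructor
  · intro h
    obtain ⟨a, ha⟩ := Submodule.mem_span_singleton.1 h
    exact ⟨-a, fieldOf_injective R (by rw [h_smul, neg_neg, ha])⟩
  · rintro ⟨b, rfl⟩
    rw [h_smul]
    exact Submodule.mem_span_singleton.2 ⟨-b, rfl⟩

theorem mem_gradientIdeal {a : CoordRing R} :
    a ∈ gradientIdeal R ↔ ∃ c : CoordRing R × CoordRing R,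
      partialR R 0 * c.1 + partialR R 1 * c.2 = a := by
  have h_range : Set.range (partialR R) = {partialR R 0, partialR R 1} := by
    ext b
    simp [Fin.exists_fin_two, eq_comm]
  simp only [gradientIdeal, h_range, Ideal.mem_span_pair, Prod.exists, mul_comm (partialR R _)]

end VectorFields

section Cohomology

variable {R : MvPolynomial (Fin 2) ℂ} {D : DifferenceRelation ℂ (CoordRing R)}

/-- `D` gives a resolution, and its matrix factorization restricts to the gradient of `R` on the
diagonal. -/
structure IsGradientResolution (D : DifferenceRelation ℂ (CoordRing R)) : Prop where
  isResolution : D.IsResolution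
  envMul_symT : envMul ℂ (CoordRing R) D.symT = partialR R 0
  envMul_symU : envMul ℂ (CoordRing R) D.symU = partialR R 1

theorem exists_isGradientResolution (hR : R ≠ 0) :
    ∃ D : DifferenceRelation ℂ (CoordRing R), IsGradientResolution D :=
  let ⟨D, hD, hT, hU⟩ := exists_isResolution (f := Ideal.Quotient.mkₐ ℂ (Ideal.span {R}))
    (Ideal.Quotient.mkₐ_surjective ℂ _) (Ideal.Quotient.mkₐ_ker ℂ _) hR
  ⟨D, hD, hT, hU⟩

namespace IsGradientResolution

theorem small_odd (hD : IsGradientResolution D) (m : ℕ) (c : CoordRing R × CoordRing R) :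
    D.small (CoordRing R) (2 * m + 1) c = (partialR R 0 * c.1 + partialR R 1 * c.2, 0) := by
  rw [Hochschild.small_odd, hD.envMul_symT, hD.envMul_symU]

theorem small_even (hD : IsGradientResolution D) (m : ℕ) (c : CoordRing R × CoordRing R) :
    D.small (CoordRing R) (2 * (m + 1)) c = (-(partialR R 1 * c.2), partialR R 0 * c.2) := by
  rw [Hochschild.small_even, hD.envMul_symT, hD.envMul_symU]

theorem mem_smallCocycles_odd (hD : IsGradientResolution D) {m : ℕ}
    {c : CoordRing R × CoordRing R} :
    c ∈ smallCocycles D (2 * m + 1) ↔ fieldOf R c ∈ tangentFields R := by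
  rw [fieldOf_mem_tangentFields]
  change D.small (CoordRing R) (2 * m + 1) c = 0 ↔ _
  rw [hD.small_odd, Prod.mk_eq_zero, and_iff_left rfl]

theorem mem_smallCocycles_even (hD : IsGradientResolution D) (hR : R ≠ 0) {m : ℕ}
    {c : CoordRing R × CoordRing R} :
    c ∈ smallCocycles D (2 * (m + 1)) ↔ c.2 ∈ gradientAnnihilator R := by
  rw [mem_gradientAnnihilator hR]
  change D.small (CoordRing R) (2 * (m + 1)) c = 0 ↔ _
  rw [hD.small_even, Prod.mk_eq_zero, neg_eq_zero, and_comm]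

/-- The vector field attached to a cocycle of odd degree of the small complex. -/
def tangentFieldOf (hD : IsGradientResolution D) (m : ℕ) :
    smallCocycles D (2 * m + 1) →ₗ[ℂ] tangentFields R :=
  (fieldOf R).restrict fun _ => hD.mem_smallCocycles_odd.1

theorem tangentFieldOf_surjective (hD : IsGradientResolution D) (m : ℕ) :
    Function.Surjective (hD.tangentFieldOf m) := fun v =>
  ⟨⟨_, hD.mem_smallCocycles_odd.2 (by rw [fieldOf_components]; exact v.2)⟩,
    Subtype.ext (fieldOf_components R v)⟩

theorem nonempty_cohomology_one (hD : IsGradientResolution D) :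
    Nonempty (Cohomology (CoordRing R) 1 ≃ₗ[ℂ] tangentFields R) := by
  refine nonempty_cohomology_equiv (n := 0) (W := tangentFields R) hD.isResolution
    (hD.tangentFieldOf 0) (hD.tangentFieldOf_surjective 0) fun c => ?_
  simp only [Hochschild.small_zero, exists_const]
  rw [← Submodule.coe_eq_zero, @eq_comm _ 0]
  exact map_eq_zero_iff _ (fieldOf_injective R)

theorem nonempty_hodgeCohomology_even (hD : IsGradientResolution D) (m : ℕ) :
    Nonempty (HodgeCohomology (CoordRing R) (2 * (m + 1)) (m + 1) ≃ₗ[ℂ]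
      (CoordRing R ⧸ gradientIdeal R)) := by
  refine nonempty_hodgeCohomology_equiv (n := 2 * m + 1) hD.isResolution
    ((Ideal.Quotient.mkₐ ℂ (gradientIdeal R)).toLinearMap ∘ₗ LinearMap.fst ℂ _ _ ∘ₗ
      (smallCocycles D (2 * (m + 1))).subtype) ?_ ?_ ?_ ?_
  · intro w
    obtain ⟨a, rfl⟩ := Ideal.Quotient.mk_surjective w
    have h_mem : (a, 0) ∈ smallCocycles D (2 * (m + 1)) := by
      change D.small (CoordRing R) (2 * (m + 1)) (a, 0) = 0
      simp [hD.small_even]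
    exact ⟨⟨_, h_mem⟩, rfl⟩
  · rintro c ⟨b, hb⟩
    rw [hD.small_odd] at hb
    exact Ideal.Quotient.eq_zero_iff_mem.2 (mem_gradientIdeal.2 ⟨b, congr_arg Prod.fst hb⟩)
  · intro j hj C hC
    exact (congr_arg (Ideal.Quotient.mk (gradientIdeal R))
      (smallComponents_even_fst_eq_zero hj hC.2)).trans (map_zero _)
  · intro C hC h
    obtain ⟨b, hb⟩ := mem_gradientIdeal.1 (Ideal.Quotient.eq_zero_iff_mem.1 h)
    have h_snd := smallComponents_even_snd_eq_zero (D := D) (by omega) hC.2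
    exact ⟨b, by rw [hD.small_odd]; exact Prod.ext hb h_snd.symm⟩

theorem nonempty_hodgeCohomology_even_succ (hD : IsGradientResolution D) (hR : R ≠ 0) (m : ℕ) :
    Nonempty (HodgeCohomology (CoordRing R) (2 * (m + 1)) (m + 2) ≃ₗ[ℂ]
      gradientAnnihilator R) := by
  refine nonempty_hodgeCohomology_equiv (n := 2 * m + 1) hD.isResolution
    ((LinearMap.snd ℂ _ _).restrict fun _ => (hD.mem_smallCocycles_even hR (m := m)).1) ?_ ?_ ?_ ?_
  · exact fun a => ⟨⟨(0, a), (hD.mem_smallCocycles_even hR).2 a.2⟩, rfl⟩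
  · rintro c ⟨b, hb⟩
    rw [hD.small_odd] at hb
    exact Subtype.ext (congr_arg Prod.snd hb).symm
  · exact fun j hj C hC => Subtype.ext (smallComponents_even_snd_eq_zero hj hC.2)
  · intro C hC h
    have h_fst := smallComponents_even_fst_eq_zero (D := D) (by omega) hC.2
    exact ⟨0, by rw [map_zero]; exact (Prod.ext h_fst (congr_arg Subtype.val h)).symm⟩

theorem nonempty_hodgeCohomology_odd (hD : IsGradientResolution D) (m : ℕ) :
    Nonempty (HodgeCohomology (CoordRing R) (2 * (m + 1) + 1) (m + 2) ≃ₗ[ℂ]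
      Subquotient (tangentFields R) (dualGradientMultiples R)) := by
  have h_eq_zero_iff (c : smallCocycles D (2 * (m + 1) + 1)) :
      Submodule.mkQ ((dualGradientMultiples R).submoduleOf (tangentFields R))
        (hD.tangentFieldOf (m + 1) c) = 0 ↔ ∃ b, D.small (CoordRing R) (2 * (m + 1)) b = c := by
    simp only [hD.small_even, Prod.exists, exists_const, Submodule.mkQ_apply,
      Submodule.Quotient.mk_eq_zero]
    exact fieldOf_mem_dualGradientMultiples
  refine nonempty_hodgeCohomology_equiv hD.isResolution
    (Submodule.mkQ _ ∘ₗ hD.tangentFieldOf (m + 1))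
    ((Submodule.mkQ_surjective _).comp (hD.tangentFieldOf_surjective _))
    (fun c => (h_eq_zero_iff c).2) ?_ fun C hC => (h_eq_zero_iff _).1
  intro j hj C hC
  have h_zero : toSmallCocycles D (2 * (m + 1) + 1) ⟨C, hC.1⟩ = 0 :=
    Subtype.ext (smallComponents_odd_eq_zero hj hC.2)
  rw [h_zero, map_zero]

end IsGradientResolution

end Cohomology

end PlaneCurve

end

theorem theorem4p9 (R : MvPolynomial (Fin 2) ℂ) (hR : R ≠ 0) :
    Nonempty (Hochschild.Cohomology (PlaneCurve.CoordRing R) 1 ≃ₗ[ℂ]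
      PlaneCurve.tangentFields R) ∧
    (∀ k : ℕ, 0 < k →
      Nonempty (Hochschild.HodgeCohomology (PlaneCurve.CoordRing R) (2 * k) k ≃ₗ[ℂ]
        (PlaneCurve.CoordRing R ⧸ PlaneCurve.gradientIdeal R)) ∧
      Nonempty (Hochschild.HodgeCohomology (PlaneCurve.CoordRing R) (2 * k) (k + 1) ≃ₗ[ℂ]
        PlaneCurve.gradientAnnihilator R) ∧
      Nonempty (Hochschild.HodgeCohomology (PlaneCurve.CoordRing R) (2 * k + 1) (k + 1) ≃ₗ[ℂ]
        Subquotient (PlaneCurve.tangentFields R) (PlaneCurve.dualGradientMultiples R))) ∧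
    (∀ n j : ℕ, 0 < n → n ≠ 2 * j → n + 1 ≠ 2 * j → n + 2 ≠ 2 * j →
      Subsingleton (Hochschild.HodgeCohomology (PlaneCurve.CoordRing R) n j)) := by
  obtain ⟨D, hD⟩ := PlaneCurve.exists_isGradientResolution hR
  refine ⟨hD.nonempty_cohomology_one, fun k hk => ?_, fun n j hn h0 h1 h2 =>
    Hochschild.subsingleton_hodgeCohomology hD.isResolution hn h0 h1 h2⟩
  obtain ⟨m, rfl⟩ : ∃ m, k = m + 1 := ⟨k - 1, by omega⟩
  exact ⟨hD.nonempty_hodgeCohomology_even m, hD.nonempty_hodgeCohomology_even_succ hR m,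
    hD.nonempty_hodgeCohomology_odd m⟩
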